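/- Let $d\ge 1$, $T>0$, let $\Omega=\prod_{i=1}^d (l_i,r_i)\subset\mathbb R^d$ with $l_i<r_i$ be a bounded open box, $Q=(0,T)\times\Omega$, and write $\|\cdot\|_p$ for the norm of $L^p(\Omega)$. A *nonnegative strong solution* of $\partial_t u=\tfrac12\Delta u^2$ in $Q$ with zero Dirichlet data and initial datum $u_0$ is a function $u\ge 0$ with $u\in C([0,T];L^1(\Omega))$ and $u(0)=u_0$ such that $u^2\in L^1_{loc}(0,T;W^{1,1}_0(\Omega))$, the distributional derivatives $\partial_t u$ and $\Delta u^2$ belong to $L^1_{loc}(0,T;L^1(\Omega))$, and $\partial_t u=\tfrac12\Delta u^2$ a.e. in $Q$. For weights $\kappa,\nu>0$, $\mu\ge 0$ and $p\in\{1,2\}$, define for functions $\hat u$ smooth on $[0,T]\times\overline\Omega$ $$\mathcal L_{\mathrm{PINN}\text{-}L^p}(\hat u)=\kappa\int_Q\bigl|\partial_t\hat u-\tfrac12\Delta\hat u^2\bigr|^p\,dx\,dt+\mu\int_{[0,T]\times\partial\Omega}|\hat u|^p\,d\sigma\,dt+\nu\int_\Omega|\hat u(0,x)-u_0(x)|^p\,dx\in[0,\infty],$$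 where $\sigma$ is the surface measure on $\partial\Omega$. Then there is a constant $C>0$ depending only on $\Omega$ and $T$, and constants $\tilde C_1,\tilde C_2>0$ depending only on $\Omega,T,\kappa,\mu,\nu$, such that for every $u_0$, every nonnegative strong solution $u$ with initial datum $u_0$, every $\hat u$ that is $C^\infty$ on $[0,T]\times\overline\Omega$ (of any sign) and vanishes on $[0,T]\times\partial\Omega$, and every $t\in[0,T]$, $$\|u(t)-\hat u(t)\|_1\le \|u_0-\hat u(0)\|_1+\int_0^t\bigl\|\partial_t\hat u-\tfrac12\Delta\hat u^2\bigr\|_1\,ds\le \tilde C_1\,\mathcal L_{\mathrm{PINN}\text{-}L^1}(\hat u)$$ and $$\|u(t)-\hat u(t)\|_1^2\le C\Bigl(\|u_0-\hat u(0)\|_2^2+\int_0^t\bigl\|\partial_t\hat u-\tfrac12\Delta\hat u^2\bigr\|_2^2\,ds\Bigr)\le \tilde C_2\,\mathcal L_{\mathrm{PINN}\text{-}L^2}(\hat u)$$ (right-hand sides may be $+\infty$ in the second chain when $u_0\notin L^2(\Omega)$). Consequently, if $(\hat u_n)$ is a sequence of such functions with $\mathcal L_{\mathrm{PINN}\text{-}L^1}(\hat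 u_n)\to0$ or $\mathcal L_{\mathrm{PINN}\text{-}L^2}(\hat u_n)\to 0$, then $\sup_{t\in[0,T]}\|u(t)-\hat u_n(t)\|_1\to 0$. -/

import Mathlib

open Set Filter Topology MeasureTheory
open scoped NNReal ENNReal ContDiff MeasureTheory

namespace QPME

/-- The open box `Ω = ∏ᵢ (lᵢ, rᵢ)` in `ℝᵈ`. -/
def box {d : ℕ} (l r : Fin d → ℝ) : Set (EuclideanSpace ℝ (Fin d)) :=
  {x | ∀ i, l i < x i ∧ x i < r i}

/-- Lebesgue measure on the box. -/
noncomputable def boxMeasure {d : ℕ} (l r : Fin d → ℝ) : Measure (EuclideanSpace ℝ (Fin d)) :=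
  volume.restrict (box l r)

/-- The open space-time cylinder `(0, T) × Ω`. -/
def cylinder {d : ℕ} (l r : Fin d → ℝ) (T : ℝ) : Set (ℝ × EuclideanSpace ℝ (Fin d)) :=
  Ioo 0 T ×ˢ box l r

/-- `g ∈ L¹_loc(0, T; L¹(Ω))` (values in `F`): integrable over `[t₁, t₂] × Ω`
whenever `0 < t₁` and `t₂ < T`. -/
def LocTimeIntegrable {d : ℕ} {F : Type*} [NormedAddCommGroup F] (l r : Fin d → ℝ) (T : ℝ)
    (g : ℝ → EuclideanSpace ℝ (Fin d) → F) : Prop :=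
  ∀ t₁ t₂ : ℝ, 0 < t₁ → t₂ < T →
    IntegrableOn (fun p : ℝ × EuclideanSpace ℝ (Fin d) => g p.1 p.2) (Icc t₁ t₂ ×ˢ box l r)

/-- Smooth test functions compactly supported in an open set `U`. -/
structure IsTestFunction {V : Type*} [NormedAddCommGroup V] [NormedSpace ℝ V] (U : Set V)
    (φ : V → ℝ) : Prop where
  smooth : ContDiff ℝ ∞ φ
  compact_support : HasCompactSupport φ
  support_subset : tsupport φ ⊆ U

/-- `g` is the distributional time derivative of `u` in `(0, T) × Ω`. -/
def HasWeakTimeDeriv {d : ℕ} (l r : Fin d → ℝ) (T : ℝ)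
    (u g : ℝ → EuclideanSpace ℝ (Fin d) → ℝ) : Prop :=
  ∀ φ : ℝ × EuclideanSpace ℝ (Fin d) → ℝ, IsTestFunction (cylinder l r T) φ →
    ∫ p in cylinder l r T, u p.1 p.2 * deriv (fun s => φ (s, p.2)) p.1 =
      -∫ p in cylinder l r T, g p.1 p.2 * φ p

/-- `g` is the distributional spatial Laplacian of `w` in `(0, T) × Ω`. -/
def HasWeakLaplacian {d : ℕ} (l r : Fin d → ℝ) (T : ℝ)
    (w g : ℝ → EuclideanSpace ℝ (Fin d) → ℝ) : Prop :=
  ∀ φ : ℝ × EuclideanSpace ℝ (Fin d) → ℝ, IsTestFunction (cylinder l r T) φ →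
    ∫ p in cylinder l r T, w p.1 p.2 * Laplacian.laplacian (fun y => φ (p.1, y)) p.2 =
      ∫ p in cylinder l r T, g p.1 p.2 * φ p

/-- `w` belongs to `W₀^{1,1}(Ω)`, the closure of the test functions in `W^{1,1}(Ω)`, and `G` is
its weak gradient. -/
def HasZeroTraceGradient {d : ℕ} (l r : Fin d → ℝ) (w : EuclideanSpace ℝ (Fin d) → ℝ)
    (G : EuclideanSpace ℝ (Fin d) → EuclideanSpace ℝ (Fin d)) : Prop :=
  MemLp w 1 (boxMeasure l r) ∧ MemLp G 1 (boxMeasure l r) ∧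
  ∃ φ : ℕ → EuclideanSpace ℝ (Fin d) → ℝ, (∀ n, IsTestFunction (box l r) (φ n)) ∧
    Tendsto (fun n => eLpNorm (fun x => φ n x - w x) 1 (boxMeasure l r)) atTop (𝓝 0) ∧
    Tendsto (fun n => eLpNorm (fun x => gradient (φ n) x - G x) 1 (boxMeasure l r)) atTop (𝓝 0)

/-- Nonnegative strong solutions of `∂ₜ u = ½ Δ u²` in `(0, T) × Ω` with `u = 0` on the lateral
boundary and `u(0) = u₀`. -/
structure IsStrongSolution {d : ℕ} (l r : Fin d → ℝ) (T : ℝ)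
    (u₀ : EuclideanSpace ℝ (Fin d) → ℝ) (u : ℝ → EuclideanSpace ℝ (Fin d) → ℝ) : Prop where
  /-- joint measurability -/
  measurable : AEStronglyMeasurable (fun p : ℝ × EuclideanSpace ℝ (Fin d) => u p.1 p.2)
    (volume.restrict (cylinder l r T))
  /-- `u ∈ C([0, T]; L¹(Ω))`: values in `L¹(Ω)` … -/
  memLp : ∀ t ∈ Icc 0 T, MemLp (u t) 1 (boxMeasure l r)
  /-- … and continuity in time with respect to the `L¹(Ω)` norm -/
  continuous : ∀ t ∈ Icc 0 T,
    Tendsto (fun s => eLpNorm (fun x => u s x - u t x) 1 (boxMeasure l r)) (𝓝[Icc 0 T] t) (𝓝 0)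
  /-- `u ≥ 0` -/
  nonneg : ∀ t ∈ Icc 0 T, ∀ᵐ x ∂(boxMeasure l r), 0 ≤ u t x
  /-- initial condition -/
  initial : ∀ᵐ x ∂(boxMeasure l r), u 0 x = u₀ x
  /-- Dirichlet condition: `u² ∈ L¹_loc(0, T; W₀^{1,1}(Ω))` -/
  sq_integrable : LocTimeIntegrable l r T (fun t x => u t x ^ 2)
  dirichlet : ∃ G : ℝ → EuclideanSpace ℝ (Fin d) → EuclideanSpace ℝ (Fin d),
    LocTimeIntegrable l r T G ∧
    ∀ᵐ t ∂(volume.restrict (Ioo 0 T)), HasZeroTraceGradient l r (fun x => u t x ^ 2) (G t)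
  /-- `∂ₜ u` and `Δ u²` are in `L¹_loc(0, T; L¹(Ω))`, and the equation holds a.e. -/
  equation : ∃ ut lap : ℝ → EuclideanSpace ℝ (Fin d) → ℝ,
    LocTimeIntegrable l r T ut ∧ LocTimeIntegrable l r T lap ∧
    HasWeakTimeDeriv l r T u ut ∧ HasWeakLaplacian l r T (fun t x => u t x ^ 2) lap ∧
    ∀ᵐ p ∂(volume.restrict (cylinder l r T)), ut p.1 p.2 = (1 / 2 : ℝ) * lap p.1 p.2

/-- Functions smooth on `[0, T] × Ω̄` that vanish on the lateral boundary `[0, T] × ∂Ω`. -/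
structure IsAdmissible {d : ℕ} (l r : Fin d → ℝ) (T : ℝ)
    (v : ℝ → EuclideanSpace ℝ (Fin d) → ℝ) : Prop where
  smooth : ContDiffOn ℝ ∞ (fun p : ℝ × EuclideanSpace ℝ (Fin d) => v p.1 p.2)
    (Icc 0 T ×ˢ closure (box l r))
  boundary : ∀ t ∈ Icc 0 T, ∀ x ∈ frontier (box l r), v t x = 0

/-- The residual `∂ₜ v - ½ Δ v²`. -/
noncomputable def residual {d : ℕ} (v : ℝ → EuclideanSpace ℝ (Fin d) → ℝ) (t : ℝ)
    (x : EuclideanSpace ℝ (Fin d)) : ℝ :=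
  deriv (fun s => v s x) t - (1 / 2 : ℝ) * Laplacian.laplacian (fun y => v t y ^ 2) x

/-- `∫_Q |∂ₜ v - ½ Δ v²|ᵖ`. -/
noncomputable def lossPDE {d : ℕ} (p : ℕ) (l r : Fin d → ℝ) (T : ℝ)
    (v : ℝ → EuclideanSpace ℝ (Fin d) → ℝ) : ℝ≥0∞ :=
  ∫⁻ q in cylinder l r T, ‖residual v q.1 q.2‖ₑ ^ p

/-- `∫_{[0,T] × ∂Ω} |v|ᵖ`, with the `(d-1)`-dimensional surface measure on `∂Ω`. -/
noncomputable def lossBoundary {d : ℕ} (p : ℕ) (l r : Fin d → ℝ) (T : ℝ)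
    (v : ℝ → EuclideanSpace ℝ (Fin d) → ℝ) : ℝ≥0∞ :=
  ∫⁻ t in Icc 0 T, ∫⁻ x in frontier (box l r), ‖v t x‖ₑ ^ p ∂μHE[d - 1]

/-- `∫_Ω |v(0) - u₀|ᵖ`. -/
noncomputable def lossInitial {d : ℕ} (p : ℕ) (l r : Fin d → ℝ)
    (u₀ : EuclideanSpace ℝ (Fin d) → ℝ) (v : ℝ → EuclideanSpace ℝ (Fin d) → ℝ) : ℝ≥0∞ :=
  ∫⁻ x in box l r, ‖v 0 x - u₀ x‖ₑ ^ p

/-- The `Lᵖ` PINN loss with weights `κ`, `μ`, `ν` (possibly infinite when `v(0) - u₀ ∉ Lᵖ`). -/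
noncomputable def pinnLoss {d : ℕ} (p : ℕ) (l r : Fin d → ℝ) (T : ℝ) (κ μ ν : ℝ≥0)
    (u₀ : EuclideanSpace ℝ (Fin d) → ℝ) (v : ℝ → EuclideanSpace ℝ (Fin d) → ℝ) : ℝ≥0∞ :=
  κ * lossPDE p l r T v + μ * lossBoundary p l r T v + ν * lossInitial p l r u₀ v

end QPME

set_option linter.unusedSectionVars false

namespace QPME

/-! ### Second-order calculus and integration by parts for the Laplacian -/

section Calculus

variable {E : Type*} [NormedAddCommGroup E] [InnerProductSpace ℝ E] [FiniteDimensional ℝ E]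

/-! The estimate is the L¹ contraction principle of the porous medium equation, with the competitor
`v` regarded as a solution driven by its own residual. If `w` is nonnegative, then `sign (u - w) =
sign (u² - w²)`. Hence the time derivative of `∫ |u - w|` is at most `½ ∫ sign (u² - w²) Δ(u² - w²)`
plus the L¹ norm of the residual of `w`, and the first term is nonpositive by Kato's inequality for
functions with zero trace (`kato_box`).

Kato's inequality is first proved in the interior by mollification and convex entropies
(`kato_local`). To reach the boundary, the test functions are cutoffs of `1 - exp (-k e)`, where `e`
is the product barrier of the box. The function `e` is superharmonic and vanishes on the boundary,
so the cutoff can be removed at fixed `k` through gradient terms only. What remains is the integral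
of a nonnegative entropy against a nonpositive Laplacian. Sending `k → ∞` and then the entropy to
the absolute value gives the inequality (`kato_box_barrier`, `kato_box_entropy`).

The competitor may change sign, and where it is negative the identity of signs fails. Since `u ≥ 0`,
however, `|u - v| = |u - v⁺| + v⁻`. The first part is controlled by the contraction argument,
applied to smooth compactly supported approximations of `v⁺`
(`IsStrongSolution.integral_abs_sub_pos_le`). The second part needs no solution at all: applied to
`-v`, the mass balance `IsAdmissible.integral_pos_eq` expresses the change of `∫ v⁻` as the integral
of minus the residual over `{v < 0}`. The two contributions live on the disjoint sets `{v > 0}` and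
`{v < 0}`, so they add up to at most one L¹ norm of the residual
(`IsStrongSolution.integral_abs_sub_le`).

The weak formulation enters through two reductions: the weak Laplacian is sliced at almost every
time (`HasWeakLaplacian.ae_slice`), and the weak time derivative is turned into an integral identity
at almost every point (`IsStrongSolution.sub_eq_integral`). This works on compact subintervals of
`(0, T)`; the endpoints follow from continuity in L¹. The bounds by the loss are Cauchy-Schwarz and
a comparison of weights. -/

theorem laplacian_eq_sum_fderiv {ι : Type*} [Fintype ι] (b : OrthonormalBasis ι ℝ E) {f : E → ℝ}
    {x : E} (hf : ContDiffAt ℝ 2 f x) :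
    Laplacian.laplacian f x = ∑ i, fderiv ℝ (fun y => fderiv ℝ f y (b i)) x (b i) := by
  rw [InnerProductSpace.laplacian_eq_iteratedFDeriv_orthonormalBasis f b]
  have h1 : DifferentiableAt ℝ (fderiv ℝ f) x :=
    (hf.fderiv_right (m := 1) (by norm_num)).differentiableAt (by norm_num)
  refine Finset.sum_congr rfl fun i _ => ?_
  rw [iteratedFDeriv_two_apply, fderiv_clm_apply h1 (differentiableAt_const _)]
  simp

theorem sum_fderiv_sq {ι : Type*} [Fintype ι] (b : OrthonormalBasis ι ℝ E) (L : E →L[ℝ] ℝ) :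
    ∑ i, L (b i) ^ 2 = ‖L‖ ^ 2 := by
  rw [← (InnerProductSpace.toDual ℝ E).symm.norm_map L,
    ← b.sum_sq_norm_inner_right ((InnerProductSpace.toDual ℝ E).symm L)]
  refine Finset.sum_congr rfl fun i _ => ?_
  rw [real_inner_comm, InnerProductSpace.toDual_symm_apply, Real.norm_eq_abs, sq_abs]

/-- The sign of the term with the second derivative of `P` is used in both directions: convex `P`
gives Kato's inequality, and concave `P` keeps the barrier superharmonic. -/
theorem laplacian_comp {P : ℝ → ℝ} (hP : ContDiff ℝ 2 P) {f : E → ℝ} {x : E}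
    (hf : ContDiffAt ℝ 2 f x) :
    Laplacian.laplacian (fun y => P (f y)) x =
      deriv P (f x) * Laplacian.laplacian f x + deriv (deriv P) (f x) * ‖fderiv ℝ f x‖ ^ 2 := by
  set b := stdOrthonormalBasis ℝ E
  have hPf : ContDiffAt ℝ 2 (fun y => P (f y)) x := hP.contDiffAt.comp x hf
  have hP' : Differentiable ℝ (deriv P) :=
    ((contDiff_succ_iff_deriv (n := 1)).1 hP).2.2.differentiable (by norm_num)
  have hPd : Differentiable ℝ P := hP.differentiable (by norm_num)
  have hev : ∀ᶠ y in 𝓝 x, DifferentiableAt ℝ f y :=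
    (hf.eventually (by simp)).mono fun y hy => hy.differentiableAt (by norm_num)
  have h1 : DifferentiableAt ℝ (fderiv ℝ f) x :=
    (hf.fderiv_right (m := 1) (by norm_num)).differentiableAt (by norm_num)
  have hfx := hf.differentiableAt (by norm_num : (2 : WithTop ℕ∞) ≠ 0)
  rw [laplacian_eq_sum_fderiv b hPf, laplacian_eq_sum_fderiv b hf, ← sum_fderiv_sq b,
    Finset.mul_sum, Finset.mul_sum, ← Finset.sum_add_distrib]
  refine Finset.sum_congr rfl fun i _ => ?_
  have e1 : (fun y => fderiv ℝ (fun y => P (f y)) y (b i)) =ᶠ[𝓝 x]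
      fun y => deriv P (f y) * fderiv ℝ f y (b i) := by
    filter_upwards [hev] with y hy
    erw [((hPd (f y)).hasDerivAt.comp_hasFDerivAt y hy.hasFDerivAt).fderiv]
    simp
  have h2 : DifferentiableAt ℝ (fun y => fderiv ℝ f y (b i)) x :=
    h1.clm_apply (differentiableAt_const _)
  have h3 := ((hP' (f x)).hasDerivAt.comp_hasFDerivAt x hfx.hasFDerivAt).mul h2.hasFDerivAt
  rw [e1.fderiv_eq]
  erw [h3.fderiv]
  simp
  ring

theorem inner_gradient_eq_sum {ι : Type*} [Fintype ι] (b : OrthonormalBasis ι ℝ E) (f g : E → ℝ)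
    (x : E) : inner ℝ (gradient f x) (gradient g x) =
      ∑ i, fderiv ℝ f x (b i) * fderiv ℝ g x (b i) := by
  rw [← b.sum_inner_mul_inner]
  refine Finset.sum_congr rfl fun i _ => ?_
  rw [real_inner_comm (gradient g x), gradient, gradient, InnerProductSpace.toDual_symm_apply,
    InnerProductSpace.toDual_symm_apply]

theorem contDiff_gradient {f : E → ℝ} {n : ℕ∞} (hf : ContDiff ℝ (n + 1) f) :
    ContDiff ℝ n (gradient f) :=
  (InnerProductSpace.toDual ℝ E).symm.toContinuousLinearEquiv.contDiff.comp
    (hf.fderiv_right le_rfl)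

theorem gradient_comp {P : ℝ → ℝ} {f : E → ℝ} {x : E} (hP : DifferentiableAt ℝ P (f x))
    (hf : DifferentiableAt ℝ f x) :
    gradient (fun y => P (f y)) x = deriv P (f x) • gradient f x := by
  rw [gradient, gradient]
  erw [(hP.hasDerivAt.comp_hasFDerivAt x hf.hasFDerivAt).fderiv]
  simp

theorem contDiff_fderiv_apply {f : E → ℝ} (hf : ContDiff ℝ 2 f) (v : E) :
    ContDiff ℝ 1 (fun y => fderiv ℝ f y v) :=
  (hf.fderiv_right (m := 1) (by norm_num)).clm_apply contDiff_const

theorem continuous_laplacian {f : E → ℝ} (hf : ContDiff ℝ 2 f) :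
    Continuous (Laplacian.laplacian f) := by
  have : Laplacian.laplacian f = fun x => ∑ i, fderiv ℝ
      (fun y => fderiv ℝ f y (stdOrthonormalBasis ℝ E i)) x (stdOrthonormalBasis ℝ E i) :=
    funext fun x => laplacian_eq_sum_fderiv _ hf.contDiffAt
  rw [this]
  refine continuous_finsetSum _ fun i _ => ?_
  exact ((contDiff_fderiv_apply hf _).continuous_fderiv (by norm_num)).clm_apply continuous_const

theorem tsupport_fderiv_apply_subset {f : E → ℝ} (v : E) :
    tsupport (fun x => fderiv ℝ f x v) ⊆ tsupport f :=
  (closure_mono fun x hx => by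
    contrapose! hx
    simp only [Function.mem_support, not_not] at hx ⊢
    simp [hx]).trans (tsupport_fderiv_subset ℝ (f := f))

theorem support_laplacian_subset {f : E → ℝ} :
    Function.support (Laplacian.laplacian f) ⊆ tsupport f := by
  intro x hx
  by_contra h
  have h0 : f =ᶠ[𝓝 x] fun _ => 0 := notMem_tsupport_iff_eventuallyEq.1 h
  have := (InnerProductSpace.laplacian_congr_nhds h0).self_of_nhds
  rw [InnerProductSpace.laplacian_const] at this
  exact hx this

theorem hasCompactSupport_laplacian {f : E → ℝ} (hf : HasCompactSupport f) :
    HasCompactSupport (Laplacian.laplacian f) :=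
  hf.mono' support_laplacian_subset

variable [MeasurableSpace E] [BorelSpace E]

/-- Every integrand is a product of derivatives of the two factors, so compact support of either
factor suffices. This allows the other one to be a constant or a barrier that does not vanish at
infinity. -/
theorem integral_mul_laplacian {η f : E → ℝ} (hη : ContDiff ℝ 2 η) (hf : ContDiff ℝ 2 f)
    (hc : HasCompactSupport η ∨ HasCompactSupport f) :
    ∫ x, η x * Laplacian.laplacian f x = -∫ x, inner ℝ (gradient η x) (gradient f x) := by
  set b := stdOrthonormalBasis ℝ E
  have hη1 : ∀ i, Continuous fun y => fderiv ℝ η y (b i) :=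
    fun i => (contDiff_fderiv_apply hη _).continuous
  have hf1 : ∀ i, Continuous fun y => fderiv ℝ f y (b i) :=
    fun i => (contDiff_fderiv_apply hf _).continuous
  have hf2 : ∀ i, Continuous fun y => fderiv ℝ (fun z => fderiv ℝ f z (b i)) y (b i) :=
    fun i => ((contDiff_fderiv_apply hf _).continuous_fderiv (by norm_num)).clm_apply
      continuous_const
  have hcs : ∀ g h : E → ℝ, Continuous g → Continuous h → tsupport g ⊆ tsupport η →
      tsupport h ⊆ tsupport f → Integrable (fun x => g x * h x) := by
    intro g h hg hh h1 h2
    refine (hg.mul hh).integrable_of_hasCompactSupport ?_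
    rcases hc with hc | hc
    · exact HasCompactSupport.mul_right (hc.of_isClosed_subset (isClosed_tsupport _) h1)
    · exact HasCompactSupport.mul_left (hc.of_isClosed_subset (isClosed_tsupport _) h2)
  have sη : ∀ i, tsupport (fun y => fderiv ℝ η y (b i)) ⊆ tsupport η :=
    fun i => tsupport_fderiv_apply_subset _
  have sf : ∀ i, tsupport (fun y => fderiv ℝ f y (b i)) ⊆ tsupport f :=
    fun i => tsupport_fderiv_apply_subset _
  have sf2 : ∀ i, tsupport (fun y => fderiv ℝ (fun z => fderiv ℝ f z (b i)) y (b i)) ⊆ tsupport f :=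
    fun i => (tsupport_fderiv_apply_subset _).trans (sf i)
  have key : ∀ i, ∫ x, η x * fderiv ℝ (fun z => fderiv ℝ f z (b i)) x (b i) =
      -∫ x, fderiv ℝ η x (b i) * fderiv ℝ f x (b i) := fun i =>
    integral_mul_fderiv_eq_neg_fderiv_mul_of_integrable
      (hcs _ _ (hη1 i) (hf1 i) (sη i) (sf i))
      (hcs _ _ hη.continuous (hf2 i) subset_rfl (sf2 i))
      (hcs _ _ hη.continuous (hf1 i) subset_rfl (sf i))
      (fun x _ => hη.differentiable (by norm_num) x)
      (fun x _ => (contDiff_fderiv_apply hf (b i)).differentiable (by norm_num) x)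
  simp_rw [laplacian_eq_sum_fderiv b hf.contDiffAt, inner_gradient_eq_sum b, Finset.mul_sum]
  rw [integral_finsetSum _ fun i _ => hcs _ _ hη.continuous (hf2 i) subset_rfl (sf2 i),
    integral_finsetSum _ fun i _ => hcs _ _ (hη1 i) (hf1 i) (sη i) (sf i),
    Finset.sum_congr rfl fun i _ => key i, Finset.sum_neg_distrib]

theorem integral_mul_laplacian_comm {η f : E → ℝ} (hη : ContDiff ℝ 2 η) (hf : ContDiff ℝ 2 f)
    (hc : HasCompactSupport η ∨ HasCompactSupport f) :
    ∫ x, η x * Laplacian.laplacian f x = ∫ x, f x * Laplacian.laplacian η x := by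
  rw [integral_mul_laplacian hη hf hc, integral_mul_laplacian hf hη hc.symm]
  simp_rw [real_inner_comm]

end Calculus

/-! ### Mollification: convergence in L¹ and commutation with weak Laplacians -/

section Mollify

variable {E : Type*} [NormedAddCommGroup E] [InnerProductSpace ℝ E] [FiniteDimensional ℝ E]
  [MeasurableSpace E] [BorelSpace E]

/-- Translations form a continuous family of measure preserving maps, and composition with such a
family is continuous into `Lp` for finite exponent. -/
theorem tendsto_lintegral_translate {Z : E → ℝ} (hZ : Integrable Z) :
    Tendsto (fun t : E => ∫⁻ x, ‖Z (x - t) - Z x‖ₑ) (𝓝 0) (𝓝 0) := by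
  have hZ1 : MemLp Z 1 volume := memLp_one_iff_integrable.2 hZ
  let F : Lp ℝ 1 (volume : Measure E) := hZ1.toLp Z
  let c : C(E × E, E) := ⟨fun p => p.2 - p.1, by fun_prop⟩
  let g : C(E, C(E, E)) := c.curry
  have hmp : ∀ t, MeasurePreserving (g t) (volume : Measure E) volume :=
    fun t => measurePreserving_sub_right volume t
  have hcont : Continuous fun t => Lp.compMeasurePreserving (g t) (hmp t) F :=
    Continuous.compMeasurePreservingLp continuous_const g.continuous hmp (by norm_num)
  have h0 := hcont.tendsto 0
  rw [Lp.tendsto_Lp_iff_tendsto_eLpNorm'] at h0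
  have hF : F =ᵐ[volume] Z := hZ1.coeFn_toLp
  have hae : ∀ t, Lp.compMeasurePreserving (g t) (hmp t) F =ᵐ[volume] fun x => Z (x - t) :=
    fun t => (Lp.coeFn_compMeasurePreserving F (hmp t)).trans
      ((hmp t).quasiMeasurePreserving.ae_eq_comp hF)
  refine h0.congr fun t => ?_
  rw [eLpNorm_one_eq_lintegral_enorm]
  refine lintegral_congr_ae ?_
  filter_upwards [hae t, hae 0] with x h1 h2
  simp only [Pi.sub_apply]
  rw [h1, h2, sub_zero]

/-- The convolution `x ↦ ∫ Z(y) ρ(x - y) dy`. -/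
noncomputable def mollify (ρ Z : E → ℝ) (x : E) : ℝ := ∫ y, Z y * ρ (x - y)

open Convolution in
theorem mollify_eq_convolution (ρ Z : E → ℝ) :
    mollify ρ Z = Z ⋆[ContinuousLinearMap.mul ℝ ℝ, volume] ρ := rfl

theorem contDiff_mollify {ρ Z : E → ℝ} {n : ℕ∞} (hρ : ContDiff ℝ n ρ) (hc : HasCompactSupport ρ)
    (hZ : LocallyIntegrable Z) : ContDiff ℝ n (mollify ρ Z) := by
  rw [mollify_eq_convolution]
  exact hc.contDiff_convolution_right _ hZ hρ

theorem fderiv_mollify_apply {ρ Z : E → ℝ} (hρ : ContDiff ℝ 1 ρ) (hc : HasCompactSupport ρ)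
    (hZ : LocallyIntegrable Z) (x v : E) :
    fderiv ℝ (mollify ρ Z) x v = mollify (fun a => fderiv ℝ ρ a v) Z x := by
  rw [mollify_eq_convolution, mollify_eq_convolution,
    (hc.hasFDerivAt_convolution_right _ hZ hρ x).fderiv]
  exact convolution_precompR_apply _ hZ (hc.fderiv ℝ) (hρ.continuous_fderiv (by norm_num)) x v

theorem mollify_integrable_mul {ρ Z : E → ℝ} (hρ : Continuous ρ) (hc : HasCompactSupport ρ)
    (hZ : LocallyIntegrable Z) (x : E) : Integrable fun y => Z y * ρ (x - y) :=
  hc.convolutionExists_right (ContinuousLinearMap.mul ℝ ℝ) hZ hρ x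

theorem laplacian_mollify {ρ Z : E → ℝ} (hρ : ContDiff ℝ 2 ρ) (hc : HasCompactSupport ρ)
    (hZ : LocallyIntegrable Z) (x : E) :
    Laplacian.laplacian (mollify ρ Z) x = mollify (Laplacian.laplacian ρ) Z x := by
  set b := stdOrthonormalBasis ℝ E
  have h2 : ContDiff ℝ 2 (mollify ρ Z) := contDiff_mollify (n := 2) hρ hc hZ
  have hcs : ∀ i, HasCompactSupport fun a => fderiv ℝ ρ a (b i) :=
    fun i => hc.of_isClosed_subset (isClosed_tsupport _) (tsupport_fderiv_apply_subset _)
  have hcs2 : ∀ i, HasCompactSupport fun a => fderiv ℝ (fun a => fderiv ℝ ρ a (b i)) a (b i) :=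
    fun i => (hcs i).of_isClosed_subset (isClosed_tsupport _) (tsupport_fderiv_apply_subset _)
  have hct : ∀ i, Continuous fun a => fderiv ℝ (fun a => fderiv ℝ ρ a (b i)) a (b i) :=
    fun i => ((contDiff_fderiv_apply hρ _).continuous_fderiv (by norm_num)).clm_apply
      continuous_const
  rw [laplacian_eq_sum_fderiv b h2.contDiffAt]
  have e : ∀ i, (fun y => fderiv ℝ (mollify ρ Z) y (b i)) =
      mollify (fun a => fderiv ℝ ρ a (b i)) Z :=
    fun i => funext fun y => fderiv_mollify_apply (hρ.of_le (by norm_num)) hc hZ y (b i)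
  simp_rw [e, fderiv_mollify_apply (contDiff_fderiv_apply hρ _) (hcs _) hZ]
  unfold mollify
  rw [← integral_finsetSum _ fun i _ => mollify_integrable_mul (hct i) (hcs2 i) hZ x]
  refine integral_congr_ae (Eventually.of_forall fun y => ?_)
  simp only
  rw [laplacian_eq_sum_fderiv b hρ.contDiffAt, Finset.mul_sum]

/-- Because the kernel has unit mass, the error is an average of the differences `Z (x - t) - Z x`.
Tonelli moves the L¹ norm inside the average, and only small translations `t` carry weight. -/
theorem tendsto_lintegral_mollify_sub {φ : ℕ → ContDiffBump (0 : E)}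
    (hφ : Tendsto (fun n => (φ n).rOut) atTop (𝓝 0)) {Z : E → ℝ} (hZ : Integrable Z) :
    Tendsto (fun n => ∫⁻ x, ‖mollify ((φ n).normed volume) Z x - Z x‖ₑ) atTop (𝓝 0) := by
  rw [ENNReal.tendsto_nhds_zero]
  intro ε hε
  have h := ENNReal.tendsto_nhds_zero.1 (tendsto_lintegral_translate hZ) ε hε
  obtain ⟨δ, hδ, hball⟩ := Metric.eventually_nhds_iff.1 h
  filter_upwards [hφ.eventually (gt_mem_nhds hδ)] with n hn
  set ρ := (φ n).normed volume
  have hρc : Continuous ρ := (φ n).continuous_normed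
  have hρi : Integrable ρ := (φ n).integrable_normed
  have hmeas : AEStronglyMeasurable (fun p : E × E => Z (p.1 - p.2) - Z p.1)
      (volume.prod volume) :=
    (hZ.aestronglyMeasurable.comp_quasiMeasurePreserving
      (quasiMeasurePreserving_sub_of_right_invariant volume volume)).sub
      hZ.aestronglyMeasurable.comp_fst
  have hpt : ∀ x, ‖mollify ρ Z x - Z x‖ₑ ≤ ∫⁻ t, ‖ρ t‖ₑ * ‖Z (x - t) - Z x‖ₑ := by
    intro x
    have hi : Integrable fun t => Z (x - t) * ρ t := by
      have := (mollify_integrable_mul hρc (φ n).hasCompactSupport_normed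
        hZ.locallyIntegrable x).comp_sub_left x
      simpa using this
    have e1 : mollify ρ Z x = ∫ t, Z (x - t) * ρ t := by
      rw [mollify, ← integral_sub_left_eq_self _ volume x]
      simp
    have e2 : mollify ρ Z x - Z x = ∫ t, ρ t * (Z (x - t) - Z x) := by
      have e3 : Z x = ∫ t, Z x * ρ t := by
        rw [integral_const_mul, (φ n).integral_normed, mul_one]
      calc mollify ρ Z x - Z x = (∫ t, Z (x - t) * ρ t) - ∫ t, Z x * ρ t := by rw [e1, ← e3]
        _ = _ := by
          rw [← integral_sub hi (hρi.const_mul _)]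
          exact integral_congr_ae (Eventually.of_forall fun t => by ring)
    rw [e2]
    refine (enorm_integral_le_lintegral_enorm _).trans (le_of_eq ?_)
    simp_rw [enorm_mul]
  calc ∫⁻ x, ‖mollify ρ Z x - Z x‖ₑ
      ≤ ∫⁻ x, ∫⁻ t, ‖ρ t‖ₑ * ‖Z (x - t) - Z x‖ₑ := lintegral_mono hpt
    _ = ∫⁻ t, ∫⁻ x, ‖ρ t‖ₑ * ‖Z (x - t) - Z x‖ₑ := by
        refine lintegral_lintegral_swap ?_
        exact ((hρc.aestronglyMeasurable (μ := volume)).comp_snd.enorm).mul hmeas.enorm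
    _ = ∫⁻ t, ‖ρ t‖ₑ * ∫⁻ x, ‖Z (x - t) - Z x‖ₑ := by
        refine lintegral_congr fun t => ?_
        rw [lintegral_const_mul' _ _ enorm_ne_top]
    _ ≤ ∫⁻ t, ‖ρ t‖ₑ * ε := by
        refine lintegral_mono fun t => ?_
        by_cases ht : t ∈ Metric.ball (0 : E) (φ n).rOut
        · gcongr
          exact hball (lt_trans ht hn)
        · rw [← (φ n).support_normed_eq (μ := volume), Function.notMem_support] at ht
          simp [ρ, ht]
    _ = (∫⁻ t, ‖ρ t‖ₑ) * ε := lintegral_mul_const'' _ hρc.aestronglyMeasurable.enorm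
    _ = ε := by
        rw [← ofReal_integral_norm_eq_lintegral_enorm hρi]
        have : ∫ t, ‖ρ t‖ = 1 := by
          rw [← (φ n).integral_normed (μ := volume)]
          exact integral_congr_ae (Eventually.of_forall fun t =>
            Real.norm_of_nonneg ((φ n).nonneg_normed t))
        rw [this]; simp

theorem laplacian_comp_sub {f : E → ℝ} (a x : E) :
    Laplacian.laplacian (fun y => f (y - a)) x = Laplacian.laplacian f (x - a) := by
  simp only [InnerProductSpace.laplacian_eq_iteratedFDeriv_stdOrthonormalBasis,
    iteratedFDeriv_comp_sub]

theorem isTestFunction_comp_sub {U : Set E} {n : ContDiffBump (0 : E)} {x : E}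
    (h : Metric.closedBall x n.rOut ⊆ U) :
    IsTestFunction U fun y => n.normed volume (y - x) where
  smooth := n.contDiff_normed.comp (contDiff_id.sub contDiff_const)
  compact_support := n.hasCompactSupport_normed.comp_homeomorph (Homeomorph.subRight x)
  support_subset := by
    refine (closure_minimal (fun y hy => ?_) Metric.isClosed_closedBall).trans h
    have : y - x ∈ Function.support (n.normed volume) := hy
    rw [n.support_normed_eq, Metric.mem_ball, dist_zero_right] at this
    rw [Metric.mem_closedBall, dist_eq_norm]
    exact this.le

theorem fderiv_comp_neg {g : E → ℝ} {x : E} (hg : DifferentiableAt ℝ g (-x)) :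
    fderiv ℝ (fun y => g (-y)) x = -fderiv ℝ g (-x) := by
  have h : HasFDerivAt (fun y : E => -y) (-ContinuousLinearMap.id ℝ E) x := (hasFDerivAt_id x).neg
  have := hg.hasFDerivAt.comp x h
  erw [this.fderiv]
  ext v
  simp

/-- Needed to pass between the convolution kernel, evaluated at `x - y`, and the translated bump,
evaluated at `y - x`. -/
theorem laplacian_even {f : E → ℝ} (hf : ContDiff ℝ 2 f) (he : ∀ x, f (-x) = f x) (x : E) :
    Laplacian.laplacian f (-x) = Laplacian.laplacian f x := by
  have h1 : ∀ y, fderiv ℝ f (-y) = -fderiv ℝ f y := fun y => by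
    have := fderiv_comp_neg (hf.differentiable (by norm_num) (-y))
    simp only [he] at this
    rw [this, neg_neg]
  set b := stdOrthonormalBasis ℝ E
  rw [laplacian_eq_sum_fderiv b hf.contDiffAt, laplacian_eq_sum_fderiv b hf.contDiffAt]
  refine Finset.sum_congr rfl fun i _ => ?_
  have := fderiv_comp_neg
    ((contDiff_fderiv_apply hf (b i)).differentiable (by norm_num) (-x))
  simp only [h1, neg_apply] at this
  rw [fderiv_fun_neg, neg_inj] at this
  rw [this]

/-- When the ball about `x` lies in `U`, the translated bump is itself an admissible test function,
and the weak equation tested with it is the claim. Extending `z` and `g` by zero therefore does no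
harm at such points. -/
theorem laplacian_mollify_eq {U : Set E} (hU : MeasurableSet U) {z g : E → ℝ}
    (hz : IntegrableOn z U)
    (hw : ∀ ψ, IsTestFunction U ψ →
      ∫ x in U, z x * Laplacian.laplacian ψ x = ∫ x in U, g x * ψ x)
    {φ : ContDiffBump (0 : E)} {x : E} (hx : Metric.closedBall x φ.rOut ⊆ U) :
    Laplacian.laplacian (mollify (φ.normed volume) (U.indicator z)) x =
      mollify (φ.normed volume) (U.indicator g) x := by
  rw [laplacian_mollify (φ.contDiff_normed (n := 2)) φ.hasCompactSupport_normed
    (hz.integrable_indicator hU).locallyIntegrable]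
  have h := hw _ (isTestFunction_comp_sub hx)
  simp only [laplacian_comp_sub] at h
  rw [← integral_indicator hU, ← integral_indicator hU] at h
  unfold mollify
  calc ∫ y, U.indicator z y * Laplacian.laplacian (φ.normed volume) (x - y)
      = ∫ y, U.indicator
          (fun y => z y * Laplacian.laplacian (φ.normed volume) (y - x)) y := by
        refine integral_congr_ae (Eventually.of_forall fun y => ?_)
        simp only
        rw [← neg_sub y x, laplacian_even (φ.contDiff_normed (n := 2)) φ.normed_neg,
          indicator_mul_left]
    _ = ∫ y, U.indicator (fun y => g y * φ.normed volume (y - x)) y := h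
    _ = ∫ y, U.indicator g y * φ.normed volume (x - y) := by
        refine integral_congr_ae (Eventually.of_forall fun y => ?_)
        simp only
        rw [← neg_sub y x, φ.normed_neg, indicator_mul_left]

end Mollify

/-! ### Smooth convex entropies and the interior Kato inequality -/

section Kato

/-- Smooth convex approximations of the absolute value. -/
structure IsEntropy (P : ℝ → ℝ) : Prop where
  smooth : ContDiff ℝ ∞ P
  zero : P 0 = 0
  nonneg : ∀ s, 0 ≤ P s
  abs_deriv_le : ∀ s, |deriv P s| ≤ 1
  deriv_deriv_nonneg : ∀ s, 0 ≤ deriv (deriv P) s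

namespace IsEntropy

variable {P : ℝ → ℝ} (hP : IsEntropy P)

include hP

theorem contDiff_two : ContDiff ℝ 2 P := contDiff_infty.1 hP.smooth 2

theorem continuous_deriv : Continuous (deriv P) :=
  hP.contDiff_two.continuous_deriv (by norm_num)

theorem abs_sub_le (a b : ℝ) : |P a - P b| ≤ |a - b| := by
  have := Convex.norm_image_sub_le_of_norm_deriv_le (𝕜 := ℝ) (f := P) (C := 1) (s := univ)
    (x := b) (y := a) (fun x _ => hP.contDiff_two.differentiable (by norm_num) x)
    (fun x _ => hP.abs_deriv_le x) convex_univ (mem_univ _) (mem_univ _)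
  simpa using this

theorem abs_le (a : ℝ) : |P a| ≤ |a| := by
  simpa [hP.zero] using hP.abs_sub_le a 0

end IsEntropy

variable {E : Type*} [NormedAddCommGroup E] [InnerProductSpace ℝ E] [FiniteDimensional ℝ E]
  [MeasurableSpace E] [BorelSpace E]

theorem IsTestFunction.contDiff_two {U : Set E} {η : E → ℝ} (hη : IsTestFunction U η) :
    ContDiff ℝ 2 η := contDiff_infty.1 hη.smooth 2

theorem IsTestFunction.eq_zero {U : Set E} {η : E → ℝ} (hη : IsTestFunction U η) {x : E}
    (hx : x ∉ U) : η x = 0 :=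
  image_eq_zero_of_notMem_tsupport fun h => hx (hη.support_subset h)

theorem IsTestFunction.laplacian_eq_zero {U : Set E} {η : E → ℝ} (hη : IsTestFunction U η) {x : E}
    (hx : x ∉ U) : Laplacian.laplacian η x = 0 := by
  by_contra h
  exact hx (hη.support_subset (support_laplacian_subset h))

/-- Integrate by parts twice onto `P ∘ f`; by the chain rule the difference of the two sides is the
integral of `η` times the second derivative of `P` times `|∇f|²`, which is nonnegative. -/
theorem integral_mul_deriv_mul_laplacian_le {P : ℝ → ℝ} (hP : IsEntropy P) {f η : E → ℝ}
    (hf : ContDiff ℝ 2 f) (hη : ContDiff ℝ 2 η) (hc : HasCompactSupport η) (hη0 : ∀ x, 0 ≤ η x) :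
    ∫ x, η x * (deriv P (f x) * Laplacian.laplacian f x) ≤
      ∫ x, P (f x) * Laplacian.laplacian η x := by
  have hPf : ContDiff ℝ 2 fun x => P (f x) := hP.contDiff_two.comp hf
  rw [← integral_mul_laplacian_comm hη hPf (Or.inl hc)]
  refine integral_mono ?_ ?_ fun x => ?_
  · exact (hη.continuous.mul ((hP.continuous_deriv.comp hf.continuous).mul
      (continuous_laplacian hf))).integrable_of_hasCompactSupport hc.mul_right
  · exact (hη.continuous.mul (continuous_laplacian hPf)).integrable_of_hasCompactSupport
      hc.mul_right
  · simp only
    rw [laplacian_comp hP.contDiff_two hf.contDiffAt]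
    refine mul_le_mul_of_nonneg_left ?_ (hη0 x)
    have := mul_nonneg (hP.deriv_deriv_nonneg (f x)) (sq_nonneg ‖fderiv ℝ f x‖)
    linarith

/-- The multiplier may vary with the index as long as its bound does not: in Kato's inequality it is
the entropy derivative of the mollified function. -/
theorem tendsto_integral_sub_mul_of_tendsto_L1 {α ι : Type*} [MeasurableSpace α] {l : Filter ι}
    {μ : Measure α} {F : ι → α → ℝ} {f : α → ℝ} {c : ι → α → ℝ} {M : ℝ}
    (hc : ∀ i, AEStronglyMeasurable (c i) μ) (hM : ∀ i, ∀ᵐ x ∂μ, |c i x| ≤ M)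
    (hF : ∀ᶠ i in l, Integrable (F i) μ) (hf : Integrable f μ)
    (h : Tendsto (fun i => ∫⁻ x, ‖F i x - f x‖ₑ ∂μ) l (𝓝 0)) :
    Tendsto (fun i => ∫ x, (F i x - f x) * c i x ∂μ) l (𝓝 0) := by
  have h0 : (0 : ℝ) = ∫ _, (0 : ℝ) ∂μ := by simp
  rw [h0]
  refine tendsto_integral_of_L1 _ aestronglyMeasurable_const (hF.mono fun i hFi =>
    (hFi.sub hf).mul_bdd (hc i) (hM i)) ?_
  have h2 := ENNReal.Tendsto.mul_const h (b := ENNReal.ofReal M) (Or.inr ENNReal.ofReal_ne_top)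
  rw [zero_mul] at h2
  refine tendsto_of_tendsto_of_tendsto_of_le_of_le tendsto_const_nhds h2 (fun _ => zero_le) ?_
  intro i
  simp only
  rw [← lintegral_mul_const' _ _ ENNReal.ofReal_ne_top]
  refine lintegral_mono_ae ((hM i).mono fun x hx => ?_)
  rw [sub_zero, enorm_mul]
  gcongr
  rw [← ofReal_norm]
  exact ENNReal.ofReal_le_ofReal hx

theorem tendsto_integral_mul_of_tendsto_L1 {α ι : Type*} [MeasurableSpace α] {l : Filter ι}
    {μ : Measure α} {F : ι → α → ℝ} {f : α → ℝ} {c : α → ℝ} {M : ℝ}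
    (hc : AEStronglyMeasurable c μ) (hM : ∀ᵐ x ∂μ, |c x| ≤ M) (hF : ∀ᶠ i in l, Integrable (F i) μ)
    (hf : Integrable f μ) (h : Tendsto (fun i => ∫⁻ x, ‖F i x - f x‖ₑ ∂μ) l (𝓝 0)) :
    Tendsto (fun i => ∫ x, F i x * c x ∂μ) l (𝓝 (∫ x, f x * c x ∂μ)) := by
  have h1 := (tendsto_integral_sub_mul_of_tendsto_L1 (fun _ => hc) (fun _ => hM) hF hf h).add_const
    (∫ x, f x * c x ∂μ)
  rw [zero_add] at h1
  refine h1.congr' ?_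
  filter_upwards [hF] with i hFi
  have hi : Integrable (fun x => (F i x - f x) * c x) μ := (hFi.sub hf).mul_bdd hc hM
  rw [← integral_add hi (hf.mul_bdd hc hM)]
  exact integral_congr_ae (Eventually.of_forall fun x => by simp only; ring)

/-- Local form of Kato's inequality. -/
theorem kato_local {U : Set E} (hU : IsOpen U) {z g : E → ℝ} (hz : IntegrableOn z U)
    (hg : IntegrableOn g U)
    (hw : ∀ ψ, IsTestFunction U ψ →
      ∫ x in U, z x * Laplacian.laplacian ψ x = ∫ x in U, g x * ψ x)
    {P : ℝ → ℝ} (hP : IsEntropy P) {η : E → ℝ} (hη : IsTestFunction U η) (hη0 : ∀ x, 0 ≤ η x) :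
    ∫ x in U, η x * (deriv P (z x) * g x) ≤ ∫ x in U, P (z x) * Laplacian.laplacian η x := by
  set Z := U.indicator z
  set Γ := U.indicator g
  have hZ : Integrable Z := hz.integrable_indicator hU.measurableSet
  have hΓ : Integrable Γ := hg.integrable_indicator hU.measurableSet
  have eL : ∫ x in U, η x * (deriv P (z x) * g x) = ∫ x, η x * (deriv P (Z x) * Γ x) := by
    rw [← integral_indicator hU.measurableSet]
    refine integral_congr_ae (Eventually.of_forall fun x => ?_)
    by_cases hx : x ∈ U <;> simp [Z, Γ, hx]
  have eR : ∫ x in U, P (z x) * Laplacian.laplacian η x =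
      ∫ x, P (Z x) * Laplacian.laplacian η x := by
    rw [← integral_indicator hU.measurableSet]
    refine integral_congr_ae (Eventually.of_forall fun x => ?_)
    by_cases hx : x ∈ U <;> simp [Z, hx, hP.zero]
  rw [eL, eR]
  let φ : ℕ → ContDiffBump (0 : E) := fun n =>
    ⟨1 / (2 * ((n : ℝ) + 1)), 1 / ((n : ℝ) + 1), by positivity, by
      rw [one_div_lt_one_div (by positivity) (by positivity)]
      have : (0 : ℝ) ≤ n := n.cast_nonneg
      linarith⟩
  have hφ : Tendsto (fun n => (φ n).rOut) atTop (𝓝 0) := tendsto_one_div_add_atTop_nhds_zero_nat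
  -- Comparable inner and outer radii are what the Lebesgue differentiation theorem for mollifiers
  -- requires; it later gives almost everywhere convergence of the mollifications.
  have hφ2 : ∀ᶠ n in atTop, (φ n).rOut ≤ 2 * (φ n).rIn := Eventually.of_forall fun n => by
    simp only [φ]
    apply le_of_eq
    field_simp
  set ρ : ℕ → E → ℝ := fun n => (φ n).normed volume
  have hρs : ∀ n, ContDiff ℝ 2 (ρ n) := fun n => (φ n).contDiff_normed (n := 2)
  have hρc : ∀ n, HasCompactSupport (ρ n) := fun n => (φ n).hasCompactSupport_normed
  have hρi : ∀ n, Integrable (ρ n) := fun n => (φ n).integrable_normed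
  have hmi : ∀ n (Y : E → ℝ), Integrable Y → Integrable (mollify (ρ n) Y) := fun n Y hY => by
    rw [mollify_eq_convolution]
    exact hY.integrable_convolution _ (hρi n)
  have hms : ∀ n (Y : E → ℝ), Integrable Y → ContDiff ℝ 2 (mollify (ρ n) Y) := fun n Y hY =>
    contDiff_mollify (n := 2) (hρs n) (hρc n) hY.locallyIntegrable
  -- Once the mollification radius is below `δ`, the Laplacian of the mollified `z` equals the
  -- mollified `g` on the whole support of `η`, and elsewhere the integrand vanishes.
  obtain ⟨δ, hδ, hthick⟩ := hη.compact_support.exists_cthickening_subset_open hU hη.support_subset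
  obtain ⟨Mη, hMη⟩ := hη.compact_support.exists_bound_of_continuous hη.smooth.continuous
  obtain ⟨ML, hML⟩ := (hasCompactSupport_laplacian hη.compact_support).exists_bound_of_continuous
    (continuous_laplacian hη.contDiff_two)
  have hMη0 : 0 ≤ Mη := (abs_nonneg _).trans (hMη 0)
  have hle : ∀ᶠ n in atTop, ∫ x, η x * (deriv P (mollify (ρ n) Z x) * mollify (ρ n) Γ x) ≤
      ∫ x, P (mollify (ρ n) Z x) * Laplacian.laplacian η x := by
    filter_upwards [hφ.eventually (gt_mem_nhds hδ)] with n hn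
    refine le_of_eq_of_le ?_ (integral_mul_deriv_mul_laplacian_le hP (hms n Z hZ) hη.contDiff_two
      hη.compact_support hη0)
    refine integral_congr_ae (Eventually.of_forall fun x => ?_)
    simp only
    by_cases hx : x ∈ tsupport η
    · rw [laplacian_mollify_eq hU.measurableSet hz hw]
      refine subset_trans ?_ hthick
      exact (Metric.closedBall_subset_closedBall hn.le).trans
        (Metric.closedBall_subset_cthickening hx δ)
    · rw [image_eq_zero_of_notMem_tsupport hx]; simp
  have hcZ := tendsto_lintegral_mollify_sub hφ hZ
  have hcΓ := tendsto_lintegral_mollify_sub hφ hΓ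
  have hPint : ∀ Y : E → ℝ, Integrable Y → Integrable fun x => P (Y x) := fun Y hY =>
    hY.mono (hP.smooth.continuous.comp_aestronglyMeasurable hY.aestronglyMeasurable)
      (Eventually.of_forall fun x => hP.abs_le _)
  have hR : Tendsto (fun n => ∫ x, P (mollify (ρ n) Z x) * Laplacian.laplacian η x) atTop
      (𝓝 (∫ x, P (Z x) * Laplacian.laplacian η x)) := by
    refine tendsto_integral_mul_of_tendsto_L1
      (continuous_laplacian hη.contDiff_two).aestronglyMeasurable (Eventually.of_forall hML)
      (Eventually.of_forall fun n => hPint _ (hmi n Z hZ)) (hPint _ hZ) ?_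
    refine tendsto_of_tendsto_of_tendsto_of_le_of_le tendsto_const_nhds hcZ
      (fun _ => zero_le) fun n => lintegral_mono fun x => ?_
    exact enorm_le_iff_norm_le.2 (hP.abs_sub_le _ _)
  have hdm : ∀ Y : E → ℝ, Integrable Y → AEStronglyMeasurable (fun x => η x * deriv P (Y x))
      volume := fun Y hY => hη.smooth.continuous.aestronglyMeasurable.mul
      (hP.continuous_deriv.comp_aestronglyMeasurable hY.aestronglyMeasurable)
  have hdb : ∀ (Y : E → ℝ) x, ‖η x * deriv P (Y x)‖ ≤ Mη := fun Y x => by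
    rw [norm_mul]
    exact (mul_le_mul (hMη x) (hP.abs_deriv_le _) (abs_nonneg _) hMη0).trans_eq (mul_one _)
  -- Both factors vary. The error in `Γ` is small in L¹ against a bounded multiplier; with `Γ`
  -- fixed, dominated convergence applies because the mollified `Z` converges almost everywhere.
  have hL : Tendsto (fun n => ∫ x, η x * (deriv P (mollify (ρ n) Z x) * mollify (ρ n) Γ x)) atTop
      (𝓝 (∫ x, η x * (deriv P (Z x) * Γ x))) := by
    have h1 : Tendsto (fun n => ∫ x, (η x * deriv P (mollify (ρ n) Z x)) *
        (mollify (ρ n) Γ x - Γ x)) atTop (𝓝 0) := by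
      simp_rw [mul_comm (η _ * _)]
      exact tendsto_integral_sub_mul_of_tendsto_L1 (fun n => hdm _ (hmi n Z hZ))
        (fun n => Eventually.of_forall (hdb _)) (Eventually.of_forall fun n => hmi n Γ hΓ) hΓ hcΓ
    have h2 : Tendsto (fun n => ∫ x, (η x * deriv P (mollify (ρ n) Z x)) * Γ x) atTop
        (𝓝 (∫ x, (η x * deriv P (Z x)) * Γ x)) := by
      refine tendsto_integral_of_dominated_convergence (fun x => Mη * ‖Γ x‖)
        (fun n => (hdm _ (hmi n Z hZ)).mul hΓ.aestronglyMeasurable) (hΓ.norm.const_mul _)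
        (fun n => Eventually.of_forall fun x => ?_) ?_
      · rw [norm_mul]
        exact mul_le_mul_of_nonneg_right (hdb _ x) (norm_nonneg _)
      · filter_upwards [ContDiffBump.ae_convolution_tendsto_right_of_locallyIntegrable hφ hφ2
          hZ.locallyIntegrable] with x hx
        have hx' : Tendsto (fun n => mollify (ρ n) Z x) atTop (𝓝 (Z x)) := by
          refine hx.congr fun n => ?_
          rw [convolution_eq_swap]
          refine integral_congr_ae (Eventually.of_forall fun y => ?_)
          simp [ρ, mul_comm]
        exact (((hP.continuous_deriv.tendsto _).comp hx').const_mul _).mul_const _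
    have h3 := h1.add h2
    rw [zero_add] at h3
    simp_rw [← mul_assoc]
    refine h3.congr fun n => ?_
    rw [← integral_add]
    · exact integral_congr_ae (Eventually.of_forall fun x => by simp only; ring)
    · exact ((hmi n Γ hΓ).sub hΓ).bdd_mul (hdm _ (hmi n Z hZ)) (Eventually.of_forall (hdb _))
    · exact hΓ.bdd_mul (hdm _ (hmi n Z hZ)) (Eventually.of_forall (hdb _))
  exact le_of_tendsto_of_tendsto hL hR hle

end Kato

/-! ### Test functions obtained by composition -/

section TestFunctions

variable {E : Type*} [NormedAddCommGroup E] [InnerProductSpace ℝ E] [FiniteDimensional ℝ E]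

/-- Since `f` vanishes on the frontier, the part of the closure where `f ≥ δ` is a compact subset of
`U`, and it contains the support. It serves both for cutoffs of the barrier and for truncations of
the competitor. -/
theorem isTestFunction_indicator_comp {U : Set E} (hU : IsOpen U) (hUc : IsCompact (closure U))
    {f : E → ℝ} (hfc : ContinuousOn f (closure U)) (hfs : ContDiffOn ℝ ∞ f U)
    (hb : ∀ x ∈ frontier U, f x = 0) {β : ℝ → ℝ} (hβ : ContDiff ℝ ∞ β) {δ : ℝ} (hδ : 0 < δ)
    (hβ0 : ∀ s < δ, β s = 0) : IsTestFunction U (U.indicator fun x => β (f x)) := by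
  set K := closure U ∩ f ⁻¹' Ici δ
  have hKc : IsClosed K := hfc.preimage_isClosed_of_isClosed isClosed_closure isClosed_Ici
  have hKU : K ⊆ U := by
    intro x hx
    by_contra h
    have h0 := hb x ⟨hx.1, by rwa [hU.interior_eq]⟩
    have h1 : δ ≤ f x := hx.2
    linarith
  have hsupp : Function.support (U.indicator fun x => β (f x)) ⊆ K := by
    intro x hx
    have hxU : x ∈ U := by
      by_contra h
      simp [h] at hx
    refine ⟨subset_closure hxU, ?_⟩
    by_contra h
    have : f x < δ := not_le.1 h
    simp [hxU, hβ0 _ this] at hx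
  have htK : tsupport (U.indicator fun x => β (f x)) ⊆ K := closure_minimal hsupp hKc
  refine ⟨contDiff_iff_contDiffAt.2 fun x => ?_, ?_, htK.trans hKU⟩
  · by_cases hx : x ∈ U
    · have h1 : ContDiffAt ℝ ∞ (fun x => β (f x)) x :=
        hβ.contDiffAt.comp x (hfs.contDiffAt (hU.mem_nhds hx))
      refine h1.congr_of_eventuallyEq ?_
      filter_upwards [hU.mem_nhds hx] with y hy
      simp [hy]
    · have hxt : x ∉ tsupport (U.indicator fun x => β (f x)) := fun h => hx (hKU (htK h))
      exact contDiffAt_const.congr_of_eventuallyEq (notMem_tsupport_iff_eventuallyEq.1 hxt)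
  · exact hUc.of_isClosed_subset (isClosed_tsupport _) (htK.trans inter_subset_left)

theorem IsTestFunction.comp_zero {U : Set E} {φ : E → ℝ} (hφ : IsTestFunction U φ) {P : ℝ → ℝ}
    (hP : ContDiff ℝ ∞ P) (h0 : P 0 = 0) : IsTestFunction U fun x => P (φ x) where
  smooth := hP.comp hφ.smooth
  compact_support := hφ.compact_support.comp_left h0
  support_subset := (closure_mono fun x hx => by
    contrapose! hx
    simp only [Function.mem_support, not_not] at hx ⊢
    rw [hx, h0]).trans hφ.support_subset

theorem IsTestFunction.gradient_eq_zero {U : Set E} {η : E → ℝ} (hη : IsTestFunction U η) {x : E}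
    (hx : x ∉ U) : gradient η x = 0 := by
  have h : fderiv ℝ η x = 0 := by
    by_contra h
    exact hx (hη.support_subset (support_fderiv_subset ℝ h))
  rw [gradient, h, map_zero]

end TestFunctions

/-! ### Geometry of the box and its superharmonic barrier -/

section Box

variable {d : ℕ} {l r : Fin d → ℝ}

theorem isOpen_box : IsOpen (box l r) := by
  have : box l r = ⋂ i, {x : EuclideanSpace ℝ (Fin d) | l i < x i ∧ x i < r i} := by
    ext x; simp [box]
  rw [this]
  refine isOpen_iInter_of_finite fun i => ?_
  have hc : Continuous fun x : EuclideanSpace ℝ (Fin d) => x i := by fun_prop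
  exact (isOpen_lt continuous_const hc).inter (isOpen_lt hc continuous_const)

theorem measurableSet_box : MeasurableSet (box l r) := isOpen_box.measurableSet

theorem closure_box_subset :
    closure (box l r) ⊆ {x : EuclideanSpace ℝ (Fin d) | ∀ i, l i ≤ x i ∧ x i ≤ r i} := by
  refine closure_minimal (fun x hx i => ⟨(hx i).1.le, (hx i).2.le⟩) ?_
  have : {x : EuclideanSpace ℝ (Fin d) | ∀ i, l i ≤ x i ∧ x i ≤ r i} =
      ⋂ i, {x : EuclideanSpace ℝ (Fin d) | l i ≤ x i ∧ x i ≤ r i} := by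
    ext x; simp
  rw [this]
  refine isClosed_iInter fun i => ?_
  have hc : Continuous fun x : EuclideanSpace ℝ (Fin d) => x i := by fun_prop
  exact (isClosed_le continuous_const hc).inter (isClosed_le hc continuous_const)

theorem isBounded_box : Bornology.IsBounded (box l r) := by
  have h := (EuclideanSpace.equiv (Fin d) ℝ).symm.lipschitz.isBounded_image
    (Metric.isBounded_Icc l r)
  refine h.subset fun x hx => ⟨EuclideanSpace.equiv (Fin d) ℝ x, ⟨?_, ?_⟩, by simp⟩
  · exact fun i => (hx i).1.le
  · exact fun i => (hx i).2.le

theorem isCompact_closure_box : IsCompact (closure (box l r)) :=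
  isBounded_box.isCompact_closure

instance isFiniteMeasure_boxMeasure : IsFiniteMeasure (boxMeasure l r) :=
  ⟨by rw [boxMeasure, Measure.restrict_apply_univ]; exact isBounded_box.measure_lt_top⟩

theorem nonempty_box (hlr : ∀ i, l i < r i) : (box l r).Nonempty :=
  ⟨WithLp.toLp 2 fun i => (l i + r i) / 2, fun i => by
    have := hlr i
    constructor <;> simp <;> linarith⟩

theorem convex_box : Convex ℝ (box l r) := by
  intro x hx y hy a b ha hb hab i
  exact convex_Ioo (l i) (r i) (hx i) (hy i) ha hb hab

theorem exists_bound_box {F : Type*} [NormedAddCommGroup F] {f : EuclideanSpace ℝ (Fin d) → F}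
    (hf : Continuous f) : ∃ M, 0 ≤ M ∧ ∀ᵐ x ∂(boxMeasure l r), ‖f x‖ ≤ M := by
  obtain ⟨M, hM⟩ := (isCompact_closure_box (l := l) (r := r)).exists_bound_of_continuousOn
    hf.continuousOn
  refine ⟨max M 0, le_max_right _ _, ?_⟩
  exact ae_restrict_of_forall_mem measurableSet_box
    fun x hx => (hM x (subset_closure hx)).trans (le_max_left _ _)

/-- `∏ᵢ (xᵢ - lᵢ) (rᵢ - xᵢ)`, a superharmonic function vanishing on the boundary of the box. -/
noncomputable def boxBarrier (l r : Fin d → ℝ) (x : EuclideanSpace ℝ (Fin d)) : ℝ :=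
  ∏ i, (x i - l i) * (r i - x i)

theorem contDiff_boxBarrier : ContDiff ℝ ∞ (boxBarrier l r) :=
  contDiff_prod fun i _ => by fun_prop

theorem boxBarrier_pos {x : EuclideanSpace ℝ (Fin d)} (hx : x ∈ box l r) : 0 < boxBarrier l r x :=
  Finset.prod_pos fun i _ => mul_pos (sub_pos.2 (hx i).1) (sub_pos.2 (hx i).2)

theorem boxBarrier_frontier {x : EuclideanSpace ℝ (Fin d)} (hx : x ∈ frontier (box l r)) :
    boxBarrier l r x = 0 := by
  have h1 := closure_box_subset hx.1
  have h2 : x ∉ box l r := by simpa [isOpen_box.interior_eq] using hx.2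
  simp only [box, mem_ofPred_eq, not_forall] at h2
  obtain ⟨i, hi⟩ := h2
  refine Finset.prod_eq_zero (Finset.mem_univ i) ?_
  have := h1 i
  rcases eq_or_lt_of_le this.1 with h | h
  · rw [h]; simp
  · rcases eq_or_lt_of_le this.2 with h' | h'
    · rw [h']; simp
    · exact absurd ⟨h, h'⟩ hi

/-- Along the line in direction `i` only the factor `p` moves. The result has the same product form,
so the lemma can be applied again to get the second derivative. -/
theorem fderiv_prod_line {i : Fin d} {p : ℝ → ℝ} {p' : ℝ} {q : Fin d → ℝ → ℝ}
    {f : EuclideanSpace ℝ (Fin d) → ℝ} {y : EuclideanSpace ℝ (Fin d)}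
    (hf : ∀ x, f x = p (x i) * ∏ j ∈ Finset.univ.erase i, q j (x j)) (hd : DifferentiableAt ℝ f y)
    (hp : HasDerivAt p p' (y i)) :
    fderiv ℝ f y (EuclideanSpace.basisFun (Fin d) ℝ i) =
      p' * ∏ j ∈ Finset.univ.erase i, q j (y j) := by
  have h1 := hd.hasFDerivAt.hasLineDerivAt (EuclideanSpace.basisFun (Fin d) ℝ i)
  have h2 : HasDerivAt (fun t : ℝ => f (y + t • EuclideanSpace.basisFun (Fin d) ℝ i))
      (p' * ∏ j ∈ Finset.univ.erase i, q j (y j)) 0 := by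
    have e : (fun t : ℝ => f (y + t • EuclideanSpace.basisFun (Fin d) ℝ i)) =
        fun t => p (y i + t) * ∏ j ∈ Finset.univ.erase i, q j (y j) := by
      funext t
      rw [hf]
      congr 1
      · simp
      · refine Finset.prod_congr rfl fun j hj => ?_
        have : j ≠ i := Finset.ne_of_mem_erase hj
        simp [this]
    rw [e]
    refine HasDerivAt.mul_const ?_ _
    have := HasDerivAt.comp_const_add (y i) 0 (by simpa using hp)
    exact this
  exact h1.unique h2

/-- The second derivative in direction `i` is `-2` times the product of the remaining factors, all
of which are positive in the box. -/
theorem laplacian_boxBarrier_nonpos {x : EuclideanSpace ℝ (Fin d)} (hx : x ∈ box l r) :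
    Laplacian.laplacian (boxBarrier l r) x ≤ 0 := by
  have hs : ContDiff ℝ 2 (boxBarrier l r) := contDiff_infty.1 contDiff_boxBarrier 2
  rw [laplacian_eq_sum_fderiv (EuclideanSpace.basisFun (Fin d) ℝ) hs.contDiffAt]
  refine Finset.sum_nonpos fun i _ => ?_
  have h1 : ∀ y, fderiv ℝ (boxBarrier l r) y (EuclideanSpace.basisFun (Fin d) ℝ i) =
      (1 * (r i - y i) + (y i - l i) * (-1)) *
        ∏ j ∈ Finset.univ.erase i, (fun s => (s - l j) * (r j - s)) (y j) := fun y => by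
    refine fderiv_prod_line (p := fun s => (s - l i) * (r i - s))
      (q := fun j s => (s - l j) * (r j - s)) (fun x => ?_)
      (hs.differentiable (by norm_num) y) ?_
    · rw [boxBarrier, ← Finset.mul_prod_erase _ _ (Finset.mem_univ i)]
    · exact ((hasDerivAt_id _).sub_const _).mul ((hasDerivAt_id _).const_sub _)
  rw [fderiv_prod_line (p := fun s => 1 * (r i - s) + (s - l i) * (-1)) (p' := -2)
    (q := fun j s => (s - l j) * (r j - s)) h1
    ((contDiff_fderiv_apply hs _).differentiable (by norm_num) x) ?_]
  · refine mul_nonpos_of_nonpos_of_nonneg (by norm_num) (Finset.prod_nonneg fun j _ => ?_)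
    exact mul_nonneg (sub_nonneg.2 (hx j).1.le) (sub_nonneg.2 (hx j).2.le)
  · have := (((hasDerivAt_id (x i)).const_sub (r i)).const_mul 1).add
      (((hasDerivAt_id (x i)).sub_const (l i)).mul_const (-1))
    have h2 : (-2 : ℝ) = 1 * -1 + 1 * -1 := by norm_num
    rw [h2]
    exact this

end Box

/-! ### Boundary-layer cutoffs with uniformly bounded slope -/

/-- A smooth step: `0` on `(-∞, 1]`, `1` on `[2, ∞)`. -/
noncomputable def step (y : ℝ) : ℝ := Real.smoothTransition (y - 1)

theorem contDiff_step : ContDiff ℝ ∞ step :=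
  Real.smoothTransition.contDiff.comp (contDiff_id.sub contDiff_const)

theorem step_eq_zero {y : ℝ} (h : y ≤ 1) : step y = 0 :=
  Real.smoothTransition.zero_of_nonpos (by linarith)

theorem step_eq_one {y : ℝ} (h : 2 ≤ y) : step y = 1 :=
  Real.smoothTransition.one_of_one_le (by linarith)

theorem step_nonneg (y : ℝ) : 0 ≤ step y := Real.smoothTransition.nonneg _

theorem step_le_one (y : ℝ) : step y ≤ 1 := Real.smoothTransition.le_one _

theorem deriv_step_eq_zero {y : ℝ} (h : y < 1 ∨ 2 < y) : deriv step y = 0 := by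
  rcases h with h | h
  · have : step =ᶠ[𝓝 y] fun _ => 0 := by
      filter_upwards [gt_mem_nhds h] with s hs using step_eq_zero (le_of_lt hs)
    rw [this.deriv_eq, deriv_const]
  · have : step =ᶠ[𝓝 y] fun _ => 1 := by
      filter_upwards [lt_mem_nhds h] with s hs using step_eq_one (le_of_lt hs)
    rw [this.deriv_eq, deriv_const]

theorem continuous_deriv_step : Continuous (deriv step) :=
  contDiff_step.continuous_deriv (by norm_num)

/-- The quantity is invariant under rescaling the step, so `B` serves all cutoff widths at once. -/
theorem exists_abs_mul_deriv_step_le : ∃ B, 0 ≤ B ∧ ∀ y, |y * deriv step y| ≤ B := by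
  have hc : HasCompactSupport fun y => y * deriv step y :=
    HasCompactSupport.intro (isCompact_Icc (a := (1 : ℝ)) (b := 2)) fun y hy => by
      rw [deriv_step_eq_zero, mul_zero]
      by_contra! h
      exact hy ⟨h.1, h.2⟩
  obtain ⟨B, hB⟩ := hc.exists_bound_of_continuous (continuous_id.mul continuous_deriv_step)
  exact ⟨B, (abs_nonneg _).trans (hB 0), hB⟩

/-- The cutoff `(1 - exp (-k s)) step (j s)`. -/
noncomputable def barrierCutoff (k j s : ℝ) : ℝ := (1 - Real.exp (-(k * s))) * step (j * s)

theorem contDiff_barrierCutoff (k j : ℝ) : ContDiff ℝ ∞ (barrierCutoff k j) := by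
  have := contDiff_step.comp (contDiff_const.mul contDiff_id : ContDiff ℝ ∞ fun s : ℝ => j * s)
  exact ContDiff.mul (by fun_prop) this

theorem deriv_barrierCutoff (k j s : ℝ) : deriv (barrierCutoff k j) s =
    k * Real.exp (-(k * s)) * step (j * s) +
      (1 - Real.exp (-(k * s))) * (j * deriv step (j * s)) := by
  have h1 : HasDerivAt (fun s => 1 - Real.exp (-(k * s))) (k * Real.exp (-(k * s))) s := by
    have := ((((hasDerivAt_id s).const_mul k).neg).exp).const_sub 1
    simpa [mul_comm] using this
  have h2 : HasDerivAt (fun s => step (j * s)) (j * deriv step (j * s)) s := by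
    have h := (contDiff_step.differentiable (by norm_num) (j * s)).hasDerivAt
    have h' : HasDerivAt (fun s => j * s) j s := by simpa using (hasDerivAt_id s).const_mul j
    rw [mul_comm]
    exact h.comp s h'
  exact (h1.mul h2).deriv

theorem one_sub_exp_bounds {k s : ℝ} (hk : 0 ≤ k) (hs : 0 ≤ s) :
    0 ≤ 1 - Real.exp (-(k * s)) ∧ 1 - Real.exp (-(k * s)) ≤ 1 ∧
      1 - Real.exp (-(k * s)) ≤ k * s := by
  refine ⟨?_, ?_, ?_⟩
  · have : Real.exp (-(k * s)) ≤ 1 := Real.exp_le_one_iff.2 (by nlinarith)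
    linarith
  · have := Real.exp_pos (-(k * s))
    linarith
  · have := Real.add_one_le_exp (-(k * s))
    linarith

/-- The bound does not involve `j`. Differentiating the step costs a factor `j`, but `1 - exp (-k s)
≤ k s` supplies the `s` that completes it to `j s`. A bare step would have a slope of order `j`;
this is why the exponential factor is present. -/
theorem abs_deriv_barrierCutoff_le {B : ℝ} (hB : ∀ y, |y * deriv step y| ≤ B) {k j s : ℝ}
    (hk : 0 ≤ k) (hj : 0 ≤ j) (hs : 0 ≤ s) : |deriv (barrierCutoff k j) s| ≤ k + k * B := by
  rw [deriv_barrierCutoff]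
  obtain ⟨h1, h2, h3⟩ := one_sub_exp_bounds hk hs
  refine (abs_add_le _ _).trans (add_le_add ?_ ?_)
  · rw [abs_of_nonneg (by have := step_nonneg (j * s); positivity)]
    have : Real.exp (-(k * s)) ≤ 1 := by linarith
    calc k * Real.exp (-(k * s)) * step (j * s) ≤ k * 1 * 1 := by
          gcongr
          · exact step_nonneg _
          · exact step_le_one _
      _ = k := by ring
  · rw [abs_mul, abs_of_nonneg h1, abs_mul, abs_of_nonneg hj]
    calc (1 - Real.exp (-(k * s))) * (j * |deriv step (j * s)|)
        ≤ k * s * (j * |deriv step (j * s)|) := by gcongr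
      _ = k * |j * s * deriv step (j * s)| := by
          rw [abs_mul, abs_of_nonneg (mul_nonneg hj hs)]; ring
      _ ≤ k * B := by gcongr; exact hB _

theorem tendsto_natCast_succ_mul_atTop {s : ℝ} (hs : 0 < s) :
    Tendsto (fun n : ℕ => ((n : ℝ) + 1) * s) atTop atTop :=
  (tendsto_atTop_add_const_right _ _ tendsto_natCast_atTop_atTop).atTop_mul_const hs

/-! ### Integration by parts for entropies of zero-trace functions -/

section Box

variable {d : ℕ} {l r : Fin d → ℝ}

/-- No boundary term appears although `η` need not vanish on the boundary: the approximants of `z`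
are compactly supported in the box, and so are their entropies because `P 0 = 0`. This is the step
that uses the Dirichlet condition. -/
theorem integral_entropy_laplacian {z : EuclideanSpace ℝ (Fin d) → ℝ}
    {G : EuclideanSpace ℝ (Fin d) → EuclideanSpace ℝ (Fin d)} (h : HasZeroTraceGradient l r z G)
    {P : ℝ → ℝ} (hP : IsEntropy P) {η : EuclideanSpace ℝ (Fin d) → ℝ} (hη : ContDiff ℝ ∞ η) :
    ∫ x in box l r, P (z x) * Laplacian.laplacian η x =
      -∫ x in box l r, deriv P (z x) * inner ℝ (G x) (gradient η x) := by
  obtain ⟨hz, hG, φ, hφ, hφz, hφG⟩ := h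
  have hη2 : ContDiff ℝ 2 η := contDiff_infty.1 hη 2
  have hmeas : TendstoInMeasure (boxMeasure l r) φ atTop z :=
    tendstoInMeasure_of_tendsto_eLpNorm one_ne_zero
      (fun n => (hφ n).smooth.continuous.aestronglyMeasurable) hz.aestronglyMeasurable hφz
  -- The entropy derivative is controlled here only through boundedness and continuity, so the limit
  -- of its product with `G` needs almost everywhere convergence, hence a subsequence.
  obtain ⟨ns, hns, hae⟩ := hmeas.exists_seq_tendsto_ae
  have hφz' := hφz.comp hns.tendsto_atTop
  have hφG' := hφG.comp hns.tendsto_atTop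
  simp only [Function.comp_def, eLpNorm_one_eq_lintegral_enorm] at hφz' hφG'
  have hΔc : Continuous (Laplacian.laplacian η) := continuous_laplacian hη2
  have hgc : Continuous (gradient η) := (contDiff_gradient (n := 1) hη2).continuous
  obtain ⟨ML, hML0, hML⟩ := exists_bound_box (l := l) (r := r) hΔc
  obtain ⟨Mg, hMg0, hMg⟩ := exists_bound_box (l := l) (r := r) hgc
  have hzi : Integrable z (boxMeasure l r) := memLp_one_iff_integrable.1 hz
  have hGi : Integrable G (boxMeasure l r) := memLp_one_iff_integrable.1 hG
  have hφi : ∀ n, Integrable (φ n) (boxMeasure l r) := fun n =>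
    ((hφ n).smooth.continuous.integrable_of_hasCompactSupport (hφ n).compact_support).restrict
  have hφgc : ∀ n, Continuous (gradient (φ n)) := fun n =>
    (contDiff_gradient (n := 1) (hφ n).contDiff_two).continuous
  have hφgi : ∀ n, Integrable (gradient (φ n)) (boxMeasure l r) := fun n => by
    refine ((hφgc n).integrable_of_hasCompactSupport ?_).restrict
    refine (hφ n).compact_support.mono' fun x hx => ?_
    by_contra hxs
    exact hx ((IsTestFunction.mk (hφ n).smooth (hφ n).compact_support
      subset_rfl : IsTestFunction (tsupport (φ n)) (φ n)).gradient_eq_zero hxs)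
  have hPint : ∀ Y : EuclideanSpace ℝ (Fin d) → ℝ, Integrable Y (boxMeasure l r) →
      Integrable (fun x => P (Y x)) (boxMeasure l r) := fun Y hY =>
    hY.mono (hP.smooth.continuous.comp_aestronglyMeasurable hY.aestronglyMeasurable)
      (Eventually.of_forall fun x => hP.abs_le _)
  have hid : ∀ n, ∫ x in box l r, P (φ n x) * Laplacian.laplacian η x =
      -∫ x in box l r, deriv P (φ n x) * inner ℝ (gradient (φ n) x) (gradient η x) := fun n => by
    have hPφ := (hφ n).comp_zero hP.smooth hP.zero
    have := integral_mul_laplacian hPφ.contDiff_two hη2 (Or.inl hPφ.compact_support)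
    rw [setIntegral_eq_integral_of_forall_compl_eq_zero fun x hx => by
      rw [hPφ.eq_zero hx, zero_mul], this, setIntegral_eq_integral_of_forall_compl_eq_zero
      fun x hx => by rw [(hφ n).gradient_eq_zero hx, inner_zero_left, mul_zero]]
    congr 1
    refine integral_congr_ae (Eventually.of_forall fun x => ?_)
    simp only
    rw [gradient_comp (hP.contDiff_two.differentiable (by norm_num) _)
      ((hφ n).contDiff_two.differentiable (by norm_num) _), real_inner_smul_left]
  have hL : Tendsto (fun n => ∫ x in box l r, P (φ (ns n) x) * Laplacian.laplacian η x) atTop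
      (𝓝 (∫ x in box l r, P (z x) * Laplacian.laplacian η x)) := by
    refine tendsto_integral_mul_of_tendsto_L1 hΔc.aestronglyMeasurable hML
      (Eventually.of_forall fun n => hPint _ (hφi _)) (hPint _ hzi) ?_
    refine tendsto_of_tendsto_of_tendsto_of_le_of_le tendsto_const_nhds hφz'
      (fun _ => zero_le) fun n => lintegral_mono fun x => ?_
    exact enorm_le_iff_norm_le.2 (hP.abs_sub_le _ _)
  have hbd : ∀ (Y : EuclideanSpace ℝ (Fin d) → ℝ)
      (H : EuclideanSpace ℝ (Fin d) → EuclideanSpace ℝ (Fin d)) x, ‖gradient η x‖ ≤ Mg →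
      ‖deriv P (Y x) * inner ℝ (H x) (gradient η x)‖ ≤ ‖H x‖ * Mg := by
    intro Y H x hx
    rw [norm_mul]
    calc ‖deriv P (Y x)‖ * ‖inner ℝ (H x) (gradient η x)‖
        ≤ 1 * (‖H x‖ * ‖gradient η x‖) := by
          gcongr
          · exact hP.abs_deriv_le _
          · exact norm_inner_le_norm _ _
      _ ≤ ‖H x‖ * Mg := by rw [one_mul]; gcongr
  have hin : ∀ (Y : EuclideanSpace ℝ (Fin d) → ℝ)
      (H : EuclideanSpace ℝ (Fin d) → EuclideanSpace ℝ (Fin d)),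
      Integrable Y (boxMeasure l r) → Integrable H (boxMeasure l r) →
      Integrable (fun x => deriv P (Y x) * inner ℝ (H x) (gradient η x)) (boxMeasure l r) := by
    intro Y H hY hH
    refine Integrable.mono' (hH.norm.mul_const Mg)
      ((hP.continuous_deriv.comp_aestronglyMeasurable hY.aestronglyMeasurable).mul
        (hH.aestronglyMeasurable.inner hgc.aestronglyMeasurable)) ?_
    filter_upwards [hMg] with x hx
    exact hbd Y H x hx
  have hR1 : Tendsto (fun n => ∫ x, deriv P (φ (ns n) x) *
      inner ℝ (gradient (φ (ns n)) x - G x) (gradient η x) ∂(boxMeasure l r)) atTop (𝓝 0) := by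
    have h0 : (0 : ℝ) = ∫ _, (0 : ℝ) ∂(boxMeasure l r) := by simp
    rw [h0]
    refine tendsto_integral_of_L1 _ aestronglyMeasurable_const (Eventually.of_forall fun n =>
      hin _ _ (hφi _) ((hφgi _).sub hGi)) ?_
    have h2 := ENNReal.Tendsto.mul_const hφG' (b := ENNReal.ofReal Mg)
      (Or.inr ENNReal.ofReal_ne_top)
    rw [zero_mul] at h2
    refine tendsto_of_tendsto_of_tendsto_of_le_of_le tendsto_const_nhds h2 (fun _ => zero_le) ?_
    intro n
    simp only
    rw [← lintegral_mul_const' _ _ ENNReal.ofReal_ne_top]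
    refine lintegral_mono_ae (hMg.mono fun x hx => ?_)
    rw [sub_zero, ← ofReal_norm, ← ofReal_norm, ← ENNReal.ofReal_mul (norm_nonneg _)]
    refine ENNReal.ofReal_le_ofReal ?_
    exact hbd (φ (ns n)) (fun x => gradient (φ (ns n)) x - G x) x hx
  have hR2 : Tendsto (fun n => ∫ x, deriv P (φ (ns n) x) *
      inner ℝ (G x) (gradient η x) ∂(boxMeasure l r)) atTop
      (𝓝 (∫ x, deriv P (z x) * inner ℝ (G x) (gradient η x) ∂(boxMeasure l r))) := by
    refine tendsto_integral_of_dominated_convergence (fun x => ‖G x‖ * Mg)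
      (fun n => (hin _ _ (hφi _) hGi).aestronglyMeasurable) (hGi.norm.mul_const _)
      (fun n => ?_) ?_
    · filter_upwards [hMg] with x hx
      exact hbd (φ (ns n)) G x hx
    · filter_upwards [hae] with x hx
      exact ((hP.continuous_deriv.tendsto _).comp hx).mul_const _
  have hR := hR1.add hR2
  rw [zero_add] at hR
  refine tendsto_nhds_unique hL (hR.neg.congr fun n => ?_)
  have hi := hin _ _ (hφi (ns n)) ((hφgi (ns n)).sub hGi)
  simp only [Pi.sub_apply] at hi
  rw [hid, ← integral_add hi (hin _ _ (hφi _) hGi)]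
  congr 1
  refine integral_congr_ae (Eventually.of_forall fun x => ?_)
  simp only
  rw [← mul_add, ← inner_add_left, sub_add_cancel]

end Box

/-! ### Kato's inequality up to the boundary -/

section KatoBox

variable {d : ℕ} {l r : Fin d → ℝ}

/-- An increasing concave function of a superharmonic function is superharmonic. -/
theorem laplacian_one_sub_exp_boxBarrier_nonpos {k : ℝ} (hk : 0 ≤ k)
    {x : EuclideanSpace ℝ (Fin d)} (hx : x ∈ box l r) :
    Laplacian.laplacian (fun y => 1 - Real.exp (-(k * boxBarrier l r y))) x ≤ 0 := by
  have hs : ContDiff ℝ 2 (boxBarrier l r) := contDiff_infty.1 contDiff_boxBarrier 2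
  have hS : ContDiff ℝ 2 fun s : ℝ => 1 - Real.exp (-(k * s)) := by fun_prop
  have h1 : ∀ s, HasDerivAt (fun s => 1 - Real.exp (-(k * s))) (k * Real.exp (-(k * s))) s := by
    intro s
    have := ((((hasDerivAt_id s).const_mul k).neg).exp).const_sub 1
    simpa [mul_comm] using this
  have h2 : deriv (fun s => 1 - Real.exp (-(k * s))) = fun s => k * Real.exp (-(k * s)) :=
    funext fun s => (h1 s).deriv
  have h3 : ∀ s, deriv (fun s => k * Real.exp (-(k * s))) s = -(k ^ 2 * Real.exp (-(k * s))) := by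
    intro s
    have := ((((hasDerivAt_id s).const_mul k).neg).exp).const_mul k
    refine Eq.trans this.deriv ?_
    simp only [id, mul_one, Pi.neg_apply]
    ring
  rw [laplacian_comp hS hs.contDiffAt, h2, h3]
  have ha := laplacian_boxBarrier_nonpos hx
  have hb : 0 ≤ k * Real.exp (-(k * boxBarrier l r x)) := by positivity
  have hc : 0 ≤ k ^ 2 * Real.exp (-(k * boxBarrier l r x)) * ‖fderiv ℝ (boxBarrier l r) x‖ ^ 2 := by
    positivity
  have := mul_nonpos_of_nonneg_of_nonpos hb ha
  linarith

/-- The weight is superharmonic and vanishes on the boundary, but it is not compactly supported in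
the box. It is cut off near the boundary, the cutoff is removed at the level of first derivatives,
and the resulting gradient integral is turned back into a Laplacian of the uncut weight. -/
theorem kato_box_barrier {z g : EuclideanSpace ℝ (Fin d) → ℝ}
    {G : EuclideanSpace ℝ (Fin d) → EuclideanSpace ℝ (Fin d)} (h : HasZeroTraceGradient l r z G)
    (hg : IntegrableOn g (box l r))
    (hw : ∀ ψ, IsTestFunction (box l r) ψ →
      ∫ x in box l r, z x * Laplacian.laplacian ψ x = ∫ x in box l r, g x * ψ x)
    {P : ℝ → ℝ} (hP : IsEntropy P) {k : ℝ} (hk : 0 ≤ k) :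
    ∫ x in box l r, (1 - Real.exp (-(k * boxBarrier l r x))) * (deriv P (z x) * g x) ≤ 0 := by
  set e := boxBarrier l r
  have hz : IntegrableOn z (box l r) := memLp_one_iff_integrable.1 h.1
  have hGi : Integrable G (boxMeasure l r) := memLp_one_iff_integrable.1 h.2.1
  have hes : ContDiff ℝ ∞ e := contDiff_boxBarrier
  have hes2 : ContDiff ℝ 2 e := contDiff_infty.1 hes 2
  set S : ℝ → ℝ := fun s => 1 - Real.exp (-(k * s))
  have hS : ContDiff ℝ ∞ S := by fun_prop
  let σ : ℕ → ℝ → ℝ := fun n => barrierCutoff k ((n : ℝ) + 1)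
  let η : ℕ → EuclideanSpace ℝ (Fin d) → ℝ := fun n => (box l r).indicator fun x => σ n (e x)
  have hη : ∀ n, IsTestFunction (box l r) (η n) := fun n => by
    refine isTestFunction_indicator_comp isOpen_box isCompact_closure_box hes.continuous.continuousOn
      hes.contDiffOn (fun x hx => boxBarrier_frontier hx) (contDiff_barrierCutoff k _)
      (δ := 1 / ((n : ℝ) + 1)) (by positivity) fun s hs => ?_
    change barrierCutoff k ((n : ℝ) + 1) s = 0
    rw [barrierCutoff, step_eq_zero, mul_zero]
    rw [lt_div_iff₀ (by positivity)] at hs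
    linarith
  have hη0 : ∀ n x, 0 ≤ η n x := fun n x => by
    refine indicator_nonneg (fun x hx => ?_) x
    exact mul_nonneg (one_sub_exp_bounds hk (boxBarrier_pos hx).le).1 (step_nonneg _)
  obtain ⟨B, hB0, hB⟩ := exists_abs_mul_deriv_step_le
  have hgc : Continuous (gradient e) := (contDiff_gradient (n := 1) hes2).continuous
  obtain ⟨Mg, hMg0, hMg⟩ := exists_bound_box (l := l) (r := r) hgc
  have hdP : AEStronglyMeasurable (fun x => deriv P (z x)) (boxMeasure l r) :=
    hP.continuous_deriv.comp_aestronglyMeasurable hz.aestronglyMeasurable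
  have hle : ∀ n, ∫ x in box l r, σ n (e x) * (deriv P (z x) * g x) ≤
      -∫ x in box l r, deriv P (z x) * (deriv (σ n) (e x) * inner ℝ (G x) (gradient e x)) := by
    intro n
    -- The second derivative of the cutoff has no bound uniform in `n`. Integrating by parts once
    -- leaves only its first derivative, which is bounded uniformly.
    have h1 := kato_local isOpen_box hz hg hw hP (hη n) (hη0 n)
    rw [integral_entropy_laplacian h hP (hη n).smooth] at h1
    rw [setIntegral_congr_fun (g := fun x => σ n (e x) * (deriv P (z x) * g x)) measurableSet_box
      (fun x hx => by simp [η, hx])] at h1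
    refine h1.trans_eq ?_
    congr 1
    refine setIntegral_congr_fun measurableSet_box fun x hx => ?_
    have hev : η n =ᶠ[𝓝 x] fun y => σ n (e y) := by
      filter_upwards [isOpen_box.mem_nhds hx] with y hy
      simp [η, hy]
    have : gradient (η n) x = deriv (σ n) (e x) • gradient e x := by
      rw [← gradient_comp ((contDiff_barrierCutoff _ _).differentiable (by norm_num) _)
        (hes.differentiable (by norm_num) _), gradient, gradient, hev.fderiv_eq]
    simp only [this, real_inner_smul_right]
  have hstep : ∀ s, 0 < s → ∀ᶠ n : ℕ in atTop, 2 < ((n : ℝ) + 1) * s := fun s hs =>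
    (tendsto_natCast_succ_mul_atTop hs).eventually (eventually_gt_atTop 2)
  have hL : Tendsto (fun n => ∫ x in box l r, σ n (e x) * (deriv P (z x) * g x)) atTop
      (𝓝 (∫ x in box l r, S (e x) * (deriv P (z x) * g x))) := by
    refine tendsto_integral_of_dominated_convergence (fun x => ‖g x‖) (fun n => ?_) hg.norm
      (fun n => ?_) ?_
    · exact ((contDiff_barrierCutoff k _).continuous.comp hes.continuous).aestronglyMeasurable.mul
        (hdP.mul hg.aestronglyMeasurable)
    · refine ae_restrict_of_forall_mem measurableSet_box fun x hx => ?_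
      have hb := one_sub_exp_bounds hk (boxBarrier_pos hx).le
      have h1 : ‖σ n (e x)‖ ≤ 1 := by
        change |(1 - Real.exp (-(k * e x))) * step (((n : ℝ) + 1) * e x)| ≤ 1
        rw [abs_of_nonneg (mul_nonneg hb.1 (step_nonneg _))]
        exact mul_le_one₀ hb.2.1 (step_nonneg _) (step_le_one _)
      rw [norm_mul, norm_mul]
      calc ‖σ n (e x)‖ * (‖deriv P (z x)‖ * ‖g x‖) ≤ 1 * (1 * ‖g x‖) := by
            gcongr
            exact hP.abs_deriv_le _
        _ = ‖g x‖ := by ring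
    · refine ae_restrict_of_forall_mem measurableSet_box fun x hx => ?_
      refine tendsto_const_nhds.congr' ?_
      filter_upwards [hstep _ (boxBarrier_pos hx)] with n hn
      simp only [σ, S, barrierCutoff, e]
      rw [step_eq_one hn.le, mul_one]
  have hR : Tendsto (fun n => ∫ x in box l r,
      deriv P (z x) * (deriv (σ n) (e x) * inner ℝ (G x) (gradient e x))) atTop
      (𝓝 (∫ x in box l r, deriv P (z x) * (deriv S (e x) * inner ℝ (G x) (gradient e x)))) := by
    refine tendsto_integral_of_dominated_convergence (fun x => (k + k * B) * (‖G x‖ * Mg))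
      (fun n => ?_) ((hGi.norm.mul_const _).const_mul _) (fun n => ?_) ?_
    · exact hdP.mul ((((contDiff_barrierCutoff k _).continuous_deriv (by norm_num)).comp
        hes.continuous).aestronglyMeasurable.mul
        (hGi.aestronglyMeasurable.inner hgc.aestronglyMeasurable))
    · filter_upwards [hMg, ae_restrict_mem measurableSet_box] with x hx hxb
      rw [norm_mul, norm_mul]
      calc ‖deriv P (z x)‖ * (‖deriv (σ n) (e x)‖ * ‖inner ℝ (G x) (gradient e x)‖)
          ≤ 1 * ((k + k * B) * (‖G x‖ * ‖gradient e x‖)) := by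
            gcongr
            · exact hP.abs_deriv_le _
            · exact abs_deriv_barrierCutoff_le hB hk (by positivity) (boxBarrier_pos hxb).le
            · exact norm_inner_le_norm _ _
        _ ≤ (k + k * B) * (‖G x‖ * Mg) := by rw [one_mul]; gcongr
    · refine ae_restrict_of_forall_mem measurableSet_box fun x hx => ?_
      refine tendsto_const_nhds.congr' ?_
      filter_upwards [hstep _ (boxBarrier_pos hx)] with n hn
      have : deriv S (e x) = deriv (σ n) (e x) := by
        rw [deriv_barrierCutoff, step_eq_one hn.le, deriv_step_eq_zero (Or.inr hn)]
        have := (((((hasDerivAt_id (e x)).const_mul k).neg).exp).const_sub 1).deriv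
        refine Eq.trans this ?_
        simp only [id, mul_one, Pi.neg_apply]
        ring
      rw [this]
  refine (le_of_tendsto_of_tendsto' hL hR.neg hle).trans ?_
  -- The integration by parts is now reversed with the uncut weight, and the sign follows from `P ≥
  -- 0` and superharmonicity.
  have hSe : ContDiff ℝ ∞ fun x => S (e x) := hS.comp hes
  have h2 := integral_entropy_laplacian h hP hSe
  have h3 : ∀ x, gradient (fun y => S (e y)) x = deriv S (e x) • gradient e x := fun x =>
    gradient_comp (hS.differentiable (by norm_num) _) (hes.differentiable (by norm_num) _)
  simp only [h3, real_inner_smul_right] at h2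
  rw [← h2]
  refine setIntegral_nonpos measurableSet_box fun x hx => ?_
  exact mul_nonpos_of_nonneg_of_nonpos (hP.nonneg _)
    (laplacian_one_sub_exp_boxBarrier_nonpos hk hx)

/-- As the parameter of the barrier weight tends to infinity, the weight tends to `1` wherever the
barrier is positive, that is, throughout the box, and it never exceeds `1`. -/
theorem kato_box_entropy {z g : EuclideanSpace ℝ (Fin d) → ℝ}
    {G : EuclideanSpace ℝ (Fin d) → EuclideanSpace ℝ (Fin d)} (h : HasZeroTraceGradient l r z G)
    (hg : IntegrableOn g (box l r))
    (hw : ∀ ψ, IsTestFunction (box l r) ψ →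
      ∫ x in box l r, z x * Laplacian.laplacian ψ x = ∫ x in box l r, g x * ψ x)
    {P : ℝ → ℝ} (hP : IsEntropy P) : ∫ x in box l r, deriv P (z x) * g x ≤ 0 := by
  have hz : IntegrableOn z (box l r) := memLp_one_iff_integrable.1 h.1
  refine le_of_tendsto' (f := fun n : ℕ => ∫ x in box l r,
    (1 - Real.exp (-(((n : ℝ) + 1) * boxBarrier l r x))) * (deriv P (z x) * g x)) (x := atTop) ?_
    fun n => kato_box_barrier h hg hw hP (by positivity)
  refine tendsto_integral_of_dominated_convergence (fun x => ‖g x‖) (fun n => ?_) hg.norm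
    (fun n => ?_) ?_
  · have hc : Continuous fun x => 1 - Real.exp (-(((n : ℝ) + 1) * boxBarrier l r x)) := by
      have := (contDiff_boxBarrier (l := l) (r := r)).continuous
      fun_prop
    exact hc.aestronglyMeasurable.mul ((hP.continuous_deriv.comp_aestronglyMeasurable
      hz.aestronglyMeasurable).mul hg.aestronglyMeasurable)
  · refine ae_restrict_of_forall_mem measurableSet_box fun x hx => ?_
    have hb := one_sub_exp_bounds (k := (n : ℝ) + 1) (by positivity) (boxBarrier_pos hx).le
    rw [norm_mul, norm_mul, Real.norm_of_nonneg hb.1]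
    calc _ ≤ 1 * (1 * ‖g x‖) := by
          gcongr
          · exact hb.2.1
          · exact hP.abs_deriv_le _
      _ = ‖g x‖ := by ring
  · refine ae_restrict_of_forall_mem measurableSet_box fun x hx => ?_
    have h1 : Tendsto (fun n : ℕ => Real.exp (-(((n : ℝ) + 1) * boxBarrier l r x))) atTop (𝓝 0) :=
      Real.tendsto_exp_neg_atTop_nhds_zero.comp
        (tendsto_natCast_succ_mul_atTop (boxBarrier_pos hx))
    simpa using (h1.const_sub 1).mul_const (deriv P (z x) * g x)

/-- `√(s² + δ²) - δ`. -/
noncomputable def sqrtEntropy (δ s : ℝ) : ℝ := √(s ^ 2 + δ ^ 2) - δ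

theorem hasDerivAt_sqrtEntropy {δ : ℝ} (hδ : 0 < δ) (s : ℝ) :
    HasDerivAt (sqrtEntropy δ) (s / √(s ^ 2 + δ ^ 2)) s := by
  have h : HasDerivAt (fun s : ℝ => s ^ 2 + δ ^ 2) (2 * s) s := by
    simpa using ((hasDerivAt_id s).pow 2).add_const (δ ^ 2)
  have := (h.sqrt (by positivity)).sub_const δ
  have h2 : s / √(s ^ 2 + δ ^ 2) = 2 * s / (2 * √(s ^ 2 + δ ^ 2)) :=
    (mul_div_mul_left _ _ two_ne_zero).symm
  rw [h2]
  exact this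

theorem deriv_sqrtEntropy {δ : ℝ} (hδ : 0 < δ) :
    deriv (sqrtEntropy δ) = fun s => s / √(s ^ 2 + δ ^ 2) :=
  funext fun s => (hasDerivAt_sqrtEntropy hδ s).deriv

theorem isEntropy_sqrtEntropy {δ : ℝ} (hδ : 0 < δ) : IsEntropy (sqrtEntropy δ) where
  smooth := by
    refine ContDiff.sub (ContDiff.sqrt (by fun_prop) fun s => by positivity) contDiff_const
  zero := by simp [sqrtEntropy, Real.sqrt_sq hδ.le]
  nonneg s := by
    have : δ ≤ √(s ^ 2 + δ ^ 2) := Real.le_sqrt_of_sq_le (by nlinarith [sq_nonneg s])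
    rw [sqrtEntropy]; linarith
  abs_deriv_le s := by
    rw [deriv_sqrtEntropy hδ]
    simp only
    rw [abs_div, abs_of_nonneg (Real.sqrt_nonneg _), div_le_one (by positivity)]
    exact Real.abs_le_sqrt (by nlinarith [sq_nonneg δ])
  deriv_deriv_nonneg s := by
    rw [deriv_sqrtEntropy hδ]
    have h : HasDerivAt (fun s : ℝ => s ^ 2 + δ ^ 2) (2 * s) s := by
      simpa using ((hasDerivAt_id s).pow 2).add_const (δ ^ 2)
    have hpos : 0 < s ^ 2 + δ ^ 2 := by positivity
    have h2 := (hasDerivAt_id s).div (h.sqrt hpos.ne') (by positivity)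
    refine le_of_le_of_eq ?_ h2.deriv.symm
    refine div_nonneg ?_ (sq_nonneg _)
    have h3 : √(s ^ 2 + δ ^ 2) * √(s ^ 2 + δ ^ 2) = s ^ 2 + δ ^ 2 := Real.mul_self_sqrt hpos.le
    have h4 : 0 < √(s ^ 2 + δ ^ 2) := Real.sqrt_pos.2 hpos
    have h5 : 1 * √(s ^ 2 + δ ^ 2) - id s * (2 * s / (2 * √(s ^ 2 + δ ^ 2))) =
        δ ^ 2 / √(s ^ 2 + δ ^ 2) := by
      simp only [id]
      field_simp
      rw [Real.sq_sqrt hpos.le]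
      ring
    rw [h5]
    positivity

/-- At `s = 0` all the derivatives vanish, in agreement with `Real.sign 0 = 0`, so the limit holds
at every point and not only almost everywhere. -/
theorem tendsto_deriv_sqrtEntropy (s : ℝ) :
    Tendsto (fun n : ℕ => deriv (sqrtEntropy (1 / ((n : ℝ) + 1))) s) atTop (𝓝 (Real.sign s)) := by
  have h0 : ∀ n : ℕ, deriv (sqrtEntropy (1 / ((n : ℝ) + 1))) s =
      s / √(s ^ 2 + (1 / ((n : ℝ) + 1)) ^ 2) := fun n => by
    rw [deriv_sqrtEntropy (by positivity)]
  simp_rw [h0]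
  rcases eq_or_ne s 0 with rfl | hs
  · simp
  · have h1 : Tendsto (fun n : ℕ => √(s ^ 2 + (1 / ((n : ℝ) + 1)) ^ 2)) atTop (𝓝 |s|) := by
      have h2 := ((tendsto_one_div_add_atTop_nhds_zero_nat (𝕜 := ℝ)).pow 2).const_add (s ^ 2)
      have := (Real.continuous_sqrt.tendsto _).comp h2
      simpa [Real.sqrt_sq_eq_abs, Function.comp_def] using this
    have h3 : s / |s| = Real.sign s := by
      rcases lt_or_gt_of_ne hs with h | h
      · rw [abs_of_neg h, Real.sign_of_neg h, div_neg, div_self hs]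
      · rw [abs_of_pos h, Real.sign_of_pos h, div_self hs]
    rw [← h3]
    exact tendsto_const_nhds.div h1 (abs_ne_zero.2 hs)

/-- Kato's inequality on the box: `∫ sign(z) Δz ≤ 0` for `z ∈ W₀^{1,1}` with `Δz ∈ L¹`. -/
theorem kato_box {z g : EuclideanSpace ℝ (Fin d) → ℝ}
    {G : EuclideanSpace ℝ (Fin d) → EuclideanSpace ℝ (Fin d)} (h : HasZeroTraceGradient l r z G)
    (hg : IntegrableOn g (box l r))
    (hw : ∀ ψ, IsTestFunction (box l r) ψ →
      ∫ x in box l r, z x * Laplacian.laplacian ψ x = ∫ x in box l r, g x * ψ x) :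
    ∫ x in box l r, Real.sign (z x) * g x ≤ 0 := by
  have hz : IntegrableOn z (box l r) := memLp_one_iff_integrable.1 h.1
  refine le_of_tendsto' (f := fun n : ℕ => ∫ x in box l r,
    deriv (sqrtEntropy (1 / ((n : ℝ) + 1))) (z x) * g x) (x := atTop) ?_
    fun n => kato_box_entropy h hg hw (isEntropy_sqrtEntropy (by positivity))
  have hE : ∀ n : ℕ, IsEntropy (sqrtEntropy (1 / ((n : ℝ) + 1))) :=
    fun n => isEntropy_sqrtEntropy (by positivity)
  refine tendsto_integral_of_dominated_convergence (fun x => ‖g x‖) (fun n => ?_) hg.norm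
    (fun n => Eventually.of_forall fun x => ?_) (Eventually.of_forall fun x => ?_)
  · exact ((hE n).continuous_deriv.comp_aestronglyMeasurable hz.aestronglyMeasurable).mul
      hg.aestronglyMeasurable
  · rw [norm_mul]
    exact mul_le_of_le_one_left (norm_nonneg _) ((hE n).abs_deriv_le _)
  · exact (tendsto_deriv_sqrtEntropy _).mul_const _

end KatoBox

/-! ### One-dimensional tools: absolute values and weak derivatives in time -/

section OneDim

theorem AbsolutelyContinuousOnInterval.abs {f : ℝ → ℝ} {a b : ℝ}
    (hf : AbsolutelyContinuousOnInterval f a b) :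
    AbsolutelyContinuousOnInterval (fun x => |f x|) a b := by
  refine squeeze_zero (fun t => Finset.sum_nonneg fun i _ => dist_nonneg) (fun t => ?_) hf
  refine Finset.sum_le_sum fun i _ => ?_
  rw [Real.dist_eq, Real.dist_eq]
  exact abs_abs_sub_abs_le_abs_sub _ _

/-- The primitive is absolutely continuous and so is its absolute value, hence the latter is the
integral of its derivative; that derivative is computed at almost every point according to the sign
of the primitive. -/
theorem abs_sub_abs_eq_integral_sign {H : ℝ → ℝ} {a b : ℝ} (hH : IntervalIntegrable H volume a b)
    (c : ℝ) : |c + ∫ s in a..b, H s| - |c| =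
      ∫ s in a..b, Real.sign (c + ∫ τ in a..s, H τ) * H s := by
  set F : ℝ → ℝ := fun s => c + ∫ τ in a..s, H τ
  have hF : AbsolutelyContinuousOnInterval F a b := by
    have h1 := hH.absolutelyContinuousOnInterval_intervalIntegral (c := a) left_mem_uIcc
    have h2 : AbsolutelyContinuousOnInterval (fun _ : ℝ => c) a b :=
      (contDiff_const.contDiffOn).absolutelyContinuousOnInterval
    exact h2.add h1
  have hab := AbsolutelyContinuousOnInterval.abs hF
  have h := hab.integral_deriv_eq_sub
  have e1 : |F b| - |F a| = |c + ∫ s in a..b, H s| - |c| := by simp [F]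
  rw [← e1, ← h]
  refine intervalIntegral.integral_congr_ae ?_
  filter_upwards [hab.ae_differentiableAt, hH.ae_hasDerivAt_integral] with s h1 h2 hs
  have hs' := uIoc_subset_uIcc hs
  have hFd : HasDerivAt F (H s) s := (h2 hs' a left_mem_uIcc).const_add c
  rcases lt_trichotomy (F s) 0 with h0 | h0 | h0
  · rw [Real.sign_of_neg h0]
    have := hFd.neg.congr_of_eventuallyEq (f₁ := fun x => |F x|) (by
      filter_upwards [hFd.continuousAt.eventually (gt_mem_nhds h0)] with x hx
      exact abs_of_neg hx)
    rw [this.deriv]; ring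
  -- At a zero of `F` the function `|F|` has a minimum, so its derivative is zero whatever `H s` is.
  · change _ = Real.sign (F s) * H s
    rw [h0, Real.sign_zero, zero_mul]
    have : IsLocalMin (fun x => |F x|) s := Eventually.of_forall fun x => by
      simp [h0]
    exact this.deriv_eq_zero
  · rw [Real.sign_of_pos h0]
    have := hFd.congr_of_eventuallyEq (f₁ := fun x => |F x|) (by
      filter_upwards [hFd.continuousAt.eventually (lt_mem_nhds h0)] with x hx
      exact abs_of_pos hx)
    rw [this.deriv]; ring

theorem smoothTransition_deriv_nonneg (y : ℝ) : 0 ≤ deriv Real.smoothTransition y :=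
  Real.smoothTransition.monotone.deriv_nonneg

theorem smoothTransition_deriv_eq_zero {y : ℝ} (h : y < 0 ∨ 1 < y) :
    deriv Real.smoothTransition y = 0 := by
  rcases h with h | h
  · have : Real.smoothTransition =ᶠ[𝓝 y] fun _ => 0 := by
      filter_upwards [gt_mem_nhds h] with s hs
      exact Real.smoothTransition.zero_of_nonpos (le_of_lt hs)
    rw [this.deriv_eq, deriv_const]
  · have : Real.smoothTransition =ᶠ[𝓝 y] fun _ => 1 := by
      filter_upwards [lt_mem_nhds h] with s hs
      exact Real.smoothTransition.one_of_one_le (le_of_lt hs)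
    rw [this.deriv_eq, deriv_const]

theorem hasDerivAt_smoothTransition_scaled (m c t : ℝ) :
    HasDerivAt (fun t => Real.smoothTransition (m * (t - c)))
      (m * deriv Real.smoothTransition (m * (t - c))) t := by
  have h1 : HasDerivAt (fun t => m * (t - c)) m t := by
    simpa using ((hasDerivAt_id t).sub_const c).const_mul m
  have h2 := ((Real.smoothTransition.contDiff (n := 1)).differentiable (by norm_num)
    (m * (t - c))).hasDerivAt
  rw [mul_comm]
  exact h2.comp t h1

theorem continuous_deriv_smoothTransition_scaled (m c : ℝ) :
    Continuous fun t => m * deriv Real.smoothTransition (m * (t - c)) := by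
  have := (Real.smoothTransition.contDiff (n := 1)).continuous_deriv (by norm_num)
  fun_prop

theorem integrableOn_smoothTransition_mul {T c m : ℝ} {U : ℝ → ℝ} (hU : ContinuousOn U (Ioo 0 T))
    (hc : 0 < c) (hm : 0 < m) (hcm : c + 1 / m < T) :
    IntegrableOn (fun t => m * deriv Real.smoothTransition (m * (t - c)) * U t) (Ioo 0 T) := by
  have h1 : Icc c (c + 1 / m) ⊆ Ioo 0 T := fun t ht => ⟨hc.trans_le ht.1, ht.2.trans_lt hcm⟩
  have h2 : IntegrableOn (fun t => m * deriv Real.smoothTransition (m * (t - c)) * U t)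
      (Icc c (c + 1 / m)) :=
    ((continuous_deriv_smoothTransition_scaled m c).continuousOn.mul
      (hU.mono h1)).integrableOn_compact isCompact_Icc
  refine h2.of_forall_sdiff_eq_zero measurableSet_Ioo fun t ht => ?_
  rw [smoothTransition_deriv_eq_zero, mul_zero, zero_mul]
  by_contra! h
  refine ht.2 ⟨?_, ?_⟩
  · have := h.1
    by_contra! h'
    nlinarith
  · have h3 := h.2
    rw [← sub_le_iff_le_add', le_div_iff₀ hm]
    linarith

/-- The kernel is a one-sided approximate identity: nonnegative, of unit mass for large `n`, and
concentrated on `[c, c + 1 / (n + 1)]`. -/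
theorem tendsto_integral_smoothTransition_mul {T c : ℝ} {U : ℝ → ℝ} (hU : ContinuousOn U (Ioo 0 T))
    (hc : c ∈ Ioo 0 T) :
    Tendsto (fun n : ℕ => ∫ t in Ioo 0 T,
      ((n : ℝ) + 1) * deriv Real.smoothTransition (((n : ℝ) + 1) * (t - c)) * U t) atTop
      (𝓝 (U c)) := by
  rw [Metric.tendsto_atTop']
  intro ε hε
  have hUc : ContinuousAt U c := hU.continuousAt (isOpen_Ioo.mem_nhds hc)
  obtain ⟨δ, hδ, hball⟩ := Metric.eventually_nhds_iff.1
    ((Metric.continuousAt_iff'.1 hUc (ε / 2) (half_pos hε)).and (isOpen_Ioo.mem_nhds hc))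
  obtain ⟨N, hN⟩ := exists_nat_one_div_lt hδ
  refine ⟨N, fun n hn => ?_⟩
  set m : ℝ := (n : ℝ) + 1
  have hm : 0 < m := by positivity
  have hmδ : 1 / m < δ := lt_of_le_of_lt (one_div_le_one_div_of_le (by positivity)
    (by simp only [m]; gcongr)) hN
  have hcm : c + 1 / m < T := by
    have := (hball (y := c + 1 / m) (by
      rw [Real.dist_eq, add_sub_cancel_left, abs_of_pos (by positivity)]; exact hmδ)).2
    exact this.2
  set κ : ℝ → ℝ := fun t => m * deriv Real.smoothTransition (m * (t - c))
  have hκ0 : ∀ t, 0 ≤ κ t := fun t => mul_nonneg hm.le (smoothTransition_deriv_nonneg _)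
  have hκc : Continuous κ := continuous_deriv_smoothTransition_scaled m c
  have hT : 0 < T := hc.1.trans hc.2
  have hκ1 : ∫ t in Ioo 0 T, κ t = 1 := by
    rw [← integral_Ioc_eq_integral_Ioo, ← intervalIntegral.integral_of_le hT.le,
      intervalIntegral.integral_eq_sub_of_hasDerivAt
        (fun t _ => hasDerivAt_smoothTransition_scaled m c t) (hκc.intervalIntegrable _ _),
      Real.smoothTransition.one_of_one_le, Real.smoothTransition.zero_of_nonpos, sub_zero]
    · have := hc.1
      nlinarith
    · have : 1 / m < T - c := by linarith
      rw [div_lt_iff₀ hm] at this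
      linarith
  have hκi : IntegrableOn κ (Ioo 0 T) :=
    (hκc.integrableOn_Icc (a := 0) (b := T)).mono_set Ioo_subset_Icc_self
  have e : (∫ t in Ioo 0 T, κ t * U t) - U c = ∫ t in Ioo 0 T, κ t * (U t - U c) := by
    have h1 : ∫ t in Ioo 0 T, κ t * U c = U c := by rw [integral_mul_const, hκ1, one_mul]
    rw [← h1, ← integral_sub (integrableOn_smoothTransition_mul hU hc.1 hm hcm)
      (hκi.mul_const _), h1]
    exact integral_congr_ae (Eventually.of_forall fun t => by simp only; ring)
  rw [Real.dist_eq, e, ← Real.norm_eq_abs]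
  have h2 : ‖∫ t in Ioo 0 T, κ t * (U t - U c)‖ ≤ ∫ t in Ioo 0 T, κ t * (ε / 2) := by
    refine norm_integral_le_of_norm_le (hκi.mul_const _) (Eventually.of_forall fun t => ?_)
    by_cases ht : m * (t - c) < 0 ∨ 1 < m * (t - c)
    · simp [κ, smoothTransition_deriv_eq_zero ht]
    · push Not at ht
      rw [norm_mul, Real.norm_of_nonneg (hκ0 t)]
      refine mul_le_mul_of_nonneg_left ?_ (hκ0 t)
      have htc : dist t c < δ := by
        have h3 : 0 ≤ t - c := by
          by_contra! h'
          nlinarith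
        rw [Real.dist_eq, abs_of_nonneg h3]
        refine lt_of_le_of_lt ?_ hmδ
        rw [le_div_iff₀ hm]
        linarith
      exact ((hball htc).1).le
  rw [integral_mul_const, hκ1, one_mul] at h2
  linarith

/-- Test with smooth approximations of the indicator of `(a, b]`. Their derivatives are approximate
identities at `a` and, with a minus sign, at `b`; continuity of `U` makes the point values
meaningful. -/
theorem eq_integral_of_weak_deriv {T : ℝ} {U A : ℝ → ℝ} (hU : ContinuousOn U (Ioo 0 T))
    (hA : LocallyIntegrableOn A (Ioo 0 T))
    (h : ∀ θ, IsTestFunction (Ioo 0 T) θ →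
      ∫ t in Ioo 0 T, deriv θ t * U t = -∫ t in Ioo 0 T, θ t * A t) {a b : ℝ} (ha : 0 < a)
    (hab : a ≤ b) (hb : b < T) : U b - U a = ∫ t in a..b, A t := by
  set φ := Real.smoothTransition
  let θ : ℕ → ℝ → ℝ := fun n t => φ (((n : ℝ) + 1) * (t - a)) - φ (((n : ℝ) + 1) * (t - b))
  -- The descending ramp of `θ n` lies to the right of `b` and has width `1 / (n + 1)`; from `N` on
  -- it ends before `T`.
  obtain ⟨N, hN⟩ := exists_nat_one_div_lt (sub_pos.2 hb)
  set b' := b + 1 / ((N : ℝ) + 1)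
  have hb' : b' < T := by simp only [b']; linarith
  have hsub : Icc a b' ⊆ Ioo 0 T := fun t ht => ⟨ha.trans_le ht.1, ht.2.trans_lt hb'⟩
  have hNn : ∀ n, N ≤ n → 1 / ((n : ℝ) + 1) ≤ 1 / ((N : ℝ) + 1) := fun n hn => by gcongr
  have hθ0 : ∀ n, N ≤ n → ∀ t, t ∉ Icc a b' → θ n t = 0 := by
    intro n hn t ht
    have hm : (0 : ℝ) < (n : ℝ) + 1 := by positivity
    by_cases h1 : t < a
    · simp only [θ]
      rw [show φ _ = 0 from Real.smoothTransition.zero_of_nonpos (by nlinarith),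
        show φ _ = 0 from Real.smoothTransition.zero_of_nonpos (by nlinarith), sub_zero]
    · have h2 : b' < t := by
        by_contra! h2
        exact ht ⟨not_lt.1 h1, h2⟩
      have h3 : 1 / ((n : ℝ) + 1) < t - b := by
        have := hNn n hn
        simp only [b'] at h2
        linarith
      rw [div_lt_iff₀ hm] at h3
      simp only [θ]
      rw [show φ _ = 1 from Real.smoothTransition.one_of_one_le (by nlinarith),
        show φ _ = 1 from Real.smoothTransition.one_of_one_le (by nlinarith), sub_self]
  have hθs : ∀ n, ContDiff ℝ ∞ (θ n) := fun n =>
    (Real.smoothTransition.contDiff.comp (by fun_prop)).sub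
      (Real.smoothTransition.contDiff.comp (by fun_prop))
  have hθ : ∀ n, N ≤ n → IsTestFunction (Ioo 0 T) (θ n) := fun n hn => by
    have hts : tsupport (θ n) ⊆ Icc a b' := closure_minimal (fun t ht => by
      by_contra h'
      exact ht (hθ0 n hn t h')) isClosed_Icc
    exact ⟨hθs n, isCompact_Icc.of_isClosed_subset (isClosed_tsupport _) hts, hts.trans hsub⟩
  have hθd : ∀ n t, deriv (θ n) t =
      ((n : ℝ) + 1) * deriv φ (((n : ℝ) + 1) * (t - a)) -
        ((n : ℝ) + 1) * deriv φ (((n : ℝ) + 1) * (t - b)) := fun n t =>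
    ((hasDerivAt_smoothTransition_scaled _ a t).sub
      (hasDerivAt_smoothTransition_scaled _ b t)).deriv
  have hL : Tendsto (fun n => ∫ t in Ioo 0 T, deriv (θ n) t * U t) atTop (𝓝 (U a - U b)) := by
    refine ((tendsto_integral_smoothTransition_mul hU ⟨ha, hab.trans_lt hb⟩).sub
      (tendsto_integral_smoothTransition_mul hU ⟨ha.trans_le hab, hb⟩)).congr' ?_
    filter_upwards [eventually_ge_atTop N] with n hn
    have hn' := hNn n hn
    rw [← integral_sub (integrableOn_smoothTransition_mul hU ha (by positivity) ?_)
      (integrableOn_smoothTransition_mul hU (ha.trans_le hab) (by positivity) ?_)]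
    · refine integral_congr_ae (Eventually.of_forall fun t => ?_)
      simp only [hθd, φ]
      ring
    · simp only [b'] at hb'
      linarith
    · simp only [b'] at hb'
      linarith
  have hAi : IntegrableOn A (Icc a b') := hA.integrableOn_compact_subset hsub isCompact_Icc
  have hR : Tendsto (fun n => ∫ t in Ioo 0 T, θ n t * A t) atTop
      (𝓝 (∫ t in Ioo 0 T, (Ioc a b).indicator A t)) := by
    refine tendsto_integral_filter_of_dominated_convergence
      (fun t => (Icc a b').indicator (fun t => ‖A t‖) t) ?_ ?_ ?_ ?_
    · refine Eventually.of_forall fun n => ?_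
      exact (hθs n).continuous.aestronglyMeasurable.mul
        (hA.aestronglyMeasurable)
    · filter_upwards [eventually_ge_atTop N] with n hn
      refine Eventually.of_forall fun t => ?_
      by_cases ht : t ∈ Icc a b'
      · rw [indicator_of_mem ht, norm_mul]
        refine mul_le_of_le_one_left (norm_nonneg _) ?_
        rw [Real.norm_eq_abs, abs_le]
        have h1 := Real.smoothTransition.nonneg (((n : ℝ) + 1) * (t - a))
        have h2 := Real.smoothTransition.le_one (((n : ℝ) + 1) * (t - a))
        have h3 := Real.smoothTransition.nonneg (((n : ℝ) + 1) * (t - b))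
        have h4 := Real.smoothTransition.le_one (((n : ℝ) + 1) * (t - b))
        simp only [θ, φ]
        constructor <;> linarith
      · rw [hθ0 n hn t ht, indicator_of_notMem ht]; simp
    · exact ((integrable_indicator_iff measurableSet_Icc).2 hAi.norm).integrableOn
    · refine Eventually.of_forall fun t => ?_
      by_cases h1 : t ≤ a
      · have : t ∉ Ioc a b := fun h' => absurd h'.1 (not_lt.2 h1)
        rw [indicator_of_notMem this]
        refine tendsto_const_nhds.congr fun n => ?_
        have hm : (0 : ℝ) < (n : ℝ) + 1 := by positivity
        simp only [θ]
        rw [show φ _ = 0 from Real.smoothTransition.zero_of_nonpos (by nlinarith),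
          show φ _ = 0 from Real.smoothTransition.zero_of_nonpos (by nlinarith)]
        ring
      · have h1' : 0 < t - a := sub_pos.2 (not_le.1 h1)
        have hev := (tendsto_natCast_succ_mul_atTop h1').eventually (eventually_ge_atTop 1)
        by_cases h2 : t ≤ b
        · rw [indicator_of_mem (show t ∈ Ioc a b from ⟨not_le.1 h1, h2⟩)]
          refine tendsto_const_nhds.congr' ?_
          filter_upwards [hev] with n hn
          have hm : (0 : ℝ) < (n : ℝ) + 1 := by positivity
          simp only [θ]
          rw [show φ _ = 1 from Real.smoothTransition.one_of_one_le hn,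
            show φ _ = 0 from Real.smoothTransition.zero_of_nonpos (by nlinarith)]
          ring
        · have : t ∉ Ioc a b := fun h' => h2 h'.2
          rw [indicator_of_notMem this]
          refine tendsto_const_nhds.congr' ?_
          filter_upwards [hev, (tendsto_natCast_succ_mul_atTop
            (sub_pos.2 (not_le.1 h2))).eventually (eventually_ge_atTop 1)] with n hn hn2
          simp only [θ]
          rw [show φ _ = 1 from Real.smoothTransition.one_of_one_le hn,
            show φ _ = 1 from Real.smoothTransition.one_of_one_le hn2]
          ring
  have hfin := tendsto_nhds_unique (hL.congr' (by
    filter_upwards [eventually_ge_atTop N] with n hn using h _ (hθ n hn))) hR.neg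
  rw [setIntegral_indicator measurableSet_Ioc,
    inter_eq_self_of_subset_right (show Ioc a b ⊆ Ioo 0 T from
      fun t ht => ⟨ha.trans ht.1, ht.2.trans_lt hb⟩),
    ← intervalIntegral.integral_of_le hab] at hfin
  linarith

end OneDim

/-! ### Slicing the space-time weak formulation -/

section Slicing

variable {d : ℕ} {l r : Fin d → ℝ} {T : ℝ}

theorem exists_Icc_of_isCompact (hT : 0 < T) {K : Set ℝ} (hK : IsCompact K) (hKT : K ⊆ Ioo 0 T) :
    ∃ t₁ t₂ : ℝ, 0 < t₁ ∧ t₂ < T ∧ K ⊆ Icc t₁ t₂ := by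
  rcases K.eq_empty_or_nonempty with rfl | hne
  · exact ⟨T / 2, T / 2, by linarith, by linarith, empty_subset _⟩
  · exact ⟨sInf K, sSup K, (hKT (hK.sInf_mem hne)).1, (hKT (hK.sSup_mem hne)).2,
      fun x hx => ⟨csInf_le hK.bddBelow hx, le_csSup hK.bddAbove hx⟩⟩

theorem isTestFunction_mul {θ : ℝ → ℝ} (hθ : IsTestFunction (Ioo 0 T) θ)
    {ψ : EuclideanSpace ℝ (Fin d) → ℝ} (hψ : IsTestFunction (box l r) ψ) :
    IsTestFunction (cylinder l r T) fun p => θ p.1 * ψ p.2 := by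
  have hts : tsupport (fun p : ℝ × EuclideanSpace ℝ (Fin d) => θ p.1 * ψ p.2) ⊆
      tsupport θ ×ˢ tsupport ψ := by
    refine closure_minimal (fun p hp => ?_) ((isClosed_tsupport _).prod (isClosed_tsupport _))
    have : θ p.1 * ψ p.2 ≠ 0 := hp
    exact ⟨subset_tsupport _ (left_ne_zero_of_mul this), subset_tsupport _ (right_ne_zero_of_mul this)⟩
  refine ⟨(hθ.smooth.comp contDiff_fst).mul (hψ.smooth.comp contDiff_snd), ?_,
    hts.trans (prod_mono hθ.support_subset hψ.support_subset)⟩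
  exact (hθ.compact_support.prod hψ.compact_support).of_isClosed_subset (isClosed_tsupport _) hts

variable {f : ℝ → EuclideanSpace ℝ (Fin d) → ℝ}

theorem LocTimeIntegrable.integrable_mul (hf : LocTimeIntegrable l r T f)
    {ψ : EuclideanSpace ℝ (Fin d) → ℝ} (hψ : Continuous ψ) {t₁ t₂ : ℝ} (h₁ : 0 < t₁) (h₂ : t₂ < T) :
    Integrable (fun p : ℝ × EuclideanSpace ℝ (Fin d) => f p.1 p.2 * ψ p.2)
      ((volume.restrict (Icc t₁ t₂)).prod (boxMeasure l r)) := by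
  have h := hf t₁ t₂ h₁ h₂
  rw [IntegrableOn, Measure.volume_eq_prod, ← Measure.prod_restrict] at h
  obtain ⟨M, hM0, hM⟩ := exists_bound_box (l := l) (r := r) hψ
  refine h.mul_bdd (c := M) (hψ.comp continuous_snd).aestronglyMeasurable ?_
  exact Measure.quasiMeasurePreserving_snd.ae hM

theorem LocTimeIntegrable.locallyIntegrableOn_integral (hT : 0 < T)
    (hf : LocTimeIntegrable l r T f) {ψ : EuclideanSpace ℝ (Fin d) → ℝ} (hψ : Continuous ψ) :
    LocallyIntegrableOn (fun t => ∫ x in box l r, f t x * ψ x) (Ioo 0 T) := by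
  rw [locallyIntegrableOn_iff isOpen_Ioo.isLocallyClosed]
  intro K hKs hK
  obtain ⟨t₁, t₂, h₁, h₂, hKI⟩ := exists_Icc_of_isCompact hT hK hKs
  exact IntegrableOn.mono_set (hf.integrable_mul hψ h₁ h₂).integral_prod_left hKI

theorem LocTimeIntegrable.integral_cylinder_mul (hT : 0 < T) (hf : LocTimeIntegrable l r T f)
    {θ : ℝ → ℝ} (hθ : Continuous θ) (hθc : HasCompactSupport θ) (hθs : tsupport θ ⊆ Ioo 0 T)
    {ψ : EuclideanSpace ℝ (Fin d) → ℝ} (hψ : Continuous ψ) :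
    ∫ p in cylinder l r T, f p.1 p.2 * (θ p.1 * ψ p.2) =
      ∫ t in Ioo 0 T, θ t * ∫ x in box l r, f t x * ψ x := by
  obtain ⟨t₁, t₂, h₁, h₂, hKI⟩ := exists_Icc_of_isCompact hT hθc hθs
  have h3 : IntegrableOn (fun p : ℝ × EuclideanSpace ℝ (Fin d) => f p.1 p.2 * (θ p.1 * ψ p.2))
      (Icc t₁ t₂ ×ˢ box l r) := by
    obtain ⟨Mθ, hMθ⟩ := hθc.exists_bound_of_continuous hθ
    have h := hf.integrable_mul hψ h₁ h₂
    rw [IntegrableOn, Measure.volume_eq_prod, ← Measure.prod_restrict]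
    refine (h.mul_bdd (c := Mθ) (hθ.comp continuous_fst).aestronglyMeasurable
      (Eventually.of_forall fun p => hMθ p.1)).congr (Eventually.of_forall fun p => ?_)
    simp only [Function.comp_apply]
    ring
  have h4 : IntegrableOn (fun p : ℝ × EuclideanSpace ℝ (Fin d) => f p.1 p.2 * (θ p.1 * ψ p.2))
      (Ioo 0 T ×ˢ box l r) := by
    refine h3.of_forall_sdiff_eq_zero (measurableSet_Ioo.prod measurableSet_box) fun p hp => ?_
    have : p.1 ∉ tsupport θ := fun h => hp.2 ⟨hKI h, hp.1.2⟩
    rw [image_eq_zero_of_notMem_tsupport this]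
    ring
  rw [cylinder, Measure.volume_eq_prod, setIntegral_prod _ (by rwa [← Measure.volume_eq_prod])]
  refine integral_congr_ae (Eventually.of_forall fun t => ?_)
  simp only
  rw [← integral_const_mul]
  refine integral_congr_ae (Eventually.of_forall fun x => ?_)
  simp only
  ring

theorem LocTimeIntegrable.ae_integrable {F : Type*} [NormedAddCommGroup F]
    {f : ℝ → EuclideanSpace ℝ (Fin d) → F} (hf : LocTimeIntegrable l r T f) :
    ∀ᵐ t ∂(volume.restrict (Ioo 0 T)), Integrable (f t) (boxMeasure l r) := by
  have h : ∀ n : ℕ, ∀ᵐ t, t ∈ Icc (1 / ((n : ℝ) + 1)) (T - 1 / ((n : ℝ) + 1)) →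
      Integrable (f t) (boxMeasure l r) := fun n => by
    have h := hf (1 / ((n : ℝ) + 1)) (T - 1 / ((n : ℝ) + 1)) (by positivity)
      (sub_lt_self _ (by positivity))
    rw [IntegrableOn, Measure.volume_eq_prod, ← Measure.prod_restrict] at h
    exact (ae_restrict_iff' measurableSet_Icc).1 h.prod_right_ae
  rw [ae_restrict_iff' measurableSet_Ioo]
  filter_upwards [ae_all_iff.2 h] with t ht htT
  obtain ⟨n, hn⟩ := exists_nat_one_div_lt (lt_min htT.1 (sub_pos.2 htT.2))
  rw [lt_min_iff] at hn
  exact ht n ⟨hn.1.le, by linarith [hn.2]⟩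

/-- Testing with products `θ(t) ψ(x)` shows that the difference of the two spatial integrals
annihilates every `θ`, hence vanishes almost everywhere in time. The exceptional null set depends on
`ψ`. -/
theorem HasWeakLaplacian.ae_slice_single (hT : 0 < T) {w g : ℝ → EuclideanSpace ℝ (Fin d) → ℝ}
    (hwi : LocTimeIntegrable l r T w) (hgi : LocTimeIntegrable l r T g)
    (h : HasWeakLaplacian l r T w g) {ψ : EuclideanSpace ℝ (Fin d) → ℝ}
    (hψ : IsTestFunction (box l r) ψ) :
    ∀ᵐ t ∂(volume.restrict (Ioo 0 T)),
      ∫ x in box l r, w t x * Laplacian.laplacian ψ x = ∫ x in box l r, g t x * ψ x := by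
  have hΔ := continuous_laplacian hψ.contDiff_two
  have h1 := hwi.locallyIntegrableOn_integral hT hΔ
  have h2 := hgi.locallyIntegrableOn_integral hT hψ.smooth.continuous
  have h3 := isOpen_Ioo.ae_eq_zero_of_integral_contDiff_smul_eq_zero (h1.sub h2) ?_
  · rw [ae_restrict_iff' measurableSet_Ioo]
    filter_upwards [h3] with t ht htT
    exact sub_eq_zero.1 (ht htT)
  · intro θ hθs hθc hθT
    have hθ : IsTestFunction (Ioo 0 T) θ := ⟨hθs, hθc, hθT⟩
    have h4 := h _ (isTestFunction_mul hθ hψ)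
    have h5 : ∀ p : ℝ × EuclideanSpace ℝ (Fin d),
        Laplacian.laplacian (fun y => θ p.1 * ψ y) p.2 = θ p.1 * Laplacian.laplacian ψ p.2 :=
      fun p => InnerProductSpace.laplacian_smul (θ p.1) hψ.contDiff_two.contDiffAt
    simp only [h5] at h4
    rw [hwi.integral_cylinder_mul hT hθs.continuous hθc hθT hΔ,
      hgi.integral_cylinder_mul hT hθs.continuous hθc hθT hψ.smooth.continuous] at h4
    have hsupp : ∀ A : ℝ → ℝ, ∫ t, θ t * A t = ∫ t in Ioo 0 T, θ t * A t := fun A =>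
      (setIntegral_eq_integral_of_forall_compl_eq_zero fun t ht => by
        rw [hθ.eq_zero ht, zero_mul]).symm
    have hint : ∀ A : ℝ → ℝ, LocallyIntegrableOn A (Ioo 0 T) → IntegrableOn (fun t => θ t * A t)
        (Ioo 0 T) := fun A hA => by
      obtain ⟨Mθ, hMθ⟩ := hθc.exists_bound_of_continuous hθs.continuous
      have h6 : IntegrableOn (fun t => θ t * A t) (tsupport θ) :=
        (hA.integrableOn_compact_subset hθT hθc).bdd_mul hθs.continuous.aestronglyMeasurable
          (Eventually.of_forall hMθ)
      refine h6.of_forall_sdiff_eq_zero measurableSet_Ioo fun t ht => ?_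
      rw [image_eq_zero_of_notMem_tsupport ht.2, zero_mul]
    simp only [smul_eq_mul]
    rw [hsupp]
    simp only [Pi.sub_apply, mul_sub]
    rw [integral_sub (hint _ h1) (hint _ h2), h4, sub_self]

/-- One null set serves all test functions: both sides are continuous in the pair `(ψ, Δψ)` for the
uniform norm on the compact closure, and the space of such pairs is separable, so countably many `ψ`
are enough. -/
theorem HasWeakLaplacian.ae_slice (hT : 0 < T) {w g : ℝ → EuclideanSpace ℝ (Fin d) → ℝ}
    (hwi : LocTimeIntegrable l r T w) (hgi : LocTimeIntegrable l r T g)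
    (h : HasWeakLaplacian l r T w g) :
    ∀ᵐ t ∂(volume.restrict (Ioo 0 T)), ∀ ψ, IsTestFunction (box l r) ψ →
      ∫ x in box l r, w t x * Laplacian.laplacian ψ x = ∫ x in box l r, g t x * ψ x := by
  set K := closure (box l r)
  have : CompactSpace K := isCompact_iff_compactSpace.1 isCompact_closure_box
  let J : {ψ // IsTestFunction (box l r) ψ} → C(K, ℝ × ℝ) := fun ψ =>
    ⟨fun x => (ψ.1 x, Laplacian.laplacian ψ.1 x),
      (ψ.2.smooth.continuous.comp continuous_subtype_val).prodMk
        ((continuous_laplacian ψ.2.contDiff_two).comp continuous_subtype_val)⟩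
  -- The countable dense set is taken inside the range of `J`, so that each of its elements comes
  -- from an actual test function.
  obtain ⟨D, hDs, hDc, hD⟩ := (TopologicalSpace.IsSeparable.of_separableSpace
    (range J)).exists_countable_dense_subset
  have hall : ∀ᵐ t ∂(volume.restrict (Ioo 0 T)), ∀ F ∈ D, ∃ ψ : {ψ // IsTestFunction (box l r) ψ},
      J ψ = F ∧ ∫ x in box l r, w t x * Laplacian.laplacian ψ.1 x =
        ∫ x in box l r, g t x * ψ.1 x := by
    rw [ae_ball_iff hDc]
    intro F hF
    obtain ⟨ψ, hψ⟩ := hDs hF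
    filter_upwards [h.ae_slice_single hT hwi hgi ψ.2] with t ht using ⟨ψ, hψ, ht⟩
  filter_upwards [hall, hwi.ae_integrable, hgi.ae_integrable] with t ht hwt hgt ψ hψ
  obtain ⟨F, hF, hFlim⟩ := mem_closure_iff_seq_limit.1 (hD (mem_range_self ⟨ψ, hψ⟩))
  choose Ψ hΨ using fun n => ht (F n) (hF n)
  obtain ⟨M, hM⟩ := hFlim.norm.bddAbove_range
  have hb : ∀ n, ∀ x ∈ box l r, ‖(Ψ n).1 x‖ ≤ M ∧ ‖Laplacian.laplacian (Ψ n).1 x‖ ≤ M := by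
    intro n x hx
    have h1 : ‖F n ⟨x, subset_closure hx⟩‖ ≤ M :=
      ((F n).norm_coe_le_norm _).trans (hM (mem_range_self n))
    rw [← (hΨ n).1, Prod.norm_def] at h1
    exact ⟨(le_max_left _ _).trans h1, (le_max_right _ _).trans h1⟩
  have hlim : ∀ x ∈ box l r, Tendsto (fun n => (Ψ n).1 x) atTop (𝓝 (ψ x)) ∧
      Tendsto (fun n => Laplacian.laplacian (Ψ n).1 x) atTop (𝓝 (Laplacian.laplacian ψ x)) := by
    intro x hx
    have h1 := ((continuous_eval_const (⟨x, subset_closure hx⟩ : K)).tendsto _).comp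
      hFlim
    have h2 : ∀ n, F n ⟨x, subset_closure hx⟩ = ((Ψ n).1 x, Laplacian.laplacian (Ψ n).1 x) :=
      fun n => by rw [← (hΨ n).1]; rfl
    simp only [Function.comp_def, h2] at h1
    exact ⟨(continuous_fst.tendsto _).comp h1, (continuous_snd.tendsto _).comp h1⟩
  have hDCT : ∀ (a : EuclideanSpace ℝ (Fin d) → ℝ) (q : ℕ → EuclideanSpace ℝ (Fin d) → ℝ)
      (q' : EuclideanSpace ℝ (Fin d) → ℝ), Integrable a (boxMeasure l r) →
      (∀ n, Continuous (q n)) → (∀ n, ∀ x ∈ box l r, ‖q n x‖ ≤ M) →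
      (∀ x ∈ box l r, Tendsto (fun n => q n x) atTop (𝓝 (q' x))) →
      Tendsto (fun n => ∫ x in box l r, a x * q n x) atTop (𝓝 (∫ x in box l r, a x * q' x)) := by
    intro a q q' ha hq hqM hql
    refine tendsto_integral_of_dominated_convergence (fun x => ‖a x‖ * M)
      (fun n => ha.aestronglyMeasurable.mul (hq n).aestronglyMeasurable) (ha.norm.mul_const _)
      (fun n => ae_restrict_of_forall_mem measurableSet_box fun x hx => ?_)
      (ae_restrict_of_forall_mem measurableSet_box fun x hx => (hql x hx).const_mul _)
    rw [norm_mul]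
    exact mul_le_mul_of_nonneg_left (hqM n x hx) (norm_nonneg _)
  refine tendsto_nhds_unique (hDCT _ _ _ hwt
    (fun n => continuous_laplacian (Ψ n).2.contDiff_two) (fun n x hx => (hb n x hx).2)
    fun x hx => (hlim x hx).2) ?_
  exact (hDCT _ _ _ hgt (fun n => (Ψ n).2.smooth.continuous) (fun n x hx => (hb n x hx).1)
    fun x hx => (hlim x hx).1).congr fun n => (hΨ n).2.symm

end Slicing

/-! ### Strong solutions: evolution in time and the sliced contraction inequality -/

section StrongSolution

variable {d : ℕ} {l r : Fin d → ℝ} {T : ℝ} {u₀ : EuclideanSpace ℝ (Fin d) → ℝ}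
  {u : ℝ → EuclideanSpace ℝ (Fin d) → ℝ}

theorem IsStrongSolution.integrable (hu : IsStrongSolution l r T u₀ u) {t : ℝ} (ht : t ∈ Icc 0 T) :
    Integrable (u t) (boxMeasure l r) := memLp_one_iff_integrable.1 (hu.memLp t ht)

theorem IsStrongSolution.tendsto_lintegral (hu : IsStrongSolution l r T u₀ u) {t : ℝ}
    (ht : t ∈ Icc 0 T) :
    Tendsto (fun s => ∫⁻ x, ‖u s x - u t x‖ₑ ∂(boxMeasure l r)) (𝓝[Icc 0 T] t) (𝓝 0) := by
  simpa only [eLpNorm_one_eq_lintegral_enorm] using hu.continuous t ht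

theorem IsStrongSolution.continuousOn_integral_mul (hu : IsStrongSolution l r T u₀ u)
    {ψ : EuclideanSpace ℝ (Fin d) → ℝ} (hψ : Continuous ψ) :
    ContinuousOn (fun t => ∫ x in box l r, u t x * ψ x) (Icc 0 T) := by
  intro t ht
  obtain ⟨M, hM0, hM⟩ := exists_bound_box (l := l) (r := r) hψ
  exact tendsto_integral_mul_of_tendsto_L1 (μ := boxMeasure l r) hψ.aestronglyMeasurable hM
    (eventually_mem_nhdsWithin.mono fun s hs => hu.integrable hs) (hu.integrable ht)
    (hu.tendsto_lintegral ht)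

theorem IsStrongSolution.continuousOn_integral_norm (hu : IsStrongSolution l r T u₀ u) :
    ContinuousOn (fun t => ∫ x, ‖u t x‖ ∂(boxMeasure l r)) (Icc 0 T) := by
  intro t ht
  refine tendsto_integral_of_L1 _ (hu.integrable ht).norm.aestronglyMeasurable
    (eventually_mem_nhdsWithin.mono fun s hs => (hu.integrable hs).norm) ?_
  refine tendsto_of_tendsto_of_tendsto_of_le_of_le tendsto_const_nhds (hu.tendsto_lintegral ht)
    (fun _ => zero_le) fun s => lintegral_mono fun x => ?_
  exact enorm_le_iff_norm_le.2 (abs_norm_sub_norm_le _ _)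

theorem IsStrongSolution.locTimeIntegrable (hu : IsStrongSolution l r T u₀ u) :
    LocTimeIntegrable l r T u := by
  intro t₁ t₂ h₁ h₂
  have h : IntegrableOn (fun p : ℝ × EuclideanSpace ℝ (Fin d) => u p.1 p.2) (Ioo 0 T ×ˢ box l r) := by
    have hm := hu.measurable
    rw [cylinder, Measure.volume_eq_prod, ← Measure.prod_restrict] at hm
    rw [IntegrableOn, Measure.volume_eq_prod, ← Measure.prod_restrict]
    refine (integrable_prod_iff hm).2 ⟨?_, ?_⟩
    · exact ae_restrict_of_forall_mem measurableSet_Ioo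
        fun t ht => hu.integrable (Ioo_subset_Icc_self ht)
    · exact (hu.continuousOn_integral_norm.integrableOn_compact isCompact_Icc).mono_set
        Ioo_subset_Icc_self
  exact h.mono_set (prod_mono (fun t ht => ⟨h₁.trans_le ht.1, ht.2.trans_lt h₂⟩) subset_rfl)

theorem LocTimeIntegrable.integrable_prod {f : ℝ → EuclideanSpace ℝ (Fin d) → ℝ}
    (hf : LocTimeIntegrable l r T f) {a b : ℝ} (ha : 0 < a) (hb : b < T) :
    Integrable (fun p : ℝ × EuclideanSpace ℝ (Fin d) => f p.1 p.2)
      ((volume.restrict (Ioc a b)).prod (boxMeasure l r)) := by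
  have h := (hf a b ha hb).mono_set (prod_mono Ioc_subset_Icc_self subset_rfl)
  rwa [IntegrableOn, Measure.volume_eq_prod, ← Measure.prod_restrict] at h

/-- Paired with a fixed `ψ`, the solution is a continuous function of time with weak derivative `∫
ut ψ`, so the scalar identity holds for these exact `a` and `b`. Varying `ψ` then identifies the
functions of `x`. -/
theorem IsStrongSolution.sub_eq_integral (hu : IsStrongSolution l r T u₀ u)
    {ut : ℝ → EuclideanSpace ℝ (Fin d) → ℝ} (hut : LocTimeIntegrable l r T ut)
    (h : HasWeakTimeDeriv l r T u ut) {a b : ℝ} (ha : 0 < a) (hab : a ≤ b) (hb : b < T) :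
    ∀ᵐ x ∂(boxMeasure l r), u b x - u a x = ∫ s in a..b, ut s x := by
  have hT : 0 < T := ha.trans_le (hab.trans hb.le)
  have hIa : Integrable (u a) (boxMeasure l r) := hu.integrable ⟨ha.le, hab.trans hb.le⟩
  have hIb : Integrable (u b) (boxMeasure l r) := hu.integrable ⟨ha.le.trans hab, hb.le⟩
  have hprod := hut.integrable_prod ha hb
  have hIi : Integrable (fun x => ∫ s in a..b, ut s x) (boxMeasure l r) := by
    simp only [intervalIntegral.integral_of_le hab]
    exact hprod.integral_prod_right
  have hdi : Integrable (fun x => u b x - u a x - ∫ s in a..b, ut s x) (boxMeasure l r) :=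
    (hIb.sub hIa).sub hIi
  have hz := isOpen_box.ae_eq_zero_of_integral_contDiff_smul_eq_zero (U := box l r)
    (IntegrableOn.locallyIntegrableOn hdi) ?_
  · rw [boxMeasure, ae_restrict_iff' measurableSet_box]
    filter_upwards [hz] with x hx hxb using sub_eq_zero.1 (hx hxb)
  · intro ψ hψs hψc hψT
    have hψ : IsTestFunction (box l r) ψ := ⟨hψs, hψc, hψT⟩
    have hψct := hψs.continuous
    have hweak := eq_integral_of_weak_deriv (T := T)
      ((hu.continuousOn_integral_mul hψct).mono Ioo_subset_Icc_self)
      (hut.locallyIntegrableOn_integral hT hψct) (fun θ hθ => ?_) ha hab hb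
    · obtain ⟨M, hM0, hM⟩ := exists_bound_box (l := l) (r := r) hψct
      have hmul : ∀ {f : EuclideanSpace ℝ (Fin d) → ℝ}, Integrable f (boxMeasure l r) →
          Integrable (fun x => f x * ψ x) (boxMeasure l r) := fun hf =>
        hf.mul_bdd hψct.aestronglyMeasurable hM
      have hswap : ∫ s in a..b, ∫ x in box l r, ut s x * ψ x =
          ∫ x in box l r, (∫ s in a..b, ut s x) * ψ x := by
        simp only [intervalIntegral.integral_of_le hab]
        rw [integral_integral_swap (f := fun s x => ut s x * ψ x)]
        · simp only [integral_mul_const]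
        · refine hprod.mul_bdd (c := M) (hψct.comp continuous_snd).aestronglyMeasurable ?_
          exact Measure.quasiMeasurePreserving_snd.ae hM
      rw [← setIntegral_eq_integral_of_forall_compl_eq_zero (s := box l r) fun x hx => by
        rw [hψ.eq_zero hx, zero_smul]]
      calc ∫ x in box l r, ψ x • (u b x - u a x - ∫ s in a..b, ut s x)
          = ∫ x in box l r, ((u b x * ψ x - u a x * ψ x) - (∫ s in a..b, ut s x) * ψ x) :=
            integral_congr_ae (Eventually.of_forall fun x => by simp only [smul_eq_mul]; ring)
        _ = 0 := by
            have hi : Integrable (fun x => u b x * ψ x - u a x * ψ x) (boxMeasure l r) :=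
              (hmul hIb).sub (hmul hIa)
            have e1 := integral_sub hi (hmul hIi)
            have e2 := integral_sub (hmul hIb) (hmul hIa)
            simp only [boxMeasure] at e1 e2
            rw [e1, e2, hweak, hswap, sub_self]
    · have h4 := h _ (isTestFunction_mul hθ hψ)
      have hθd : Differentiable ℝ θ := hθ.smooth.differentiable (by norm_num)
      have h5 : ∀ p : ℝ × EuclideanSpace ℝ (Fin d),
          deriv (fun s => θ s * ψ p.2) p.1 = deriv θ p.1 * ψ p.2 := fun p =>
        deriv_mul_const (hθd p.1) _
      have hθ'c : Continuous (deriv θ) := hθ.smooth.continuous_deriv (by norm_num)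
      simp only [h5] at h4
      rwa [hu.locTimeIntegrable.integral_cylinder_mul hT hθ'c hθ.compact_support.deriv
        (tsupport_deriv_subset.trans hθ.support_subset) hψct,
        hut.integral_cylinder_mul hT hθ.smooth.continuous hθ.compact_support hθ.support_subset
          hψct] at h4

/-- Nonnegative comparison functions that are compactly supported in the box at each time. -/
structure IsComparison (l r : Fin d → ℝ) (T : ℝ)
    (w wt : ℝ → EuclideanSpace ℝ (Fin d) → ℝ) : Prop where
  test : ∀ t ∈ Icc 0 T, IsTestFunction (box l r) (w t)
  nonneg : ∀ t ∈ Icc 0 T, ∀ x, 0 ≤ w t x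
  sub_eq_integral : ∀ x ∈ box l r, ∀ a b, 0 < a → a ≤ b → b < T →
    w b x - w a x = ∫ s in a..b, wt s x
  integrable_deriv : LocTimeIntegrable l r T wt
  integrable_laplacian : LocTimeIntegrable l r T
    fun t x => Laplacian.laplacian (fun y => w t y ^ 2) x

/-- The only place where the nonlinearity matters: squaring is strictly increasing on nonnegative
numbers. It fails for negative arguments, which is why sign-changing competitors need a separate
treatment. -/
theorem sign_sub_eq_sign_sq_sub {a b : ℝ} (ha : 0 ≤ a) (hb : 0 ≤ b) :
    Real.sign (a - b) = Real.sign (a ^ 2 - b ^ 2) := by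
  rcases lt_trichotomy a b with h | h | h
  · rw [Real.sign_of_neg (by linarith), Real.sign_of_neg (by nlinarith)]
  · simp [h]
  · rw [Real.sign_of_pos (by linarith), Real.sign_of_pos (by nlinarith)]

theorem abs_sign_le_one (s : ℝ) : |Real.sign s| ≤ 1 := by
  rcases Real.sign_apply_eq s with h | h | h <;> rw [h] <;> norm_num

theorem measurable_real_sign : Measurable Real.sign :=
  Measurable.ite measurableSet_Iio measurable_const
    (Measurable.ite measurableSet_Ioi measurable_const measurable_const)

theorem HasZeroTraceGradient.sub_test {z : EuclideanSpace ℝ (Fin d) → ℝ}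
    {G : EuclideanSpace ℝ (Fin d) → EuclideanSpace ℝ (Fin d)} (h : HasZeroTraceGradient l r z G)
    {η : EuclideanSpace ℝ (Fin d) → ℝ} (hη : IsTestFunction (box l r) η) :
    HasZeroTraceGradient l r (fun x => z x - η x) (fun x => G x - gradient η x) := by
  obtain ⟨hz, hG, φ, hφ, hφz, hφG⟩ := h
  have hηc := hη.smooth.continuous
  have hgc : Continuous (gradient η) := (contDiff_gradient (n := 1) hη.contDiff_two).continuous
  obtain ⟨M1, -, hM1⟩ := exists_bound_box (l := l) (r := r) hηc
  obtain ⟨M2, -, hM2⟩ := exists_bound_box (l := l) (r := r) hgc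
  refine ⟨hz.sub (MemLp.of_bound hηc.aestronglyMeasurable M1 hM1),
    hG.sub (MemLp.of_bound hgc.aestronglyMeasurable M2 hM2), fun n x => φ n x - η x,
    fun n => ⟨(hφ n).smooth.sub hη.smooth, (hφ n).compact_support.sub hη.compact_support, ?_⟩, ?_, ?_⟩
  · exact (tsupport_sub _ _).trans (union_subset (hφ n).support_subset hη.support_subset)
  · simpa using hφz
  · refine hφG.congr fun n => ?_
    congr 1
    funext x
    have : gradient (fun x => φ n x - η x) x = gradient (φ n) x - gradient η x := by
      rw [gradient, fderiv_fun_sub ((hφ n).smooth.differentiable (by norm_num) x)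
        (hη.smooth.differentiable (by norm_num) x), map_sub]
      rfl
    rw [this, sub_sub_sub_cancel_right]

/-- Kato's inequality is applied to `u² - w²`, which inherits zero trace because `w²` is a test
function. The rest of the time derivative is the residual of `w`, multiplied by a sign of modulus at
most `1`. -/
theorem IsStrongSolution.ae_slice_le (hT : 0 < T) (hu : IsStrongSolution l r T u₀ u)
    {ut lap : ℝ → EuclideanSpace ℝ (Fin d) → ℝ}
    (hut : LocTimeIntegrable l r T ut) (hlap : LocTimeIntegrable l r T lap)
    (hwl : HasWeakLaplacian l r T (fun t x => u t x ^ 2) lap)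
    (heq : ∀ᵐ p ∂(volume.restrict (cylinder l r T)), ut p.1 p.2 = (1 / 2 : ℝ) * lap p.1 p.2)
    {w wt : ℝ → EuclideanSpace ℝ (Fin d) → ℝ} (hw : IsComparison l r T w wt) :
    ∀ᵐ t ∂(volume.restrict (Ioo 0 T)),
      ∫ x in box l r, Real.sign (u t x - w t x) * (ut t x - wt t x) ≤
        ∫ x in box l r, |wt t x - 1 / 2 * Laplacian.laplacian (fun y => w t y ^ 2) x| := by
  obtain ⟨G, hG, hdir⟩ := hu.dirichlet
  rw [cylinder, Measure.volume_eq_prod, ← Measure.prod_restrict] at heq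
  filter_upwards [hdir, hwl.ae_slice hT hu.sq_integrable hlap, Measure.ae_ae_of_ae_prod heq,
    hlap.ae_integrable, hut.ae_integrable, hw.integrable_deriv.ae_integrable,
    hw.integrable_laplacian.ae_integrable, ae_restrict_mem measurableSet_Ioo]
    with t h1 h2 h3 h4 h5 h6 h7 htT
  have ht : t ∈ Icc 0 T := Ioo_subset_Icc_self htT
  have hw2 : IsTestFunction (box l r) fun y => w t y ^ 2 :=
    (hw.test t ht).comp_zero (P := fun s => s ^ 2) (by fun_prop) (by simp)
  set q : EuclideanSpace ℝ (Fin d) → ℝ := Laplacian.laplacian fun y => w t y ^ 2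
  have hqz : ∀ ψ, IsTestFunction (box l r) ψ →
      ∫ x in box l r, (u t x ^ 2 - w t x ^ 2) * Laplacian.laplacian ψ x =
        ∫ x in box l r, (lap t x - q x) * ψ x := by
    intro ψ hψ
    obtain ⟨M1, -, hM1⟩ := exists_bound_box (l := l) (r := r) hψ.smooth.continuous
    have hΔc := continuous_laplacian hψ.contDiff_two
    obtain ⟨M2, -, hM2⟩ := exists_bound_box (l := l) (r := r) hΔc
    have hqc : Continuous q := continuous_laplacian hw2.contDiff_two
    have e1 : ∫ x in box l r, w t x ^ 2 * Laplacian.laplacian ψ x = ∫ x in box l r, q x * ψ x := by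
      rw [setIntegral_eq_integral_of_forall_compl_eq_zero fun x hx => by
        rw [hψ.laplacian_eq_zero hx, mul_zero], setIntegral_eq_integral_of_forall_compl_eq_zero
        fun x hx => by rw [hψ.eq_zero hx, mul_zero], integral_mul_laplacian_comm hw2.contDiff_two
        hψ.contDiff_two (Or.inl hw2.compact_support)]
      exact integral_congr_ae (Eventually.of_forall fun x => mul_comm _ _)
    have i1 : Integrable (fun x => u t x ^ 2 * Laplacian.laplacian ψ x) (boxMeasure l r) :=
      (memLp_one_iff_integrable.1 h1.1).mul_bdd hΔc.aestronglyMeasurable hM2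
    have i2 : Integrable (fun x => w t x ^ 2 * Laplacian.laplacian ψ x) (boxMeasure l r) :=
      ((hw2.smooth.continuous.mul hΔc).integrable_of_hasCompactSupport
        hw2.compact_support.mul_right).restrict
    have i3 : Integrable (fun x => lap t x * ψ x) (boxMeasure l r) :=
      h4.mul_bdd hψ.smooth.continuous.aestronglyMeasurable hM1
    have i4 : Integrable (fun x => q x * ψ x) (boxMeasure l r) :=
      h7.mul_bdd hψ.smooth.continuous.aestronglyMeasurable hM1
    simp only [sub_mul]
    have := h2 ψ hψ
    have e2 := integral_sub i1 i2
    have e3 := integral_sub i3 i4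
    simp only [boxMeasure] at e2 e3
    rw [e2, e3, this, e1]
  have hk := kato_box (h1.sub_test hw2) (h4.sub h7) hqz
  have hsm : AEStronglyMeasurable (fun x => Real.sign (u t x ^ 2 - w t x ^ 2)) (boxMeasure l r) :=
    (measurable_real_sign.comp_aemeasurable
      (h1.sub_test hw2).1.aestronglyMeasurable.aemeasurable).aestronglyMeasurable
  have hsb : ∀ᵐ x ∂(boxMeasure l r), ‖Real.sign (u t x ^ 2 - w t x ^ 2)‖ ≤ 1 :=
    Eventually.of_forall fun x => abs_sign_le_one _
  have j1 : Integrable (fun x => Real.sign (u t x ^ 2 - w t x ^ 2) * (lap t x - q x))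
      (boxMeasure l r) := (h4.sub h7).bdd_mul hsm hsb
  have j2 : Integrable (fun x => |wt t x - 1 / 2 * q x|) (boxMeasure l r) :=
    (h6.sub (h7.const_mul _)).norm
  have j3 : Integrable (fun x => Real.sign (u t x ^ 2 - w t x ^ 2) * (ut t x - wt t x))
      (boxMeasure l r) := (h5.sub h6).bdd_mul hsm hsb
  calc ∫ x in box l r, Real.sign (u t x - w t x) * (ut t x - wt t x)
      = ∫ x, Real.sign (u t x ^ 2 - w t x ^ 2) * (ut t x - wt t x) ∂(boxMeasure l r) := by
        refine integral_congr_ae ?_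
        filter_upwards [hu.nonneg t ht] with x hx
        rw [sign_sub_eq_sign_sq_sub hx (hw.nonneg t ht x)]
    _ ≤ ∫ x, (1 / 2 * (Real.sign (u t x ^ 2 - w t x ^ 2) * (lap t x - q x)) +
          |wt t x - 1 / 2 * q x|) ∂(boxMeasure l r) := by
        refine integral_mono_ae j3 ((j1.const_mul _).add j2) ?_
        filter_upwards [h3] with x hx
        set σ := Real.sign (u t x ^ 2 - w t x ^ 2)
        have e : σ * (ut t x - wt t x) =
            1 / 2 * (σ * (lap t x - q x)) - σ * (wt t x - 1 / 2 * q x) := by rw [hx]; ring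
        have hle : -(σ * (wt t x - 1 / 2 * q x)) ≤ |wt t x - 1 / 2 * q x| := by
          refine (neg_le_abs _).trans ?_
          rw [abs_mul]
          exact mul_le_of_le_one_left (abs_nonneg _) (abs_sign_le_one _)
        rw [e]
        linarith
    _ ≤ ∫ x in box l r, |wt t x - 1 / 2 * q x| := by
        rw [integral_add (j1.const_mul _) j2, integral_const_mul]
        have : 1 / 2 * ∫ x, Real.sign (u t x ^ 2 - w t x ^ 2) * (lap t x - q x) ∂(boxMeasure l r)
            ≤ 0 := mul_nonpos_of_nonneg_of_nonpos (by norm_num) hk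
        have e : ∫ x, |wt t x - 1 / 2 * q x| ∂(boxMeasure l r) =
          ∫ x in box l r, |wt t x - 1 / 2 * q x| := rfl
        linarith

end StrongSolution

/-! ### L¹ contraction against nonnegative comparison functions -/

section Contraction

variable {d : ℕ} {l r : Fin d → ℝ} {T : ℝ} {u₀ : EuclideanSpace ℝ (Fin d) → ℝ}
  {u : ℝ → EuclideanSpace ℝ (Fin d) → ℝ} {w wt : ℝ → EuclideanSpace ℝ (Fin d) → ℝ}

/-- Integrating the absolute value of an absolutely continuous family and exchanging the order of
integration. -/
theorem integral_abs_sub_integral_abs_le {α : Type*} [MeasurableSpace α] {μ : Measure α}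
    [SFinite μ] {h H : ℝ → α → ℝ} {R : ℝ → ℝ} {a b : ℝ} (hab : a ≤ b)
    (hH : Integrable (fun p : ℝ × α => H p.1 p.2) ((volume.restrict (Ioc a b)).prod μ))
    (ha : Integrable (h a) μ)
    (hh : ∀ s ∈ Icc a b, ∀ᵐ x ∂μ, h s x - h a x = ∫ τ in a..s, H τ x)
    (hR : IntervalIntegrable R volume a b)
    (hle : ∀ᵐ s ∂(volume.restrict (Ioc a b)), ∫ x, Real.sign (h s x) * H s x ∂μ ≤ R s) :
    ∫ x, |h b x| ∂μ ≤ ∫ x, |h a x| ∂μ + ∫ s in a..b, R s := by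
  set m := volume.restrict (Ioc a b)
  -- Each relation between `h s` and `H` holds only outside a null set depending on `s`, and `h` is
  -- not assumed jointly measurable. Strongly measurable representatives are used instead.
  set H' : ℝ × α → ℝ := hH.aestronglyMeasurable.mk _
  have hH'm : StronglyMeasurable H' := hH.aestronglyMeasurable.stronglyMeasurable_mk
  have hHH' : (fun p : ℝ × α => H p.1 p.2) =ᵐ[m.prod μ] H' := hH.aestronglyMeasurable.ae_eq_mk
  have hH'i : Integrable H' (m.prod μ) := hH.congr hHH'
  set c : α → ℝ := ha.aestronglyMeasurable.mk _
  have hcm : StronglyMeasurable c := ha.aestronglyMeasurable.stronglyMeasurable_mk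
  have hc : h a =ᵐ[μ] c := ha.aestronglyMeasurable.ae_eq_mk
  -- A jointly measurable version of `h`, rebuilt from its initial value and its derivative. It
  -- makes `sign k * H'` integrable on the product, so that Fubini applies, and for integrable time
  -- slices it is a genuine primitive.
  set k : ℝ × α → ℝ := fun p => c p.2 + ∫ τ, (Iic p.1).indicator (fun τ => H' (τ, p.2)) τ ∂m
  have hkm : StronglyMeasurable k := by
    refine (hcm.comp_measurable measurable_snd).add (StronglyMeasurable.integral_prod_right
      (f := fun (p : ℝ × α) (τ : ℝ) => (Iic p.1).indicator (fun τ => H' (τ, p.2)) τ) ?_)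
    have hs : MeasurableSet {q : (ℝ × α) × ℝ | q.2 ≤ q.1.1} :=
      measurableSet_le measurable_snd (measurable_fst.comp measurable_fst)
    have : StronglyMeasurable fun q : (ℝ × α) × ℝ => H' (q.2, q.1.2) :=
      hH'm.comp_measurable (measurable_snd.prodMk (measurable_snd.comp measurable_fst))
    exact this.indicator hs
  have hk : ∀ s ∈ Icc a b, ∀ x, k (s, x) = c x + ∫ τ in a..s, H' (τ, x) := by
    intro s hs x
    simp only [k, m]
    rw [setIntegral_indicator measurableSet_Iic, Ioc_inter_Iic, min_eq_right hs.2,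
      intervalIntegral.integral_of_le hs.1]
  have hswap : ∀ᵐ x ∂μ, ∀ᵐ s ∂m, H s x = H' (s, x) :=
    Measure.ae_ae_of_ae_prod (Measure.measurePreserving_swap.quasiMeasurePreserving.ae hHH')
  have hint : ∀ᵐ x ∂μ, Integrable (fun s => H' (s, x)) m := hH'i.prod_left_ae
  have hks : ∀ s ∈ Icc a b, ∀ᵐ x ∂μ, h s x = k (s, x) := by
    intro s hs
    filter_upwards [hh s hs, hc, hswap] with x h1 h2 h3
    rw [hk s hs, ← h2]
    have : ∫ τ in a..s, H τ x = ∫ τ in a..s, H' (τ, x) := by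
      rw [intervalIntegral.integral_of_le hs.1, intervalIntegral.integral_of_le hs.1]
      exact integral_congr_ae (ae_restrict_of_ae_restrict_of_subset (Ioc_subset_Ioc_right hs.2) h3)
    rw [← this, ← h1]
    ring
  set K : ℝ × α → ℝ := fun p => Real.sign (k p) * H' p
  have hK : Integrable K (m.prod μ) := hH'i.bdd_mul (c := 1)
    (measurable_real_sign.comp hkm.measurable).aestronglyMeasurable
    (Eventually.of_forall fun p => abs_sign_le_one _)
  have hx : ∀ᵐ x ∂μ, |h b x| = |h a x| + ∫ s, K (s, x) ∂m := by
    filter_upwards [hks b ⟨hab, le_rfl⟩, hc, hint] with x h1 h2 h3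
    have h4 : IntervalIntegrable (fun s => H' (s, x)) volume a b :=
      (intervalIntegrable_iff_integrableOn_Ioc_of_le hab).2 h3
    have h5 := abs_sub_abs_eq_integral_sign h4 (c x)
    rw [h1, h2, hk b ⟨hab, le_rfl⟩, eq_add_of_sub_eq' h5, intervalIntegral.integral_of_le hab]
    congr 1
    refine setIntegral_congr_fun measurableSet_Ioc fun s hs => ?_
    simp only [K]
    rw [hk s (Ioc_subset_Icc_self hs)]
  calc ∫ x, |h b x| ∂μ = ∫ x, (|h a x| + ∫ s, K (s, x) ∂m) ∂μ := integral_congr_ae hx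
    _ = ∫ x, |h a x| ∂μ + ∫ s, ∫ x, K (s, x) ∂μ ∂m := by
        rw [integral_add ha.abs hK.integral_prod_right]
        congr 1
        exact (integral_integral_swap (f := fun s x => K (s, x)) hK).symm
    _ ≤ ∫ x, |h a x| ∂μ + ∫ s in a..b, R s := by
        rw [intervalIntegral.integral_of_le hab]
        refine add_le_add le_rfl (integral_mono_ae hK.integral_prod_left
          ((intervalIntegrable_iff_integrableOn_Ioc_of_le hab).1 hR) ?_)
        filter_upwards [hle, Measure.ae_ae_of_ae_prod hHH', ae_restrict_mem measurableSet_Ioc]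
          with s h1 h2 h3
        refine le_of_eq_of_le (integral_congr_ae ?_) h1
        filter_upwards [h2, hks s (Ioc_subset_Icc_self h3)] with x h4 h5
        simp only [K]
        rw [h5, ← h4]

theorem IsStrongSolution.integral_abs_sub_le_of_Ioo (hT : 0 < T) (hu : IsStrongSolution l r T u₀ u)
    (hw : IsComparison l r T w wt) {a b : ℝ} (ha : 0 < a) (hab : a ≤ b) (hb : b < T) :
    ∫ x, |u b x - w b x| ∂(boxMeasure l r) ≤ ∫ x, |u a x - w a x| ∂(boxMeasure l r) +
      ∫ s in a..b, ∫ x, |wt s x - 1 / 2 * Laplacian.laplacian (fun y => w s y ^ 2) x|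
        ∂(boxMeasure l r) := by
  obtain ⟨ut, lap, hut, hlap, hwt, hwl, heq⟩ := hu.equation
  have hwi : ∀ t ∈ Icc 0 T, Integrable (w t) (boxMeasure l r) := fun t ht =>
    ((hw.test t ht).smooth.continuous.integrable_of_hasCompactSupport
      (hw.test t ht).compact_support).restrict
  have haT : a ∈ Icc 0 T := ⟨ha.le, hab.trans hb.le⟩
  have hR : Integrable (fun p : ℝ × EuclideanSpace ℝ (Fin d) =>
      |wt p.1 p.2 - 1 / 2 * Laplacian.laplacian (fun y => w p.1 y ^ 2) p.2|)
      ((volume.restrict (Ioc a b)).prod (boxMeasure l r)) :=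
    ((hw.integrable_deriv.integrable_prod ha hb).sub
      ((hw.integrable_laplacian.integrable_prod ha hb).const_mul _)).abs
  refine integral_abs_sub_integral_abs_le (h := fun s x => u s x - w s x)
    (H := fun s x => ut s x - wt s x) hab
    ((hut.integrable_prod ha hb).sub (hw.integrable_deriv.integrable_prod ha hb))
    ((hu.integrable haT).sub (hwi a haT)) ?_
    ((intervalIntegrable_iff_integrableOn_Ioc_of_le hab).2 hR.integral_prod_left) ?_
  · intro s hs
    have hint := ((hut.integrable_prod ha hb).prod_left_ae)
    have hint' := ((hw.integrable_deriv.integrable_prod ha hb).prod_left_ae)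
    filter_upwards [hu.sub_eq_integral hut hwt ha hs.1 (hs.2.trans_lt hb), hint, hint',
      ae_restrict_mem measurableSet_box] with x h1 h2 h3 h4
    have i1 : IntervalIntegrable (fun τ => ut τ x) volume a s :=
      (intervalIntegrable_iff_integrableOn_Ioc_of_le hs.1).2
        (IntegrableOn.mono_set h2 (Ioc_subset_Ioc_right hs.2))
    have i2 : IntervalIntegrable (fun τ => wt τ x) volume a s :=
      (intervalIntegrable_iff_integrableOn_Ioc_of_le hs.1).2
        (IntegrableOn.mono_set h3 (Ioc_subset_Ioc_right hs.2))
    rw [intervalIntegral.integral_sub i1 i2, ← h1,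
      ← hw.sub_eq_integral x h4 a s ha hs.1 (hs.2.trans_lt hb)]
    ring
  · exact ae_restrict_of_ae_restrict_of_subset
      (show Ioc a b ⊆ Ioo 0 T from fun s hs => ⟨ha.trans hs.1, hs.2.trans_lt hb⟩)
      (hu.ae_slice_le hT hut hlap hwl heq hw)

end Contraction

/-! ### Smooth truncations of the positive part -/

section PosApprox

/-- A smooth approximation of the positive part that vanishes for `s ≤ 1 / k` and equals `s` for
`s ≥ 2 / k`. -/
noncomputable def posApprox (k s : ℝ) : ℝ := s * step (k * s)

theorem contDiff_posApprox (k : ℝ) : ContDiff ℝ ∞ (posApprox k) :=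
  contDiff_id.mul (contDiff_step.comp (contDiff_const.mul contDiff_id))

theorem posApprox_eq_zero {k s : ℝ} (h : k * s ≤ 1) : posApprox k s = 0 := by
  rw [posApprox, step_eq_zero h, mul_zero]

theorem posApprox_eq_self {k s : ℝ} (h : 2 ≤ k * s) : posApprox k s = s := by
  rw [posApprox, step_eq_one h, mul_one]

theorem posApprox_nonneg {k : ℝ} (hk : 0 < k) (s : ℝ) : 0 ≤ posApprox k s := by
  rcases le_total s 0 with h | h
  · rw [posApprox_eq_zero]
    nlinarith
  · exact mul_nonneg h (step_nonneg _)

theorem abs_posApprox_le (k s : ℝ) : |posApprox k s| ≤ |s| := by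
  rw [posApprox, abs_mul, abs_of_nonneg (step_nonneg _)]
  exact mul_le_of_le_one_right (abs_nonneg _) (step_le_one _)

theorem posApprox_eq_inv_mul {k : ℝ} (hk : k ≠ 0) (s : ℝ) :
    posApprox k s = k⁻¹ * posApprox 1 (k * s) := by
  simp only [posApprox, one_mul]
  field_simp

theorem eventuallyEq_posApprox_zero {k s : ℝ} (h : k * s < 1) : posApprox k =ᶠ[𝓝 s] fun _ => 0 := by
  have : ContinuousAt (fun s => k * s) s := by fun_prop
  filter_upwards [this.eventually (gt_mem_nhds h)] with y hy using posApprox_eq_zero (le_of_lt hy)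

theorem eventuallyEq_posApprox_self {k s : ℝ} (h : 2 < k * s) : posApprox k =ᶠ[𝓝 s] id := by
  have : ContinuousAt (fun s => k * s) s := by fun_prop
  filter_upwards [this.eventually (lt_mem_nhds h)] with y hy using posApprox_eq_self (le_of_lt hy)

theorem deriv_posApprox_zero {k s : ℝ} (h : k * s < 1) : deriv (posApprox k) s = 0 := by
  rw [(eventuallyEq_posApprox_zero h).deriv_eq, deriv_const]

theorem deriv_posApprox_self {k s : ℝ} (h : 2 < k * s) : deriv (posApprox k) s = 1 := by
  rw [(eventuallyEq_posApprox_self h).deriv_eq, deriv_id]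

theorem deriv_posApprox_sq (k s : ℝ) :
    deriv (fun s => posApprox k s ^ 2) s = 2 * posApprox k s * deriv (posApprox k) s := by
  rw [deriv_fun_pow ((contDiff_posApprox k).differentiable (by norm_num) s)]
  simp

theorem deriv_deriv_posApprox_sq_zero {k s : ℝ} (h : k * s < 1) :
    deriv (deriv fun s => posApprox k s ^ 2) s = 0 := by
  have : (fun s => posApprox k s ^ 2) =ᶠ[𝓝 s] fun _ => 0 :=
    (eventuallyEq_posApprox_zero h).mono fun y hy => by simp [hy]
  rw [this.deriv.deriv_eq]
  simp

theorem deriv_deriv_posApprox_sq_self {k s : ℝ} (h : 2 < k * s) :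
    deriv (deriv fun s => posApprox k s ^ 2) s = 2 := by
  have : (fun s => posApprox k s ^ 2) =ᶠ[𝓝 s] fun s => s ^ 2 :=
    (eventuallyEq_posApprox_self h).mono fun y hy => by simp [hy]
  rw [this.deriv.deriv_eq]
  have h1 : (deriv fun s : ℝ => s ^ 2) = fun s => 2 * s := funext fun s => by simp
  rw [h1, deriv_const_mul_field, deriv_id'', mul_one]

theorem contDiff_posApprox_sq (k : ℝ) : ContDiff ℝ ∞ fun s => posApprox k s ^ 2 :=
  (contDiff_posApprox k).pow 2

theorem exists_abs_le_of_eq_const {f : ℝ → ℝ} (hf : Continuous f) {c : ℝ} (h0 : ∀ y < 1, f y = 0)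
    (h1 : ∀ y, 2 < y → f y = c) : ∃ K, 0 ≤ K ∧ ∀ y, |f y| ≤ K := by
  obtain ⟨K, hK⟩ := isCompact_Icc.exists_bound_of_continuousOn (s := Icc (1 : ℝ) 2) hf.continuousOn
  refine ⟨max K |c|, (abs_nonneg _).trans (le_max_right _ _), fun y => ?_⟩
  rcases lt_or_ge y 1 with h | h
  · rw [h0 y h, abs_zero]
    exact (abs_nonneg _).trans (le_max_right _ _)
  · rcases lt_or_ge 2 y with h' | h'
    · rw [h1 y h']
      exact le_max_right _ _
    · exact (hK y ⟨h, h'⟩).trans (le_max_left _ _)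

/-- By the scaling `posApprox k s = k⁻¹ posApprox 1 (k s)`, the first derivative, and the second
derivative of the square, depend on `k s` only. Both are constant outside `[1, 2]` and therefore
bounded uniformly in `k`. -/
theorem exists_posApprox_bound : ∃ K, 0 ≤ K ∧ ∀ k > 0, ∀ s, |deriv (posApprox k) s| ≤ K ∧
    |deriv (fun s => posApprox k s ^ 2) s| ≤ K * |s| ∧
    |deriv (deriv fun s => posApprox k s ^ 2) s| ≤ K := by
  have hc1 : Continuous (deriv (posApprox 1)) := (contDiff_posApprox 1).continuous_deriv (by norm_num)
  have hc2 : Continuous (deriv (deriv fun s => posApprox 1 s ^ 2)) := by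
    have := contDiff_infty.1 (contDiff_posApprox_sq 1) 2
    exact ((contDiff_succ_iff_deriv (n := 1)).1 this).2.2.continuous_deriv le_rfl
  obtain ⟨K1, h1, hK1⟩ := exists_abs_le_of_eq_const hc1
    (fun y hy => deriv_posApprox_zero (by rwa [one_mul]))
    (fun y hy => deriv_posApprox_self (by rwa [one_mul]))
  obtain ⟨K2, h2, hK2⟩ := exists_abs_le_of_eq_const hc2
    (fun y hy => deriv_deriv_posApprox_sq_zero (by rwa [one_mul]))
    (fun y hy => deriv_deriv_posApprox_sq_self (by rwa [one_mul]))
  refine ⟨2 * K1 + K2, by positivity, fun k hk s => ?_⟩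
  have e1 : deriv (posApprox k) s = deriv (posApprox 1) (k * s) := by
    have : posApprox k = fun s => k⁻¹ * posApprox 1 (k * s) :=
      funext (posApprox_eq_inv_mul hk.ne')
    rw [this, deriv_const_mul_field, deriv_comp_mul_left, smul_eq_mul, inv_mul_cancel_left₀ hk.ne']
  have e2 : deriv (deriv fun s => posApprox k s ^ 2) s =
      deriv (deriv fun s => posApprox 1 s ^ 2) (k * s) := by
    have : (fun s => posApprox k s ^ 2) = fun s => (k⁻¹) ^ 2 * posApprox 1 (k * s) ^ 2 :=
      funext fun s => by rw [posApprox_eq_inv_mul hk.ne', mul_pow]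
    have h3 : (deriv fun s => posApprox k s ^ 2) =
        fun s => k⁻¹ * deriv (fun s => posApprox 1 s ^ 2) (k * s) := by
      funext s
      rw [this, deriv_const_mul_field, deriv_comp_mul_left k fun s => posApprox 1 s ^ 2]
      simp only [smul_eq_mul]
      field_simp
    rw [h3, deriv_const_mul_field, deriv_comp_mul_left, smul_eq_mul, inv_mul_cancel_left₀ hk.ne']
  have b1 : |deriv (posApprox k) s| ≤ K1 := e1 ▸ hK1 _
  refine ⟨b1.trans (by linarith), ?_, e2 ▸ (hK2 _).trans (by linarith)⟩
  rw [deriv_posApprox_sq, abs_mul, abs_mul, abs_two]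
  calc 2 * |posApprox k s| * |deriv (posApprox k) s| ≤ 2 * |s| * K1 := by
        exact mul_le_mul (by linarith [abs_posApprox_le k s]) b1 (abs_nonneg _) (by positivity)
    _ ≤ (2 * K1 + K2) * |s| := by nlinarith [mul_nonneg h2 (abs_nonneg s)]

/-- The value of `∂ₜ β(z) - ½ Δ β(z)²` for `β = posApprox k`, in terms of `z`, `D = ∂ₜ z`, `L = Δ z`
and `G = |∇ z|²`. -/
noncomputable def approxResidual (k z D L G : ℝ) : ℝ :=
  deriv (posApprox k) z * D - 1 / 2 * (deriv (fun s => posApprox k s ^ 2) z * L +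
    deriv (deriv fun s => posApprox k s ^ 2) z * G)

/-- Independence of `k` provides the dominating constant for the limit. The second derivative of the
truncation alone would grow with `k`; only that of its square occurs, thanks to the quadratic
nonlinearity. -/
theorem exists_approxResidual_bound (M : ℝ) : ∃ K, ∀ k > 0, ∀ z D L G, |z| ≤ M → |D| ≤ M →
    |L| ≤ M → |G| ≤ M → |approxResidual k z D L G| ≤ K := by
  obtain ⟨K, hK0, hK⟩ := exists_posApprox_bound
  refine ⟨K * M + 1 / 2 * (K * M * M + K * M), fun k hk z D L G hz hD hL hG => ?_⟩
  obtain ⟨h1, h2, h3⟩ := hK k hk z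
  have hM : 0 ≤ M := (abs_nonneg z).trans hz
  have a1 : |deriv (posApprox k) z * D| ≤ K * M := by
    rw [abs_mul]; gcongr
  have a2 : |deriv (fun s => posApprox k s ^ 2) z * L| ≤ K * M * M := by
    rw [abs_mul]
    calc _ ≤ K * |z| * M := by gcongr
      _ ≤ K * M * M := by gcongr
  have a3 : |deriv (deriv fun s => posApprox k s ^ 2) z * G| ≤ K * M := by
    rw [abs_mul]; gcongr
  rw [approxResidual]
  rw [abs_le] at *
  constructor <;> linarith

/-- The sequence is eventually constant at each point, since `(n + 1) z` eventually exceeds `2` when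
`z > 0` and stays below `1` when `z ≤ 0`. In particular the set `z = 0` contributes nothing in the
limit. -/
theorem tendsto_approxResidual (z D L G : ℝ) :
    Tendsto (fun n : ℕ => approxResidual ((n : ℝ) + 1) z D L G) atTop
      (𝓝 (if 0 < z then D - (z * L + G) else 0)) := by
  refine tendsto_const_nhds.congr' ?_
  split_ifs with h
  · filter_upwards [(tendsto_natCast_succ_mul_atTop h).eventually_gt_atTop 2] with n hn
    rw [approxResidual, deriv_posApprox_self hn, deriv_posApprox_sq, deriv_posApprox_self hn,
      posApprox_eq_self hn.le, deriv_deriv_posApprox_sq_self hn]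
    ring
  · refine Eventually.of_forall fun n => ?_
    have hn : ((n : ℝ) + 1) * z < 1 := by
      have : (0 : ℝ) < (n : ℝ) + 1 := by positivity
      nlinarith
    beta_reduce
    rw [approxResidual, deriv_posApprox_zero hn, deriv_posApprox_sq, deriv_posApprox_zero hn,
      deriv_deriv_posApprox_sq_zero hn]
    ring

theorem tendsto_posApprox (s : ℝ) :
    Tendsto (fun n : ℕ => posApprox ((n : ℝ) + 1) s) atTop (𝓝 (max s 0)) := by
  refine tendsto_const_nhds.congr' ?_
  rcases lt_or_ge 0 s with h | h
  · filter_upwards [(tendsto_natCast_succ_mul_atTop h).eventually_gt_atTop 2] with n hn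
    rw [posApprox_eq_self hn.le, max_eq_left h.le]
  · refine Eventually.of_forall fun n => ?_
    beta_reduce
    rw [max_eq_right h, posApprox_eq_zero]
    have : (0 : ℝ) < (n : ℝ) + 1 := by positivity
    nlinarith

theorem continuous_approxResidual (k : ℝ) :
    Continuous fun q : ℝ × ℝ × ℝ × ℝ => approxResidual k q.1 q.2.1 q.2.2.1 q.2.2.2 := by
  have h := contDiff_infty.1 (contDiff_posApprox_sq k) 2
  have h1 : Continuous (deriv (posApprox k)) := (contDiff_posApprox k).continuous_deriv (by norm_num)
  have h2 : Continuous (deriv fun s => posApprox k s ^ 2) := h.continuous_deriv (by norm_num)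
  have h3 : Continuous (deriv (deriv fun s => posApprox k s ^ 2)) :=
    ((contDiff_succ_iff_deriv (n := 1)).1 h).2.2.continuous_deriv le_rfl
  unfold approxResidual
  fun_prop

end PosApprox

/-! ### Regularity and bounds for admissible competitors -/

section Admissible

variable {d : ℕ} {l r : Fin d → ℝ} {T : ℝ} {v : ℝ → EuclideanSpace ℝ (Fin d) → ℝ}

theorem isOpen_cylinder : IsOpen (cylinder l r T) := isOpen_Ioo.prod isOpen_box

theorem cylinder_subset : cylinder l r T ⊆ Icc 0 T ×ˢ closure (box l r) :=
  prod_mono Ioo_subset_Icc_self subset_closure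

theorem uniqueDiffOn_closedCylinder (hlr : ∀ i, l i < r i) (hT : 0 < T) :
    UniqueDiffOn ℝ (Icc 0 T ×ˢ closure (box l r)) := by
  refine (uniqueDiffOn_Icc hT).prod (uniqueDiffOn_convex convex_box.closure ?_)
  obtain ⟨x, hx⟩ := nonempty_box hlr
  exact ⟨x, interior_mono subset_closure (isOpen_box.interior_eq.symm ▸ hx)⟩

theorem isCompact_closedCylinder : IsCompact (Icc 0 T ×ˢ closure (box l r)) :=
  isCompact_Icc.prod isCompact_closure_box

theorem fderivWithin_closedCylinder_eq {F : Type*} [NormedAddCommGroup F] [NormedSpace ℝ F]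
    (f : ℝ × EuclideanSpace ℝ (Fin d) → F) {p : ℝ × EuclideanSpace ℝ (Fin d)}
    (hp : p ∈ cylinder l r T) :
    fderivWithin ℝ f (Icc 0 T ×ˢ closure (box l r)) p = fderiv ℝ f p :=
  fderivWithin_of_mem_nhds (mem_of_superset (isOpen_cylinder.mem_nhds hp) cylinder_subset)

theorem IsAdmissible.contDiffAt (hv : IsAdmissible l r T v) {p : ℝ × EuclideanSpace ℝ (Fin d)}
    (hp : p ∈ cylinder l r T) :
    ContDiffAt ℝ ∞ (fun p : ℝ × EuclideanSpace ℝ (Fin d) => v p.1 p.2) p :=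
  hv.smooth.contDiffAt (mem_of_superset (isOpen_cylinder.mem_nhds hp) cylinder_subset)

/-- Derivatives within the closed cylinder are continuous on a compact set, as the cylinder has
unique differentials; at points of the open cylinder they are the ordinary derivatives. -/
theorem IsAdmissible.exists_bound (hlr : ∀ i, l i < r i) (hT : 0 < T)
    (hv : IsAdmissible l r T v) : ∃ M, ∀ p ∈ cylinder l r T, |v p.1 p.2| ≤ M ∧
      ‖fderiv ℝ (fun p : ℝ × EuclideanSpace ℝ (Fin d) => v p.1 p.2) p‖ ≤ M ∧
      ‖fderiv ℝ (fderiv ℝ fun p : ℝ × EuclideanSpace ℝ (Fin d) => v p.1 p.2) p‖ ≤ M := by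
  set V : ℝ × EuclideanSpace ℝ (Fin d) → ℝ := fun p => v p.1 p.2
  set C : Set (ℝ × EuclideanSpace ℝ (Fin d)) := Icc 0 T ×ˢ closure (box l r)
  have hu : UniqueDiffOn ℝ C := uniqueDiffOn_closedCylinder hlr hT
  have h1 : ContDiffOn ℝ ∞ (fderivWithin ℝ V C) C := hv.smooth.fderivWithin hu (by norm_num)
  obtain ⟨M0, hM0⟩ := isCompact_closedCylinder.exists_bound_of_continuousOn hv.smooth.continuousOn
  obtain ⟨M1, hM1⟩ := isCompact_closedCylinder.exists_bound_of_continuousOn h1.continuousOn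
  obtain ⟨M2, hM2⟩ := isCompact_closedCylinder.exists_bound_of_continuousOn
    (h1.continuousOn_fderivWithin hu (by norm_num))
  refine ⟨max M0 (max M1 M2), fun p hp => ?_⟩
  have hpC : p ∈ C := cylinder_subset hp
  refine ⟨(hM0 p hpC).trans (le_max_left _ _), ?_, ?_⟩
  · rw [← fderivWithin_closedCylinder_eq V hp]
    exact (hM1 p hpC).trans ((le_max_left _ _).trans (le_max_right _ _))
  · have : fderiv ℝ V =ᶠ[𝓝 p] fderivWithin ℝ V C := by
      filter_upwards [isOpen_cylinder.mem_nhds hp] with q hq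
      exact (fderivWithin_closedCylinder_eq V hq).symm
    rw [this.fderiv_eq, ← fderivWithin_closedCylinder_eq _ hp]
    exact (hM2 p hpC).trans ((le_max_right _ _).trans (le_max_right _ _))

theorem hasFDerivAt_slice (t : ℝ) (x : EuclideanSpace ℝ (Fin d)) :
    HasFDerivAt (fun y : EuclideanSpace ℝ (Fin d) => (t, y))
      (ContinuousLinearMap.inr ℝ ℝ (EuclideanSpace ℝ (Fin d))) x := hasFDerivAt_prodMk_right t x

theorem IsAdmissible.hasDerivAt (hv : IsAdmissible l r T v) {t : ℝ} {x : EuclideanSpace ℝ (Fin d)}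
    (hp : (t, x) ∈ cylinder l r T) : HasDerivAt (fun s => v s x)
      (fderiv ℝ (fun p : ℝ × EuclideanSpace ℝ (Fin d) => v p.1 p.2) (t, x) (1, 0)) t := by
  have h := ((hv.contDiffAt hp).differentiableAt (by norm_num)).hasFDerivAt
  exact h.comp_hasDerivAt t ((hasDerivAt_id t).prodMk (hasDerivAt_const t x))

theorem IsAdmissible.hasFDerivAt (hv : IsAdmissible l r T v) {t : ℝ} {x : EuclideanSpace ℝ (Fin d)}
    (hp : (t, x) ∈ cylinder l r T) : HasFDerivAt (v t)
      ((fderiv ℝ (fun p : ℝ × EuclideanSpace ℝ (Fin d) => v p.1 p.2) (t, x)).comp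
        (ContinuousLinearMap.inr ℝ ℝ (EuclideanSpace ℝ (Fin d)))) x := by
  have h := ((hv.contDiffAt hp).differentiableAt (by norm_num)).hasFDerivAt
  exact h.comp x (hasFDerivAt_slice t x)

theorem IsAdmissible.contDiffOn_slice (hv : IsAdmissible l r T v) {t : ℝ} (ht : t ∈ Icc 0 T) :
    ContDiffOn ℝ ∞ (v t) (closure (box l r)) :=
  hv.smooth.comp (contDiff_const.prodMk contDiff_id).contDiffOn fun _ hx => ⟨ht, hx⟩

/-- Expressing the spatial Laplacian through the joint second derivative yields its continuity in
`(t, x)` and its boundedness. -/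
theorem IsAdmissible.laplacian_slice (hv : IsAdmissible l r T v) {t : ℝ}
    {x : EuclideanSpace ℝ (Fin d)} (hp : (t, x) ∈ cylinder l r T) :
    Laplacian.laplacian (v t) x = ∑ i, fderiv ℝ (fderiv ℝ
      fun p : ℝ × EuclideanSpace ℝ (Fin d) => v p.1 p.2) (t, x)
        (0, stdOrthonormalBasis ℝ (EuclideanSpace ℝ (Fin d)) i)
        (0, stdOrthonormalBasis ℝ (EuclideanSpace ℝ (Fin d)) i) := by
  have hc : ContDiffAt ℝ ∞ (v t) x :=
    (hv.contDiffAt hp).comp x (contDiff_const.prodMk contDiff_id).contDiffAt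
  rw [laplacian_eq_sum_fderiv (stdOrthonormalBasis ℝ _) (contDiffAt_infty.1 hc 2)]
  refine Finset.sum_congr rfl fun i _ => ?_
  set e := stdOrthonormalBasis ℝ (EuclideanSpace ℝ (Fin d)) i
  set V : ℝ × EuclideanSpace ℝ (Fin d) → ℝ := fun p => v p.1 p.2
  have h1 : (fun y => fderiv ℝ (v t) y e) =ᶠ[𝓝 x] fun y => fderiv ℝ V (t, y) (0, e) := by
    filter_upwards [isOpen_box.mem_nhds hp.2] with y hy
    rw [(hv.hasFDerivAt (show (t, y) ∈ cylinder l r T from ⟨hp.1, hy⟩)).fderiv]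
    rfl
  have h2 : DifferentiableAt ℝ (fderiv ℝ V) (t, x) :=
    ((contDiffAt_infty.1 (hv.contDiffAt hp) 2).fderiv_right (m := 1) (by norm_num)).differentiableAt (by norm_num)
  have h3 : HasFDerivAt (fun y => fderiv ℝ V (t, y))
      ((fderiv ℝ (fderiv ℝ V) (t, x)).comp (ContinuousLinearMap.inr ℝ ℝ _)) x :=
    h2.hasFDerivAt.comp x (hasFDerivAt_slice t x)
  rw [h1.fderiv_eq, (h3.clm_apply (hasFDerivAt_const ((0 : ℝ), e) x)).fderiv]
  simp

theorem IsAdmissible.continuousOn_deriv (hv : IsAdmissible l r T v) :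
    ContinuousOn (fun p : ℝ × EuclideanSpace ℝ (Fin d) => deriv (fun s => v s p.2) p.1)
      (cylinder l r T) := by
  have h : ContinuousOn (fderiv ℝ fun p : ℝ × EuclideanSpace ℝ (Fin d) => v p.1 p.2)
      (cylinder l r T) := fun p hp =>
    ((hv.contDiffAt hp).fderiv_right (m := 0) (by norm_num)).continuousAt.continuousWithinAt
  exact (h.clm_apply continuousOn_const).congr fun p hp => (hv.hasDerivAt hp).deriv

theorem IsAdmissible.continuousOn_fderiv (hv : IsAdmissible l r T v) :
    ContinuousOn (fun p : ℝ × EuclideanSpace ℝ (Fin d) => fderiv ℝ (v p.1) p.2)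
      (cylinder l r T) := by
  have h : ContinuousOn (fderiv ℝ fun p : ℝ × EuclideanSpace ℝ (Fin d) => v p.1 p.2)
      (cylinder l r T) := fun p hp =>
    ((hv.contDiffAt hp).fderiv_right (m := 0) (by norm_num)).continuousAt.continuousWithinAt
  exact (h.clm_comp continuousOn_const).congr fun p hp => (hv.hasFDerivAt hp).fderiv

theorem IsAdmissible.continuousOn_laplacian (hv : IsAdmissible l r T v) :
    ContinuousOn (fun p : ℝ × EuclideanSpace ℝ (Fin d) => Laplacian.laplacian (v p.1) p.2)
      (cylinder l r T) := by
  have h : ContinuousOn (fderiv ℝ (fderiv ℝ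
      fun p : ℝ × EuclideanSpace ℝ (Fin d) => v p.1 p.2)) (cylinder l r T) := fun p hp =>
    (((contDiffAt_infty.1 (hv.contDiffAt hp) 2).fderiv_right (m := 1) (by norm_num)).fderiv_right (m := 0)
      (by norm_num)).continuousAt.continuousWithinAt
  refine ContinuousOn.congr ?_ fun p hp => hv.laplacian_slice hp
  exact continuousOn_finsetSum _ fun i _ =>
    (h.clm_apply continuousOn_const).clm_apply continuousOn_const

theorem IsAdmissible.exists_bound_derivatives (hlr : ∀ i, l i < r i) (hT : 0 < T)
    (hv : IsAdmissible l r T v) : ∃ M, ∀ t x, (t, x) ∈ cylinder l r T → |v t x| ≤ M ∧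
      |deriv (fun s => v s x) t| ≤ M ∧ |Laplacian.laplacian (v t) x| ≤ M ∧
      ‖fderiv ℝ (v t) x‖ ^ 2 ≤ M := by
  obtain ⟨M, hM⟩ := hv.exists_bound hlr hT
  set b := stdOrthonormalBasis ℝ (EuclideanSpace ℝ (Fin d))
  set N : ℝ := ∑ i, M * ‖((0 : ℝ), b i)‖ * ‖((0 : ℝ), b i)‖
  set m : ℝ := ‖((1 : ℝ), (0 : EuclideanSpace ℝ (Fin d)))‖
  set R : ℝ := ‖ContinuousLinearMap.inr ℝ ℝ (EuclideanSpace ℝ (Fin d))‖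
  refine ⟨max (max M (M * m)) (max N ((M * R) ^ 2)), fun t x hp => ?_⟩
  obtain ⟨h0, h1, h2⟩ := hM _ hp
  refine ⟨h0.trans ((le_max_left _ _).trans (le_max_left _ _)), ?_, ?_, ?_⟩
  · rw [(hv.hasDerivAt hp).deriv]
    refine le_trans ?_ ((le_max_right _ _).trans (le_max_left _ _))
    exact ContinuousLinearMap.le_of_opNorm_le _ h1 _
  · rw [hv.laplacian_slice hp]
    refine le_trans ?_ ((le_max_left _ _).trans (le_max_right _ _))
    refine (Finset.abs_sum_le_sum_abs _ _).trans (Finset.sum_le_sum fun i _ => ?_)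
    exact ContinuousLinearMap.le_of_opNorm_le _ (ContinuousLinearMap.le_of_opNorm_le _ h2 _) _
  · rw [(hv.hasFDerivAt hp).fderiv]
    refine le_trans ?_ ((le_max_right _ _).trans (le_max_right _ _))
    gcongr
    exact (ContinuousLinearMap.opNorm_comp_le _ _).trans (by gcongr)

theorem IsAdmissible.residual_eq (hv : IsAdmissible l r T v) {t : ℝ}
    {x : EuclideanSpace ℝ (Fin d)} (hp : (t, x) ∈ cylinder l r T) :
    residual v t x = deriv (fun s => v s x) t -
      (v t x * Laplacian.laplacian (v t) x + ‖fderiv ℝ (v t) x‖ ^ 2) := by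
  have hc : ContDiffAt ℝ ∞ (v t) x :=
    (hv.contDiffAt hp).comp x (contDiff_const.prodMk contDiff_id).contDiffAt
  rw [residual, laplacian_comp (P := fun s => s ^ 2) (by fun_prop)
    (contDiffAt_infty.1 hc 2)]
  have h1 : (deriv fun s : ℝ => s ^ 2) = fun s => 2 * s := funext fun s => by simp
  rw [h1, deriv_const_mul_field, deriv_id'']
  ring

theorem IsAdmissible.continuousOn_residual (hv : IsAdmissible l r T v) :
    ContinuousOn (fun p : ℝ × EuclideanSpace ℝ (Fin d) => residual v p.1 p.2)
      (cylinder l r T) := by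
  have h0 : ContinuousOn (fun p : ℝ × EuclideanSpace ℝ (Fin d) => v p.1 p.2) (cylinder l r T) :=
    hv.smooth.continuousOn.mono cylinder_subset
  exact (hv.continuousOn_deriv.sub ((h0.mul hv.continuousOn_laplacian).add
    (hv.continuousOn_fderiv.norm.pow 2))).congr fun p hp => hv.residual_eq hp

end Admissible

/-! ### Truncated competitors as comparison functions -/

section Comparison

variable {d : ℕ} {l r : Fin d → ℝ} {T : ℝ} {v : ℝ → EuclideanSpace ℝ (Fin d) → ℝ}

theorem measurableSet_cylinder : MeasurableSet (cylinder l r T) := isOpen_cylinder.measurableSet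

theorem integrableOn_cylinder {f : ℝ × EuclideanSpace ℝ (Fin d) → ℝ}
    (hf : ContinuousOn f (cylinder l r T)) {M : ℝ} (hM : ∀ p ∈ cylinder l r T, |f p| ≤ M) :
    IntegrableOn f (cylinder l r T) := by
  have hfin : volume (cylinder l r T) < ⊤ :=
    ((isCompact_Icc.isBounded.subset Ioo_subset_Icc_self).prod isBounded_box).measure_lt_top
  exact IntegrableOn.of_bound hfin (hf.aestronglyMeasurable measurableSet_cylinder)
    M (ae_restrict_of_forall_mem measurableSet_cylinder hM)

theorem locTimeIntegrable_of_integrableOn {f : ℝ → EuclideanSpace ℝ (Fin d) → ℝ}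
    (hf : IntegrableOn (fun p : ℝ × EuclideanSpace ℝ (Fin d) => f p.1 p.2) (cylinder l r T)) :
    LocTimeIntegrable l r T f := fun _ _ h₁ h₂ =>
  hf.mono_set (prod_mono (fun _ ht => ⟨h₁.trans_le ht.1, ht.2.trans_lt h₂⟩) subset_rfl)

theorem prod_boxMeasure_le {a b : ℝ} (ha : 0 < a) (hb : b < T) :
    (volume.restrict (Ioc a b)).prod (boxMeasure l r) ≤ volume.restrict (cylinder l r T) := by
  rw [boxMeasure, Measure.prod_restrict, ← Measure.volume_eq_prod]
  exact Measure.restrict_mono (show Ioc a b ×ˢ box l r ⊆ cylinder l r T from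
    fun p hp => ⟨⟨ha.trans hp.1.1, hp.1.2.trans_lt hb⟩, hp.2⟩) le_rfl

theorem ae_mem_cylinder {a b : ℝ} (ha : 0 < a) (hb : b < T) :
    ∀ᵐ p ∂((volume.restrict (Ioc a b)).prod (boxMeasure l r)), p ∈ cylinder l r T := by
  rw [boxMeasure, Measure.prod_restrict]
  exact ae_restrict_of_forall_mem (measurableSet_Ioc.prod measurableSet_box)
    fun p hp => ⟨⟨ha.trans hp.1.1, hp.1.2.trans_lt hb⟩, hp.2⟩

/-- Smooth nonnegative approximation of the positive part of `v`, extended by zero. -/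
noncomputable def approxPos (l r : Fin d → ℝ) (v : ℝ → EuclideanSpace ℝ (Fin d) → ℝ) (k t : ℝ) :
    EuclideanSpace ℝ (Fin d) → ℝ :=
  (box l r).indicator fun x => posApprox k (v t x)

theorem approxPos_of_mem {k t : ℝ} {x : EuclideanSpace ℝ (Fin d)} (hx : x ∈ box l r) :
    approxPos l r v k t x = posApprox k (v t x) := indicator_of_mem hx _

theorem IsAdmissible.isTestFunction_approxPos (hv : IsAdmissible l r T v) {k : ℝ} (hk : 0 < k)
    {t : ℝ} (ht : t ∈ Icc 0 T) : IsTestFunction (box l r) (approxPos l r v k t) := by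
  refine isTestFunction_indicator_comp isOpen_box isCompact_closure_box
    (hv.contDiffOn_slice ht).continuousOn ((hv.contDiffOn_slice ht).mono subset_closure)
    (hv.boundary t ht) (contDiff_posApprox k) (inv_pos.2 hk) fun s hs => posApprox_eq_zero ?_
  calc k * s ≤ k * k⁻¹ := by gcongr
    _ = 1 := mul_inv_cancel₀ hk.ne'

theorem IsAdmissible.laplacian_approxPos_sq (hv : IsAdmissible l r T v) (k : ℝ) {t : ℝ}
    {x : EuclideanSpace ℝ (Fin d)} (hp : (t, x) ∈ cylinder l r T) :
    Laplacian.laplacian (fun y => approxPos l r v k t y ^ 2) x =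
      deriv (fun s => posApprox k s ^ 2) (v t x) * Laplacian.laplacian (v t) x +
        deriv (deriv fun s => posApprox k s ^ 2) (v t x) * ‖fderiv ℝ (v t) x‖ ^ 2 := by
  have hc : ContDiffAt ℝ ∞ (v t) x :=
    (hv.contDiffAt hp).comp x (contDiff_const.prodMk contDiff_id).contDiffAt
  rw [← laplacian_comp (contDiff_infty.1 (contDiff_posApprox_sq k) 2) (contDiffAt_infty.1 hc 2)]
  have : (fun y => approxPos l r v k t y ^ 2) =ᶠ[𝓝 x] fun y => posApprox k (v t y) ^ 2 := by
    filter_upwards [isOpen_box.mem_nhds hp.2] with y hy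
    rw [approxPos_of_mem hy]
  exact (InnerProductSpace.laplacian_congr_nhds this).eq_of_nhds

/-- The factor `σ` covers two uses: `σ = 1` is the residual in the contraction estimate, and `σ =
-1` is the integrand in the mass balance. -/
theorem IsAdmissible.approxResidual_eq (hv : IsAdmissible l r T v) (k : ℝ) {t : ℝ}
    {x : EuclideanSpace ℝ (Fin d)} (hp : (t, x) ∈ cylinder l r T) (σ : ℝ) :
    deriv (posApprox k) (v t x) * deriv (fun s => v s x) t -
        1 / 2 * (σ * Laplacian.laplacian (fun y => approxPos l r v k t y ^ 2) x) =
      approxResidual k (v t x) (deriv (fun s => v s x) t) (σ * Laplacian.laplacian (v t) x)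
        (σ * ‖fderiv ℝ (v t) x‖ ^ 2) := by
  rw [hv.laplacian_approxPos_sq k hp, approxResidual]
  ring

theorem IsAdmissible.continuousOn (hv : IsAdmissible l r T v) :
    ContinuousOn (fun p : ℝ × EuclideanSpace ℝ (Fin d) => v p.1 p.2) (cylinder l r T) :=
  hv.smooth.continuousOn.mono cylinder_subset

theorem IsAdmissible.continuousOn_approxResidual (hv : IsAdmissible l r T v) (k σ τ : ℝ) :
    ContinuousOn (fun p : ℝ × EuclideanSpace ℝ (Fin d) => approxResidual k (v p.1 p.2)
      (τ * deriv (fun s => v s p.2) p.1) (σ * Laplacian.laplacian (v p.1) p.2)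
        (σ * ‖fderiv ℝ (v p.1) p.2‖ ^ 2)) (cylinder l r T) :=
  (continuous_approxResidual k).comp_continuousOn (hv.continuousOn.prodMk
    ((continuousOn_const.mul hv.continuousOn_deriv).prodMk
    ((continuousOn_const.mul hv.continuousOn_laplacian).prodMk
    (continuousOn_const.mul (hv.continuousOn_fderiv.norm.pow 2)))))

theorem IsAdmissible.exists_approxResidual_bound (hlr : ∀ i, l i < r i) (hT : 0 < T)
    (hv : IsAdmissible l r T v) {σ τ : ℝ} (hσ : |σ| ≤ 1) (hτ : |τ| ≤ 1) :
    ∃ K, ∀ k > 0, ∀ p ∈ cylinder l r T,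
      |approxResidual k (v p.1 p.2) (τ * deriv (fun s => v s p.2) p.1)
        (σ * Laplacian.laplacian (v p.1) p.2) (σ * ‖fderiv ℝ (v p.1) p.2‖ ^ 2)| ≤ K := by
  obtain ⟨M, hM⟩ := hv.exists_bound_derivatives hlr hT
  obtain ⟨K, hK⟩ := QPME.exists_approxResidual_bound M
  refine ⟨K, fun k hk p hp => ?_⟩
  obtain ⟨h1, h2, h3, h4⟩ := hM p.1 p.2 hp
  have hm : ∀ {σ c : ℝ}, |σ| ≤ 1 → |c| ≤ M → |σ * c| ≤ M := fun hσ hc => by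
    rw [abs_mul]
    exact (mul_le_of_le_one_left (abs_nonneg _) hσ).trans hc
  exact hK k hk _ _ _ _ h1 (hm hτ h2) (hm hσ h3) (hm hσ (by rwa [abs_of_nonneg (by positivity)]))

theorem IsAdmissible.isComparison (hlr : ∀ i, l i < r i) (hT : 0 < T) (hv : IsAdmissible l r T v)
    {k : ℝ} (hk : 0 < k) : IsComparison l r T (approxPos l r v k)
      fun t x => deriv (posApprox k) (v t x) * deriv (fun s => v s x) t := by
  -- With spatial factor `0` and temporal factor `1` the approximate residual reduces to the time
  -- derivative of the truncation; the opposite choice, used at the end, isolates `-½` times the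
  -- Laplacian of its square.
  have e0 : ∀ {t : ℝ} {x : EuclideanSpace ℝ (Fin d)},
      deriv (posApprox k) (v t x) * deriv (fun s => v s x) t = approxResidual k (v t x)
        (1 * deriv (fun s => v s x) t) (0 * Laplacian.laplacian (v t) x)
        (0 * ‖fderiv ℝ (v t) x‖ ^ 2) := by
    intro t x
    rw [approxResidual]
    ring
  have hcont := hv.continuousOn_approxResidual k 0 1
  obtain ⟨K, hK⟩ := hv.exists_approxResidual_bound hlr hT (σ := 0) (τ := 1) (by simp) (by simp)
  refine ⟨fun t ht => hv.isTestFunction_approxPos hk ht, fun t _ x => ?_, ?_, ?_, ?_⟩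
  · exact indicator_nonneg (fun x _ => posApprox_nonneg hk _) x
  · intro x hx a b ha hab hb
    have hmem : ∀ s ∈ uIcc a b, (s, x) ∈ cylinder l r T := fun s hs => by
      rw [uIcc_of_le hab] at hs
      exact ⟨⟨ha.trans_le hs.1, hs.2.trans_lt hb⟩, hx⟩
    have hder : ∀ s ∈ uIcc a b, HasDerivAt (fun s => posApprox k (v s x))
        (deriv (posApprox k) (v s x) * deriv (fun s => v s x) s) s := fun s hs => by
      have h1 := (hv.hasDerivAt (hmem s hs)).differentiableAt.hasDerivAt
      exact (((contDiff_posApprox k).differentiable (by norm_num)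
        (v s x)).hasDerivAt).comp s h1
    rw [intervalIntegral.integral_eq_sub_of_hasDerivAt hder, approxPos_of_mem hx,
      approxPos_of_mem hx]
    refine ContinuousOn.intervalIntegrable ?_
    simp only [e0]
    exact hcont.comp (f := fun s => (s, x)) (by fun_prop) hmem
  · simp only [e0]
    exact locTimeIntegrable_of_integrableOn (integrableOn_cylinder hcont (hK k hk))
  · obtain ⟨K', hK'⟩ := hv.exists_approxResidual_bound hlr hT (σ := 1) (τ := 0) (by simp) (by simp)
    refine locTimeIntegrable_of_integrableOn (((integrableOn_cylinder
      (hv.continuousOn_approxResidual k 1 0) (hK' k hk)).const_mul (-2)).congr ?_)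
    refine ae_restrict_of_forall_mem measurableSet_cylinder fun p hp => ?_
    beta_reduce
    rw [hv.laplacian_approxPos_sq k hp, approxResidual]
    ring

variable {a b : ℝ}

/-- Dominated convergence with a constant bound on a finite measure. The function `g` is the
absolute value in the contraction estimate and the identity in the mass balance. -/
theorem IsAdmissible.tendsto_integral_approxResidual (hlr : ∀ i, l i < r i) (hT : 0 < T)
    (hv : IsAdmissible l r T v) (ha : 0 < a) (hb : b < T) {σ : ℝ} (hσ : |σ| ≤ 1) {g : ℝ → ℝ}
    (hg : Continuous g) :
    Tendsto (fun n : ℕ => ∫ p, g (approxResidual ((n : ℝ) + 1) (v p.1 p.2)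
      (deriv (fun s => v s p.2) p.1) (σ * Laplacian.laplacian (v p.1) p.2)
        (σ * ‖fderiv ℝ (v p.1) p.2‖ ^ 2)) ∂((volume.restrict (Ioc a b)).prod (boxMeasure l r)))
      atTop (𝓝 (∫ p, g (if 0 < v p.1 p.2 then deriv (fun s => v s p.2) p.1 -
        (v p.1 p.2 * (σ * Laplacian.laplacian (v p.1) p.2) + σ * ‖fderiv ℝ (v p.1) p.2‖ ^ 2)
        else 0) ∂((volume.restrict (Ioc a b)).prod (boxMeasure l r)))) := by
  obtain ⟨K, hK⟩ := hv.exists_approxResidual_bound hlr hT hσ (τ := 1) (by simp)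
  simp only [one_mul] at hK
  obtain ⟨N, hN⟩ := isCompact_Icc.exists_bound_of_continuousOn (s := Icc (-K) K) hg.continuousOn
  refine tendsto_integral_of_dominated_convergence (fun _ => N) (fun n => ?_)
    (integrable_const _) (fun n => ?_) (Eventually.of_forall fun p =>
      (hg.tendsto _).comp (tendsto_approxResidual _ _ _ _))
  · have h := hv.continuousOn_approxResidual ((n : ℝ) + 1) σ 1
    simp only [one_mul] at h
    exact hg.comp_aestronglyMeasurable ((h.aestronglyMeasurable (μ := volume)
      measurableSet_cylinder).mono_measure (prod_boxMeasure_le ha hb))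
  · filter_upwards [ae_mem_cylinder ha hb] with p hp
    exact hN _ (abs_le.1 (hK _ (by positivity) p hp))

theorem IsAdmissible.integrable_slice (hv : IsAdmissible l r T v) {t : ℝ} (ht : t ∈ Icc 0 T) :
    Integrable (v t) (boxMeasure l r) :=
  ((hv.contDiffOn_slice ht).continuousOn.integrableOn_compact isCompact_closure_box).mono_set
    subset_closure

theorem IsAdmissible.tendsto_integral_abs_sub_approxPos (hv : IsAdmissible l r T v) {t : ℝ}
    (ht : t ∈ Icc 0 T) {f : EuclideanSpace ℝ (Fin d) → ℝ} (hf : Integrable f (boxMeasure l r)) :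
    Tendsto (fun n : ℕ => ∫ x, |f x - approxPos l r v ((n : ℝ) + 1) t x| ∂(boxMeasure l r)) atTop
      (𝓝 (∫ x, |f x - max (v t x) 0| ∂(boxMeasure l r))) := by
  have hbox : ∀ᵐ x ∂(boxMeasure l r), x ∈ box l r := ae_restrict_mem measurableSet_box
  refine tendsto_integral_of_dominated_convergence (fun x => |f x| + |v t x|) (fun n => ?_)
    (hf.abs.add (hv.integrable_slice ht).abs) (fun n => ?_) ?_
  · exact (hf.aestronglyMeasurable.sub (hv.isTestFunction_approxPos (by positivity)
      ht).smooth.continuous.aestronglyMeasurable).norm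
  · filter_upwards [hbox] with x hx
    rw [Real.norm_eq_abs, abs_abs, approxPos_of_mem hx]
    exact (abs_sub _ _).trans (add_le_add le_rfl (abs_posApprox_le _ _))
  · filter_upwards [hbox] with x hx
    simp only [approxPos_of_mem hx]
    exact (tendsto_const_nhds.sub (tendsto_posApprox _)).abs

end Comparison

/-! ### Sign-changing competitors and the L¹ stability estimate -/

section Stability

variable {d : ℕ} {l r : Fin d → ℝ} {T : ℝ} {v : ℝ → EuclideanSpace ℝ (Fin d) → ℝ} {a b : ℝ}
  {u₀ : EuclideanSpace ℝ (Fin d) → ℝ} {u : ℝ → EuclideanSpace ℝ (Fin d) → ℝ}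

theorem integral_laplacian_eq_zero {φ : EuclideanSpace ℝ (Fin d) → ℝ}
    (hφ : IsTestFunction (box l r) φ) :
    ∫ x, Laplacian.laplacian φ x ∂(boxMeasure l r) = 0 := by
  have h := integral_mul_laplacian_comm (η := fun _ : EuclideanSpace ℝ (Fin d) => (1 : ℝ))
    contDiff_const hφ.contDiff_two (Or.inr hφ.compact_support)
  have h0 : ∀ x, Laplacian.laplacian (fun _ : EuclideanSpace ℝ (Fin d) => (1 : ℝ)) x = 0 := by
    intro x
    rw [laplacian_eq_sum_fderiv (stdOrthonormalBasis ℝ _) contDiffAt_const]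
    simp
  rw [boxMeasure, setIntegral_eq_integral_of_forall_compl_eq_zero
    fun x hx => hφ.laplacian_eq_zero hx]
  simpa [h0] using h

theorem IsAdmissible.neg (hv : IsAdmissible l r T v) : IsAdmissible l r T fun t x => -v t x where
  smooth := hv.smooth.neg
  boundary t ht x hx := by rw [hv.boundary t ht x hx, neg_zero]

/-- The Laplacian term integrates to zero because `w²` is compactly supported. It is inserted with
the plus sign so that, for truncations of `-v`, the integrand tends to minus the residual of `v`
where `v < 0`. -/
theorem IsComparison.integral_sub {w wt : ℝ → EuclideanSpace ℝ (Fin d) → ℝ}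
    (hw : IsComparison l r T w wt) (ha : 0 < a) (hab : a ≤ b) (hb : b < T) :
    ∫ x, w b x ∂(boxMeasure l r) - ∫ x, w a x ∂(boxMeasure l r) =
      ∫ p : ℝ × EuclideanSpace ℝ (Fin d), (wt p.1 p.2 +
        1 / 2 * Laplacian.laplacian (fun y => w p.1 y ^ 2) p.2)
        ∂((volume.restrict (Ioc a b)).prod (boxMeasure l r)) := by
  have hi : ∀ t ∈ Icc 0 T, Integrable (w t) (boxMeasure l r) := fun t ht =>
    ((hw.test t ht).smooth.continuous.integrable_of_hasCompactSupport
      (hw.test t ht).compact_support).restrict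
  have i1 := hw.integrable_deriv.integrable_prod ha hb
  have i2 := hw.integrable_laplacian.integrable_prod ha hb
  have hlap : ∫ p : ℝ × EuclideanSpace ℝ (Fin d),
      Laplacian.laplacian (fun y => w p.1 y ^ 2) p.2
        ∂((volume.restrict (Ioc a b)).prod (boxMeasure l r)) = 0 := by
    have key : ∀ t ∈ Ioc a b,
        ∫ x, Laplacian.laplacian (fun y => w t y ^ 2) x ∂(boxMeasure l r) = 0 := fun t ht => by
      have h : IsTestFunction (box l r) fun y => w t y ^ 2 :=
        (hw.test t ⟨(ha.trans ht.1).le, ht.2.trans hb.le⟩).comp_zero (P := fun s => s ^ 2)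
          (by fun_prop) (by simp)
      exact integral_laplacian_eq_zero h
    calc _ = ∫ t in Ioc a b, ∫ x, Laplacian.laplacian (fun y => w t y ^ 2) x ∂(boxMeasure l r) :=
          integral_prod _ i2
      _ = ∫ t in Ioc a b, (0 : ℝ) := setIntegral_congr_fun measurableSet_Ioc key
      _ = 0 := integral_zero _ _
  have e := integral_add i1 (i2.const_mul (1 / 2))
  rw [integral_const_mul, hlap, mul_zero, add_zero] at e
  have e2 := integral_integral_swap (f := wt) i1
  rw [e, ← MeasureTheory.integral_sub (hi b ⟨(ha.trans_le hab).le, hb.le⟩)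
    (hi a ⟨ha.le, hab.trans hb.le⟩), integral_prod _ i1, e2]
  refine integral_congr_ae (ae_restrict_of_forall_mem measurableSet_box fun x hx => ?_)
  beta_reduce
  rw [hw.sub_eq_integral x hx a b ha hab hb, intervalIntegral.integral_of_le hab]

theorem IsAdmissible.integral_approxPos_sub (hlr : ∀ i, l i < r i) (hT : 0 < T)
    (hv : IsAdmissible l r T v) (ha : 0 < a) (hab : a ≤ b) (hb : b < T) {k : ℝ} (hk : 0 < k) :
    ∫ x, approxPos l r v k b x ∂(boxMeasure l r) - ∫ x, approxPos l r v k a x ∂(boxMeasure l r) =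
      ∫ p, approxResidual k (v p.1 p.2) (deriv (fun s => v s p.2) p.1)
        (-1 * Laplacian.laplacian (v p.1) p.2) (-1 * ‖fderiv ℝ (v p.1) p.2‖ ^ 2)
        ∂((volume.restrict (Ioc a b)).prod (boxMeasure l r)) := by
  rw [(hv.isComparison hlr hT hk).integral_sub ha hab hb]
  refine integral_congr_ae ?_
  filter_upwards [ae_mem_cylinder ha hb] with p hp
  rw [← hv.approxResidual_eq k hp]
  ring

/-- Limit of the mass balance of the truncations. It is an equality involving no solution, and it
will be applied to `-v`. -/
theorem IsAdmissible.integral_pos_eq (hlr : ∀ i, l i < r i) (hT : 0 < T)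
    (hv : IsAdmissible l r T v) (ha : 0 < a) (hab : a ≤ b) (hb : b < T) :
    ∫ x, max (v b x) 0 ∂(boxMeasure l r) - ∫ x, max (v a x) 0 ∂(boxMeasure l r) =
      ∫ p, (if 0 < v p.1 p.2 then deriv (fun s => v s p.2) p.1 +
        (v p.1 p.2 * Laplacian.laplacian (v p.1) p.2 + ‖fderiv ℝ (v p.1) p.2‖ ^ 2) else 0)
        ∂((volume.restrict (Ioc a b)).prod (boxMeasure l r)) := by
  have hlim : ∀ t ∈ Icc 0 T, Tendsto
      (fun n : ℕ => ∫ x, approxPos l r v ((n : ℝ) + 1) t x ∂(boxMeasure l r)) atTop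
      (𝓝 (∫ x, max (v t x) 0 ∂(boxMeasure l r))) := fun t ht => by
    have h := hv.tendsto_integral_abs_sub_approxPos ht (f := fun _ => 0) (integrable_zero _ _ _)
    have e : ∀ n : ℕ, ∀ x, |0 - approxPos l r v ((n : ℝ) + 1) t x| =
        approxPos l r v ((n : ℝ) + 1) t x := fun n x => by
      rw [zero_sub, abs_neg, abs_of_nonneg]
      exact indicator_nonneg (fun x _ => posApprox_nonneg (by positivity) _) x
    have e' : ∀ x, |0 - max (v t x) 0| = max (v t x) 0 := fun x => by
      rw [zero_sub, abs_neg, abs_of_nonneg (le_max_right _ _)]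
    simpa only [e, e'] using h
  have h1 := (hlim b ⟨(ha.trans_le hab).le, hb.le⟩).sub (hlim a ⟨ha.le, hab.trans hb.le⟩)
  have h2 := hv.tendsto_integral_approxResidual hlr hT ha hb (σ := -1) (a := a) (by simp)
    continuous_id
  refine (tendsto_nhds_unique (h1.congr fun n =>
    hv.integral_approxPos_sub hlr hT ha hab hb (by positivity)) h2).trans ?_
  refine integral_congr_ae (Eventually.of_forall fun p => ?_)
  simp only [id]
  split_ifs <;> ring

/-- Limit of the contraction estimate against the truncations; only the residual on `{v > 0}`
survives. -/
theorem IsStrongSolution.integral_abs_sub_pos_le (hlr : ∀ i, l i < r i) (hT : 0 < T)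
    (hu : IsStrongSolution l r T u₀ u) (hv : IsAdmissible l r T v) (ha : 0 < a) (hab : a ≤ b)
    (hb : b < T) :
    ∫ x, |u b x - max (v b x) 0| ∂(boxMeasure l r) ≤
      ∫ x, |u a x - max (v a x) 0| ∂(boxMeasure l r) +
      ∫ p, |if 0 < v p.1 p.2 then deriv (fun s => v s p.2) p.1 -
        (v p.1 p.2 * Laplacian.laplacian (v p.1) p.2 + ‖fderiv ℝ (v p.1) p.2‖ ^ 2) else 0|
        ∂((volume.restrict (Ioc a b)).prod (boxMeasure l r)) := by
  have haT : a ∈ Icc 0 T := ⟨ha.le, hab.trans hb.le⟩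
  have hbT : b ∈ Icc 0 T := ⟨(ha.trans_le hab).le, hb.le⟩
  have h3 := hv.tendsto_integral_approxResidual hlr hT ha hb (σ := 1) (a := a) (by simp)
    continuous_abs
  simp only [one_mul] at h3
  refine le_of_tendsto_of_tendsto' (hv.tendsto_integral_abs_sub_approxPos hbT (hu.integrable hbT))
    ((hv.tendsto_integral_abs_sub_approxPos haT (hu.integrable haT)).add h3) fun n => ?_
  have hw := hv.isComparison hlr hT (k := (n : ℝ) + 1) (by positivity)
  refine (hu.integral_abs_sub_le_of_Ioo hT hw ha hab hb).trans_eq ?_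
  congr 1
  have hi := ((hw.integrable_deriv.integrable_prod ha hb).sub
    ((hw.integrable_laplacian.integrable_prod ha hb).const_mul (1 / 2))).abs
  rw [intervalIntegral.integral_of_le hab]
  refine (integral_prod _ hi).symm.trans (integral_congr_ae ?_)
  filter_upwards [ae_mem_cylinder ha hb] with p hp
  have := hv.approxResidual_eq ((n : ℝ) + 1) hp 1
  simp only [one_mul] at this
  rw [← this]
  rfl

theorem abs_sub_eq_abs_sub_max_add {s z : ℝ} (hs : 0 ≤ s) :
    |s - z| = |s - max z 0| + max (-z) 0 := by
  rcases le_total z 0 with h | h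
  · rw [max_eq_right h, max_eq_left (by linarith), sub_zero, abs_of_nonneg hs,
      abs_of_nonneg (by linarith)]
    ring
  · rw [max_eq_left h, max_eq_right (by linarith), add_zero]

theorem IsAdmissible.integrable_residual (hlr : ∀ i, l i < r i) (hT : 0 < T)
    (hv : IsAdmissible l r T v) : IntegrableOn
      (fun p : ℝ × EuclideanSpace ℝ (Fin d) => residual v p.1 p.2) (cylinder l r T) := by
  obtain ⟨M, hM⟩ := hv.exists_bound_derivatives hlr hT
  refine integrableOn_cylinder hv.continuousOn_residual (M := M + (M * M + M)) fun p hp => ?_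
  obtain ⟨h1, h2, h3, h4⟩ := hM p.1 p.2 hp
  rw [hv.residual_eq hp]
  have hM0 : 0 ≤ M := (abs_nonneg _).trans h1
  have h5 : |v p.1 p.2 * Laplacian.laplacian (v p.1) p.2| ≤ M * M := by
    rw [abs_mul]; gcongr
  have h6 : (0 : ℝ) ≤ ‖fderiv ℝ (v p.1) p.2‖ ^ 2 := by positivity
  rw [abs_le] at *
  constructor <;> linarith

/-- Split `|u - v| = |u - v⁺| + v⁻`, which uses `u ≥ 0`, and add the contraction estimate for the
first part to the mass balance for the second. -/
theorem IsStrongSolution.integral_abs_sub_le (hlr : ∀ i, l i < r i) (hT : 0 < T)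
    (hu : IsStrongSolution l r T u₀ u) (hv : IsAdmissible l r T v) (ha : 0 < a) (hab : a ≤ b)
    (hb : b < T) :
    ∫ x, |u b x - v b x| ∂(boxMeasure l r) ≤ ∫ x, |u a x - v a x| ∂(boxMeasure l r) +
      ∫ p, |residual v p.1 p.2| ∂((volume.restrict (Ioc a b)).prod (boxMeasure l r)) := by
  have haT : a ∈ Icc 0 T := ⟨ha.le, hab.trans hb.le⟩
  have hbT : b ∈ Icc 0 T := ⟨(ha.trans_le hab).le, hb.le⟩
  have hsplit : ∀ t ∈ Icc 0 T, ∫ x, |u t x - v t x| ∂(boxMeasure l r) =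
      ∫ x, |u t x - max (v t x) 0| ∂(boxMeasure l r) +
        ∫ x, max (-v t x) 0 ∂(boxMeasure l r) := fun t ht => by
    refine Eq.trans (integral_congr_ae ?_)
      (integral_add ((hu.integrable ht).sub (hv.integrable_slice ht).pos_part).abs
        (hv.integrable_slice ht).neg_part)
    filter_upwards [hu.nonneg t ht] with x hx using abs_sub_eq_abs_sub_max_add hx
  have h1 := hu.integral_abs_sub_pos_le hlr hT hv ha hab hb
  -- With `z = -v` one has `∂ₜ z + ½ Δ z² = -(∂ₜ v - ½ Δ v²)`: the time derivative changes sign and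
  -- the square does not. The integrand on `{v < 0}` is thus minus the residual.
  have h2 := hv.neg.integral_pos_eq hlr hT ha hab hb
  have hres : Integrable (fun p : ℝ × EuclideanSpace ℝ (Fin d) => residual v p.1 p.2)
      ((volume.restrict (Ioc a b)).prod (boxMeasure l r)) :=
    Integrable.mono_measure (hv.integrable_residual hlr hT) (prod_boxMeasure_le ha hb)
  have hvm : AEStronglyMeasurable (fun p : ℝ × EuclideanSpace ℝ (Fin d) => v p.1 p.2)
      ((volume.restrict (Ioc a b)).prod (boxMeasure l r)) :=
    (hv.continuousOn.aestronglyMeasurable (μ := volume) measurableSet_cylinder).mono_measure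
      (prod_boxMeasure_le ha hb)
  have hpos : NullMeasurableSet {p : ℝ × EuclideanSpace ℝ (Fin d) | 0 < v p.1 p.2}
      ((volume.restrict (Ioc a b)).prod (boxMeasure l r)) :=
    nullMeasurableSet_lt aemeasurable_const hvm.aemeasurable
  have hneg : NullMeasurableSet {p : ℝ × EuclideanSpace ℝ (Fin d) | 0 < -v p.1 p.2}
      ((volume.restrict (Ioc a b)).prod (boxMeasure l r)) :=
    nullMeasurableSet_lt aemeasurable_const hvm.neg.aemeasurable
  set ρ := (volume.restrict (Ioc a b)).prod (boxMeasure l r)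
  have e1 : ∫ p, |if 0 < v p.1 p.2 then deriv (fun s => v s p.2) p.1 -
        (v p.1 p.2 * Laplacian.laplacian (v p.1) p.2 + ‖fderiv ℝ (v p.1) p.2‖ ^ 2) else 0| ∂ρ =
      ∫ p, {p : ℝ × EuclideanSpace ℝ (Fin d) | 0 < v p.1 p.2}.indicator
        (fun p => |residual v p.1 p.2|) p ∂ρ := by
    refine integral_congr_ae ?_
    filter_upwards [ae_mem_cylinder ha hb] with p hp
    rw [indicator_apply, hv.residual_eq hp]
    simp only [mem_ofPred_eq]
    split_ifs
    · rfl
    · exact abs_zero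
  have e2 : ∫ p, (if 0 < -v p.1 p.2 then deriv (fun s => -v s p.2) p.1 +
        (-v p.1 p.2 * Laplacian.laplacian (fun y => -v p.1 y) p.2 +
          ‖fderiv ℝ (fun y => -v p.1 y) p.2‖ ^ 2) else 0) ∂ρ =
      ∫ p, {p : ℝ × EuclideanSpace ℝ (Fin d) | 0 < -v p.1 p.2}.indicator
        (fun p => -residual v p.1 p.2) p ∂ρ := by
    refine integral_congr_ae ?_
    filter_upwards [ae_mem_cylinder ha hb] with p hp
    rw [indicator_apply, hv.residual_eq hp]
    simp only [mem_ofPred_eq]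
    split_ifs
    · have hL : Laplacian.laplacian (fun y => -v p.1 y) p.2 =
          -Laplacian.laplacian (v p.1) p.2 := by
        have := congrFun (InnerProductSpace.laplacian_neg (f := v p.1)) p.2
        exact this
      have hF : fderiv ℝ (fun y => -v p.1 y) p.2 = -fderiv ℝ (v p.1) p.2 := fderiv_fun_neg
      have hD : deriv (fun s => -v s p.2) p.1 = -deriv (fun s => v s p.2) p.1 := deriv.fun_neg
      rw [hL, hF, hD, norm_neg]
      ring
    · rfl
  rw [e1] at h1
  rw [e2] at h2
  rw [hsplit a haT, hsplit b hbT]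
  -- The two sets are disjoint, so the residual is counted at most once and the constant stays equal
  -- to `1`.
  have h3 : ∫ p, {p : ℝ × EuclideanSpace ℝ (Fin d) | 0 < v p.1 p.2}.indicator
        (fun p => |residual v p.1 p.2|) p ∂ρ +
      ∫ p, {p : ℝ × EuclideanSpace ℝ (Fin d) | 0 < -v p.1 p.2}.indicator
        (fun p => -residual v p.1 p.2) p ∂ρ ≤ ∫ p, |residual v p.1 p.2| ∂ρ := by
    have i1 := hres.abs.indicator₀ hpos
    have i2 := hres.neg.indicator₀ hneg
    refine (integral_add i1 i2).symm.trans_le (integral_mono (i1.add i2) hres.abs fun p => ?_)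
    simp only [indicator_apply, mem_ofPred_eq, Pi.neg_apply]
    have := abs_nonneg (residual v p.1 p.2)
    have := neg_le_abs (residual v p.1 p.2)
    split_ifs <;> linarith
  linarith

end Stability

/-! ### Extension to the closed time interval and Cauchy-Schwarz -/

section Estimates

variable {d : ℕ} {l r : Fin d → ℝ} {T : ℝ} {v : ℝ → EuclideanSpace ℝ (Fin d) → ℝ}
  {u₀ : EuclideanSpace ℝ (Fin d) → ℝ} {u : ℝ → EuclideanSpace ℝ (Fin d) → ℝ}

theorem IsAdmissible.tendsto_lintegral (hv : IsAdmissible l r T v) {t : ℝ} (ht : t ∈ Icc 0 T) :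
    Tendsto (fun s => ∫⁻ x, ‖v s x - v t x‖ₑ ∂(boxMeasure l r)) (𝓝[Icc 0 T] t) (𝓝 0) := by
  obtain ⟨M, hM⟩ := isCompact_closedCylinder.exists_bound_of_continuousOn hv.smooth.continuousOn
  have hmem : ∀ᶠ s in 𝓝[Icc 0 T] t, s ∈ Icc 0 T := eventually_mem_nhdsWithin
  have h : Tendsto (fun s => ∫ x, ‖v s x - v t x‖ ∂(boxMeasure l r)) (𝓝[Icc 0 T] t)
      (𝓝 (∫ x, (0 : ℝ) ∂(boxMeasure l r))) := by
    refine tendsto_integral_filter_of_dominated_convergence (fun _ => M + M) ?_ ?_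
      (integrable_const _) ?_
    · exact hmem.mono fun s hs =>
        ((hv.integrable_slice hs).sub (hv.integrable_slice ht)).norm.aestronglyMeasurable
    · refine hmem.mono fun s hs => ae_restrict_of_forall_mem measurableSet_box fun x hx => ?_
      rw [norm_norm]
      exact (norm_sub_le _ _).trans (add_le_add (hM (s, x) ⟨hs, subset_closure hx⟩)
        (hM (t, x) ⟨ht, subset_closure hx⟩))
    · refine ae_restrict_of_forall_mem measurableSet_box fun x hx => ?_
      have hc : ContinuousOn (fun s => v s x) (Icc 0 T) :=
        hv.smooth.continuousOn.comp (f := fun s => (s, x)) (by fun_prop)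
          fun s hs => ⟨hs, subset_closure hx⟩
      exact tendsto_iff_norm_sub_tendsto_zero.1 (hc t ht)
  rw [integral_zero] at h
  have h' := ENNReal.tendsto_ofReal h
  rw [ENNReal.ofReal_zero] at h'
  refine h'.congr' (hmem.mono fun s hs => ?_)
  exact ofReal_integral_norm_eq_lintegral_enorm
    ((hv.integrable_slice hs).sub (hv.integrable_slice ht))

theorem IsAdmissible.aestronglyMeasurable_residual (hv : IsAdmissible l r T v) {t : ℝ}
    (ht : t ≤ T) : AEStronglyMeasurable
      (fun p : ℝ × EuclideanSpace ℝ (Fin d) => residual v p.1 p.2)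
      ((volume.restrict (Ioo 0 t)).prod (boxMeasure l r)) := by
  rw [boxMeasure, Measure.prod_restrict, ← Measure.volume_eq_prod]
  exact (hv.continuousOn_residual.mono (show Ioo 0 t ×ˢ box l r ⊆ cylinder l r T from
    fun p hp => ⟨⟨hp.1.1, hp.1.2.trans_le ht⟩, hp.2⟩)).aestronglyMeasurable
      (measurableSet_Ioo.prod measurableSet_box)

theorem IsAdmissible.lintegral_residual (hv : IsAdmissible l r T v) {t : ℝ} (ht : t ≤ T) (p : ℕ) :
    ∫⁻ s in Ioc 0 t, ∫⁻ x, ‖residual v s x‖ₑ ^ p ∂(boxMeasure l r) =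
      ∫⁻ q, ‖residual v q.1 q.2‖ₑ ^ p ∂((volume.restrict (Ioo 0 t)).prod (boxMeasure l r)) := by
  rw [lintegral_prod _ ((hv.aestronglyMeasurable_residual ht).enorm.pow_const p),
    Measure.restrict_congr_set Ioo_ae_eq_Ioc]

theorem IsAdmissible.lintegral_residual_le_lossPDE (hv : IsAdmissible l r T v) {t : ℝ} (ht : t ≤ T)
    (p : ℕ) : ∫⁻ s in Ioc 0 t, ∫⁻ x, ‖residual v s x‖ₑ ^ p ∂(boxMeasure l r) ≤
      lossPDE p l r T v := by
  rw [hv.lintegral_residual ht, lossPDE]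
  refine lintegral_mono' ?_ le_rfl
  rw [boxMeasure, Measure.prod_restrict, ← Measure.volume_eq_prod]
  exact Measure.restrict_mono (show Ioo 0 t ×ˢ box l r ⊆ cylinder l r T from
    fun p hp => ⟨⟨hp.1.1, hp.1.2.trans_le ht⟩, hp.2⟩) le_rfl

theorem IsStrongSolution.lintegral_sub_le_of_Ioo (hlr : ∀ i, l i < r i) (hT : 0 < T)
    (hu : IsStrongSolution l r T u₀ u) (hv : IsAdmissible l r T v) {a b : ℝ} (ha : 0 < a)
    (hab : a ≤ b) (hb : b < T) :
    ∫⁻ x, ‖u b x - v b x‖ₑ ∂(boxMeasure l r) ≤ ∫⁻ x, ‖u a x - v a x‖ₑ ∂(boxMeasure l r) +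
      ∫⁻ s in Ioc 0 b, ∫⁻ x, ‖residual v s x‖ₑ ∂(boxMeasure l r) := by
  have haT : a ∈ Icc 0 T := ⟨ha.le, hab.trans hb.le⟩
  have hbT : b ∈ Icc 0 T := ⟨(ha.trans_le hab).le, hb.le⟩
  have hres : Integrable (fun p : ℝ × EuclideanSpace ℝ (Fin d) => residual v p.1 p.2)
      ((volume.restrict (Ioc a b)).prod (boxMeasure l r)) :=
    Integrable.mono_measure (hv.integrable_residual hlr hT) (prod_boxMeasure_le ha hb)
  have h := ENNReal.ofReal_le_ofReal (hu.integral_abs_sub_le hlr hT hv ha hab hb)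
  rw [ENNReal.ofReal_add (integral_nonneg fun _ => abs_nonneg _)
    (integral_nonneg fun _ => abs_nonneg _)] at h
  have e1 := ofReal_integral_norm_eq_lintegral_enorm
    ((hu.integrable haT).sub (hv.integrable_slice haT))
  have e2 := ofReal_integral_norm_eq_lintegral_enorm
    ((hu.integrable hbT).sub (hv.integrable_slice hbT))
  have e3 := ofReal_integral_norm_eq_lintegral_enorm hres
  simp only [Real.norm_eq_abs, Pi.sub_apply] at e1 e2 e3
  rw [e1, e2, e3, lintegral_prod _ hres.aestronglyMeasurable.enorm] at h
  exact h.trans (add_le_add le_rfl (lintegral_mono_set (Ioc_subset_Ioc_left ha.le)))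

/-- An increment bound on the open interval extends to the closed one by continuity. -/
theorem le_add_of_forall_Ioo {T t : ℝ} (ht0 : 0 < t) (htT : t ≤ T) {N : ℝ → ℝ≥0∞}
    {δ : ℝ → ℝ → ℝ≥0∞} {J : ℝ≥0∞} (hN : ∀ s ∈ Icc 0 T, ∀ s' ∈ Icc 0 T, N s ≤ N s' + δ s s')
    (hδs : ∀ s s', δ s s' = δ s' s)
    (hδ : ∀ s ∈ Icc 0 T, Tendsto (fun s' => δ s' s) (𝓝[Icc 0 T] s) (𝓝 0))
    (h : ∀ a b, 0 < a → a ≤ b → b < t → N b ≤ N a + J) : N t ≤ N 0 + J := by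
  have hT : 0 < T := ht0.trans_le htT
  have h0 : (0 : ℝ) ∈ Icc 0 T := ⟨le_rfl, hT.le⟩
  have ht : t ∈ Icc 0 T := ⟨ht0.le, htT⟩
  have hl1 : Tendsto (fun ε : ℝ => ε) (𝓝[>] 0) (𝓝[Icc 0 T] 0) := by
    refine tendsto_nhdsWithin_iff.2 ⟨tendsto_id.mono_left nhdsWithin_le_nhds, ?_⟩
    filter_upwards [Ioc_mem_nhdsGT hT] with ε hε using ⟨hε.1.le, hε.2⟩
  have hl2 : Tendsto (fun ε : ℝ => t - ε) (𝓝[>] 0) (𝓝[Icc 0 T] t) := by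
    refine tendsto_nhdsWithin_iff.2 ⟨?_, ?_⟩
    · have : Tendsto (fun ε : ℝ => t - ε) (𝓝 0) (𝓝 (t - 0)) :=
        (continuous_const.sub continuous_id).tendsto 0
      rw [sub_zero] at this
      exact this.mono_left nhdsWithin_le_nhds
    · filter_upwards [Ioc_mem_nhdsGT ht0] with ε hε using
        ⟨sub_nonneg.2 hε.2, (sub_le_self _ hε.1.le).trans htT⟩
  have hlim : Tendsto (fun ε => N 0 + δ ε 0 + J + δ (t - ε) t) (𝓝[>] 0)
      (𝓝 (N 0 + 0 + J + 0)) :=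
    ((tendsto_const_nhds.add ((hδ 0 h0).comp hl1)).add tendsto_const_nhds).add
      ((hδ t ht).comp hl2)
  rw [add_zero, add_zero] at hlim
  refine ge_of_tendsto hlim ?_
  -- The bound `ε ≤ t / 2` ensures `ε ≤ t - ε`, so both points are usable in the interior
  -- inequality.
  filter_upwards [Ioc_mem_nhdsGT (half_pos ht0)] with ε hε
  have hab : ε ≤ t - ε := by linarith [hε.2]
  have hbt : t - ε < t := sub_lt_self _ hε.1
  have haT : ε ∈ Icc 0 T := ⟨hε.1.le, by linarith⟩
  have hbT : t - ε ∈ Icc 0 T := ⟨hε.1.le.trans hab, hbt.le.trans htT⟩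
  calc N t ≤ N (t - ε) + δ (t - ε) t := hδs t (t - ε) ▸ hN t ht _ hbT
    _ ≤ (N ε + J) + δ (t - ε) t := add_le_add (h _ _ hε.1 hab hbt) le_rfl
    _ ≤ _ := add_le_add (add_le_add (hN ε haT 0 h0) le_rfl) le_rfl

theorem lintegral_enorm_sub_le {α : Type*} [MeasurableSpace α] {μ : Measure α} {f g f' g' : α → ℝ}
    (hf : AEStronglyMeasurable f μ) (hf' : AEStronglyMeasurable f' μ)
    (hg' : AEStronglyMeasurable g' μ) :
    ∫⁻ x, ‖f x - g x‖ₑ ∂μ ≤ ∫⁻ x, ‖f' x - g' x‖ₑ ∂μ +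
      (∫⁻ x, ‖f x - f' x‖ₑ ∂μ + ∫⁻ x, ‖g x - g' x‖ₑ ∂μ) := by
  have m1 : AEMeasurable (fun x => ‖f' x - g' x‖ₑ) μ := (hf'.sub hg').enorm
  have m2 : AEMeasurable (fun x => ‖f x - f' x‖ₑ) μ := (hf.sub hf').enorm
  rw [← lintegral_add_left' m2, ← lintegral_add_left' m1]
  refine lintegral_mono fun x => ?_
  have : f x - g x = (f' x - g' x) + ((f x - f' x) - (g x - g' x)) := by ring
  rw [this]
  exact (enorm_add_le _ _).trans (add_le_add le_rfl enorm_sub_le)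

/-- The time derivative of `u` is only locally integrable in `(0, T)`, so times `0` and `T` are
reached by L¹ continuity of `u` and `v`. The integral of the residual from `0` serves as a common
upper bound. -/
theorem IsStrongSolution.lintegral_sub_le (hlr : ∀ i, l i < r i) (hT : 0 < T)
    (hu : IsStrongSolution l r T u₀ u) (hv : IsAdmissible l r T v) {t : ℝ} (ht : t ∈ Icc 0 T) :
    ∫⁻ x, ‖u t x - v t x‖ₑ ∂(boxMeasure l r) ≤ ∫⁻ x, ‖u 0 x - v 0 x‖ₑ ∂(boxMeasure l r) +
      ∫⁻ s in Ioc 0 t, ∫⁻ x, ‖residual v s x‖ₑ ∂(boxMeasure l r) := by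
  rcases ht.1.eq_or_lt with rfl | ht0
  · exact le_self_add
  refine le_add_of_forall_Ioo (N := fun s => ∫⁻ x, ‖u s x - v s x‖ₑ ∂(boxMeasure l r))
    (δ := fun s s' => ∫⁻ x, ‖u s x - u s' x‖ₑ ∂(boxMeasure l r) +
      ∫⁻ x, ‖v s x - v s' x‖ₑ ∂(boxMeasure l r)) ht0 ht.2 (fun s hs s' hs' => ?_) (fun s s' => ?_)
    (fun s hs => ?_) fun a b ha hab hb => ?_
  · exact lintegral_enorm_sub_le (hu.integrable hs).aestronglyMeasurable
      (hu.integrable hs').aestronglyMeasurable (hv.integrable_slice hs').aestronglyMeasurable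
  · congr 1 <;> exact lintegral_congr fun x => enorm_sub_rev _ _
  · simpa only [add_zero] using (hu.tendsto_lintegral hs).add (hv.tendsto_lintegral hs)
  · exact (hu.lintegral_sub_le_of_Ioo hlr hT hv ha hab (hb.trans_le ht.2)).trans
      (add_le_add le_rfl (lintegral_mono_set (Ioc_subset_Ioc_right hb.le)))

theorem sq_lintegral_le {α : Type*} [MeasurableSpace α] {μ : Measure α} {f : α → ℝ≥0∞}
    (hf : AEMeasurable f μ) : (∫⁻ x, f x ∂μ) ^ 2 ≤ μ univ * ∫⁻ x, f x ^ 2 ∂μ := by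
  have h := ENNReal.lintegral_mul_le_Lp_mul_Lq μ Real.HolderConjugate.two_two
    (aemeasurable_const (b := (1 : ℝ≥0∞))) hf
  simp only [Pi.mul_apply, one_mul, ENNReal.one_rpow, lintegral_const] at h
  calc (∫⁻ x, f x ∂μ) ^ 2
      ≤ ((μ univ) ^ (1 / 2 : ℝ) * (∫⁻ x, f x ^ (2 : ℝ) ∂μ) ^ (1 / 2 : ℝ)) ^ 2 := by gcongr
    _ = μ univ * ∫⁻ x, f x ^ 2 ∂μ := by
      rw [mul_pow, ← ENNReal.rpow_natCast, ← ENNReal.rpow_natCast, ← ENNReal.rpow_mul,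
        ← ENNReal.rpow_mul]
      norm_num

theorem eLpNorm_two_sq_eq_lintegral {α : Type*} [MeasurableSpace α] {μ : Measure α} (f : α → ℝ) :
    eLpNorm f 2 μ ^ 2 = ∫⁻ x, ‖f x‖ₑ ^ 2 ∂μ := by
  have h := eLpNorm_nnreal_pow_eq_lintegral (f := f) (μ := μ) (p := 2) two_ne_zero
  simpa using h

end Estimates

/-! ### Comparison with the loss functionals -/

section Loss

variable {d : ℕ} {l r : Fin d → ℝ} {T : ℝ} {v : ℝ → EuclideanSpace ℝ (Fin d) → ℝ}
  {u₀ : EuclideanSpace ℝ (Fin d) → ℝ} {u : ℝ → EuclideanSpace ℝ (Fin d) → ℝ}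

theorem IsStrongSolution.eLpNorm_sub_le (hlr : ∀ i, l i < r i) (hT : 0 < T)
    (hu : IsStrongSolution l r T u₀ u) (hv : IsAdmissible l r T v) {t : ℝ} (ht : t ∈ Icc 0 T) :
    eLpNorm (fun x => u t x - v t x) 1 (boxMeasure l r) ≤
      eLpNorm (fun x => u₀ x - v 0 x) 1 (boxMeasure l r) +
        ∫⁻ s in Ioc 0 t, eLpNorm (residual v s) 1 (boxMeasure l r) := by
  simp only [eLpNorm_one_eq_lintegral_enorm]
  refine (hu.lintegral_sub_le hlr hT hv ht).trans_eq ?_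
  congr 1
  exact lintegral_congr_ae (hu.initial.mono fun x hx => by simp only [hx])

theorem IsStrongSolution.aestronglyMeasurable_initial_sub (hT : 0 < T)
    (hu : IsStrongSolution l r T u₀ u) (hv : IsAdmissible l r T v) :
    AEStronglyMeasurable (fun x => u₀ x - v 0 x) (boxMeasure l r) :=
  ((hu.integrable ⟨le_rfl, hT.le⟩).aestronglyMeasurable.congr hu.initial).sub
    (hv.integrable_slice ⟨le_rfl, hT.le⟩).aestronglyMeasurable

/-- The factor `κ⁻¹ + ν⁻¹` dominates both inverse weights; the boundary term is nonnegative and is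
dropped, so `μ` plays no role in the constant. -/
theorem le_mul_pinnLoss {κ μ ν : ℝ≥0} (hκ : 0 < κ) (hν : 0 < ν) (p : ℕ) :
    lossInitial p l r u₀ v + lossPDE p l r T v ≤
      ((κ⁻¹ + ν⁻¹ : ℝ≥0) : ℝ≥0∞) * pinnLoss p l r T κ μ ν u₀ v := by
  have h1 : (1 : ℝ≥0∞) ≤ ((κ⁻¹ + ν⁻¹ : ℝ≥0) : ℝ≥0∞) * κ := by
    rw [← ENNReal.coe_mul, add_mul, inv_mul_cancel₀ hκ.ne']
    exact_mod_cast le_self_add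
  have h2 : (1 : ℝ≥0∞) ≤ ((κ⁻¹ + ν⁻¹ : ℝ≥0) : ℝ≥0∞) * ν := by
    rw [← ENNReal.coe_mul, add_mul, inv_mul_cancel₀ hν.ne']
    exact_mod_cast le_add_self
  rw [pinnLoss, mul_add, mul_add, ← mul_assoc, ← mul_assoc _ (ν : ℝ≥0∞), add_comm]
  refine add_le_add (le_add_right ?_) ?_
  · exact (one_mul _).symm.le.trans (mul_le_mul_left h1 _)
  · exact (one_mul _).symm.le.trans (mul_le_mul_left h2 _)

theorem lintegral_initial_eq (p : ℕ) :
    ∫⁻ x, ‖u₀ x - v 0 x‖ₑ ^ p ∂(boxMeasure l r) = lossInitial p l r u₀ v :=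
  lintegral_congr fun x => by rw [enorm_sub_rev]

theorem IsAdmissible.one_le_pinnLoss (hv : IsAdmissible l r T v) {κ μ ν : ℝ≥0} (hκ : 0 < κ)
    (hν : 0 < ν) {t : ℝ} (ht : t ≤ T) :
    eLpNorm (fun x => u₀ x - v 0 x) 1 (boxMeasure l r) +
        ∫⁻ s in Ioc 0 t, eLpNorm (residual v s) 1 (boxMeasure l r) ≤
      ((κ⁻¹ + ν⁻¹ : ℝ≥0) : ℝ≥0∞) * pinnLoss 1 l r T κ μ ν u₀ v := by
  refine le_trans ?_ (le_mul_pinnLoss hκ hν 1)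
  have h1 := lintegral_initial_eq (l := l) (r := r) (u₀ := u₀) (v := v) 1
  have h2 := hv.lintegral_residual_le_lossPDE ht 1
  simp only [pow_one] at h1 h2
  simp only [eLpNorm_one_eq_lintegral_enorm]
  exact add_le_add h1.le h2

theorem IsAdmissible.two_le_pinnLoss (hv : IsAdmissible l r T v) {κ μ ν : ℝ≥0} (hκ : 0 < κ)
    (hν : 0 < ν) {t : ℝ} (ht : t ≤ T) :
    eLpNorm (fun x => u₀ x - v 0 x) 2 (boxMeasure l r) ^ 2 +
        ∫⁻ s in Ioc 0 t, eLpNorm (residual v s) 2 (boxMeasure l r) ^ 2 ≤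
      ((κ⁻¹ + ν⁻¹ : ℝ≥0) : ℝ≥0∞) * pinnLoss 2 l r T κ μ ν u₀ v := by
  refine le_trans ?_ (le_mul_pinnLoss hκ hν 2)
  simp only [eLpNorm_two_sq_eq_lintegral]
  exact add_le_add (lintegral_initial_eq 2).le (hv.lintegral_residual_le_lossPDE ht 2)

theorem sq_add_le_two_mul (a b : ℝ≥0∞) : (a + b) ^ 2 ≤ 2 * (a ^ 2 + b ^ 2) := by
  have h := ENNReal.rpow_add_le_mul_rpow_add_rpow a b one_le_two
  norm_num at h
  exact h

/-- The constant of the squared estimate. -/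
noncomputable def stabilityConstant (l r : Fin d → ℝ) (T : ℝ) : ℝ≥0 :=
  2 * (((boxMeasure l r) univ).toNNReal * (1 + T.toNNReal)) + 1

/-- After `(a + b)² ≤ 2 (a² + b²)`, Cauchy-Schwarz costs the measure `|Ω|` for the initial term and
at most `T |Ω|` for the residual. Both are at most `|Ω| (1 + T)`; the additional `1` in the constant
makes it visibly positive. -/
theorem IsStrongSolution.sq_le (hT : 0 < T) (hu : IsStrongSolution l r T u₀ u)
    (hv : IsAdmissible l r T v) {t : ℝ} (ht : t ≤ T) :
    (eLpNorm (fun x => u₀ x - v 0 x) 1 (boxMeasure l r) +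
        ∫⁻ s in Ioc 0 t, eLpNorm (residual v s) 1 (boxMeasure l r)) ^ 2 ≤
      stabilityConstant l r T * (eLpNorm (fun x => u₀ x - v 0 x) 2 (boxMeasure l r) ^ 2 +
        ∫⁻ s in Ioc 0 t, eLpNorm (residual v s) 2 (boxMeasure l r) ^ 2) := by
  simp only [eLpNorm_two_sq_eq_lintegral, eLpNorm_one_eq_lintegral_enorm]
  have h1 := sq_lintegral_le (hu.aestronglyMeasurable_initial_sub hT hv).enorm
  have h2 := sq_lintegral_le (hv.aestronglyMeasurable_residual ht).enorm
  have e1 := hv.lintegral_residual ht 1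
  have e2 := hv.lintegral_residual ht 2
  simp only [pow_one] at e1
  rw [← e1, ← e2] at h2
  set m := (boxMeasure l r) univ
  have hm : ((m.toNNReal : ℝ≥0) : ℝ≥0∞) = m := ENNReal.coe_toNNReal (measure_ne_top _ _)
  have hvol : ((volume.restrict (Ioo 0 t)).prod (boxMeasure l r)) univ ≤ T.toNNReal * m := by
    rw [← univ_prod_univ, Measure.prod_prod, Measure.restrict_apply_univ, Real.volume_Ioo, sub_zero]
    gcongr
    exact ENNReal.ofReal_le_ofReal ht
  set A := ∫⁻ x, ‖u₀ x - v 0 x‖ₑ ^ 2 ∂(boxMeasure l r)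
  set B := ∫⁻ s in Ioc 0 t, ∫⁻ x, ‖residual v s x‖ₑ ^ 2 ∂(boxMeasure l r)
  have hc : ((stabilityConstant l r T : ℝ≥0) : ℝ≥0∞) = 2 * (m * (1 + T.toNNReal)) + 1 := by
    rw [stabilityConstant]
    push_cast
    rw [hm]
  rw [hc]
  calc _ ≤ 2 * (m * A + T.toNNReal * m * B) :=
        (sq_add_le_two_mul _ _).trans (by gcongr; exact h2.trans (by gcongr))
    _ ≤ 2 * (m * (1 + T.toNNReal) * A + m * (1 + T.toNNReal) * B) := by
        refine mul_le_mul_right (add_le_add (mul_le_mul_left ?_ _) (mul_le_mul_left ?_ _)) _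
        · exact le_mul_of_one_le_right' le_self_add
        · exact (mul_comm _ _).le.trans (mul_le_mul_right le_add_self _)
    _ = 2 * (m * (1 + T.toNNReal)) * (A + B) := by ring
    _ ≤ _ := by
        gcongr
        exact le_self_add

end Loss

end QPME

theorem mainTheorem1 {d : ℕ} (hd : 0 < d) (l r : Fin d → ℝ) (hlr : ∀ i, l i < r i)
    (T : ℝ) (hT : 0 < T) :
    ∃ C : ℝ≥0, 0 < C ∧ ∀ κ μ ν : ℝ≥0, 0 < κ → 0 < ν →
      ∃ C₁ C₂ : ℝ≥0, 0 < C₁ ∧ 0 < C₂ ∧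
        ∀ (u₀ : EuclideanSpace ℝ (Fin d) → ℝ) (u : ℝ → EuclideanSpace ℝ (Fin d) → ℝ),
          QPME.IsStrongSolution l r T u₀ u →
          (∀ v : ℝ → EuclideanSpace ℝ (Fin d) → ℝ, QPME.IsAdmissible l r T v →
            ∀ t ∈ Icc 0 T,
              (eLpNorm (fun x => u t x - v t x) 1 (QPME.boxMeasure l r) ≤
                  eLpNorm (fun x => u₀ x - v 0 x) 1 (QPME.boxMeasure l r) +
                    ∫⁻ s in Ioc 0 t, eLpNorm (QPME.residual v s) 1 (QPME.boxMeasure l r)) ∧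
              (eLpNorm (fun x => u₀ x - v 0 x) 1 (QPME.boxMeasure l r) +
                    ∫⁻ s in Ioc 0 t, eLpNorm (QPME.residual v s) 1 (QPME.boxMeasure l r) ≤
                  C₁ * QPME.pinnLoss 1 l r T κ μ ν u₀ v) ∧
              (eLpNorm (fun x => u t x - v t x) 1 (QPME.boxMeasure l r) ^ 2 ≤
                  C * (eLpNorm (fun x => u₀ x - v 0 x) 2 (QPME.boxMeasure l r) ^ 2 +
                    ∫⁻ s in Ioc 0 t, eLpNorm (QPME.residual v s) 2 (QPME.boxMeasure l r) ^ 2)) ∧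
              (C * (eLpNorm (fun x => u₀ x - v 0 x) 2 (QPME.boxMeasure l r) ^ 2 +
                    ∫⁻ s in Ioc 0 t, eLpNorm (QPME.residual v s) 2 (QPME.boxMeasure l r) ^ 2) ≤
                  C₂ * QPME.pinnLoss 2 l r T κ μ ν u₀ v)) ∧
          (∀ v : ℕ → ℝ → EuclideanSpace ℝ (Fin d) → ℝ, (∀ n, QPME.IsAdmissible l r T (v n)) →
            (Tendsto (fun n => QPME.pinnLoss 1 l r T κ μ ν u₀ (v n)) atTop (𝓝 0) ∨
              Tendsto (fun n => QPME.pinnLoss 2 l r T κ μ ν u₀ (v n)) atTop (𝓝 0)) →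
            Tendsto (fun n => ⨆ t ∈ Icc 0 T,
              eLpNorm (fun x => u t x - v n t x) 1 (QPME.boxMeasure l r)) atTop (𝓝 0)) := by
  refine ⟨QPME.stabilityConstant l r T, by unfold QPME.stabilityConstant; positivity,
    fun κ μ ν hκ hν => ⟨κ⁻¹ + ν⁻¹, QPME.stabilityConstant l r T * (κ⁻¹ + ν⁻¹), by positivity,
      mul_pos (by unfold QPME.stabilityConstant; positivity) (by positivity), fun u₀ u hu => ?_⟩⟩
  have h2 : ∀ v : ℝ → EuclideanSpace ℝ (Fin d) → ℝ, QPME.IsAdmissible l r T v → ∀ t ∈ Icc 0 T,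
      (QPME.stabilityConstant l r T : ℝ≥0∞) *
          (eLpNorm (fun x => u₀ x - v 0 x) 2 (QPME.boxMeasure l r) ^ 2 +
            ∫⁻ s in Ioc 0 t, eLpNorm (QPME.residual v s) 2 (QPME.boxMeasure l r) ^ 2) ≤
        ((QPME.stabilityConstant l r T * (κ⁻¹ + ν⁻¹) : ℝ≥0) : ℝ≥0∞) *
          QPME.pinnLoss 2 l r T κ μ ν u₀ v := fun v hv t ht => by
    rw [ENNReal.coe_mul, mul_assoc]
    exact mul_le_mul_right (hv.two_le_pinnLoss hκ hν ht.2) _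
  have h1 : ∀ v : ℝ → EuclideanSpace ℝ (Fin d) → ℝ, QPME.IsAdmissible l r T v → ∀ t ∈ Icc 0 T,
      eLpNorm (fun x => u t x - v t x) 1 (QPME.boxMeasure l r) ^ 2 ≤
        QPME.stabilityConstant l r T *
          (eLpNorm (fun x => u₀ x - v 0 x) 2 (QPME.boxMeasure l r) ^ 2 +
            ∫⁻ s in Ioc 0 t, eLpNorm (QPME.residual v s) 2 (QPME.boxMeasure l r) ^ 2) :=
    fun v hv t ht =>
      (pow_le_pow_left' (hu.eLpNorm_sub_le hlr hT hv ht) 2).trans (hu.sq_le hT hv ht.2)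
  refine ⟨fun v hv t ht => ⟨hu.eLpNorm_sub_le hlr hT hv ht, hv.one_le_pinnLoss hκ hν ht.2,
    h1 v hv t ht, h2 v hv t ht⟩, fun v hv hlim => ?_⟩
  rcases hlim with hlim | hlim
  · have h := ENNReal.Tendsto.const_mul (a := ((κ⁻¹ + ν⁻¹ : ℝ≥0) : ℝ≥0∞)) hlim
      (Or.inr ENNReal.coe_ne_top)
    rw [mul_zero] at h
    refine tendsto_of_tendsto_of_tendsto_of_le_of_le tendsto_const_nhds h (fun _ => zero_le)
      fun n => iSup₂_le fun t ht => ?_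
    exact (hu.eLpNorm_sub_le hlr hT (hv n) ht).trans ((hv n).one_le_pinnLoss hκ hν ht.2)
  -- The second chain bounds the square of the L¹ norm uniformly in time, so the bound on the
  -- supremum is the square root of `C₂` times the loss.
  · have h := (ENNReal.Tendsto.const_mul
      (a := ((QPME.stabilityConstant l r T * (κ⁻¹ + ν⁻¹) : ℝ≥0) : ℝ≥0∞)) hlim
      (Or.inr ENNReal.coe_ne_top)).ennrpow_const (1 / 2 : ℝ)
    rw [mul_zero, ENNReal.zero_rpow_of_pos (by norm_num)] at h
    refine tendsto_of_tendsto_of_tendsto_of_le_of_le tendsto_const_nhds h (fun _ => zero_le)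
      fun n => iSup₂_le fun t ht => ?_
    rw [one_div, ENNReal.le_rpow_inv_iff (by norm_num), ENNReal.rpow_two]
    exact (h1 _ (hv n) t ht).trans (h2 _ (hv n) t ht)
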